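/- Let $W$ be a finite group acting faithfully on a finite-dimensional complex vector space $\mathfrak h$; let $S\subset W$ be the set of reflections (elements $s\neq 1$ with $\operatorname{rk}(s-1)=1$ on $\mathfrak h$), and let $c:S\to\mathbb C$ be invariant under conjugation by $W$. For $s\in S$ let $\alpha_s\in\mathfrak h^*$ and $\alpha_s^\vee\in\mathfrak h$ be generators of the images of $s-1$ on $\mathfrak h^*$ and on $\mathfrak h$ with $(\alpha_s,\alpha_s^\vee)=2$. The rational Cherednik algebra $H_c(W,\mathfrak h)$ is the quotient of $\mathbb CW\ltimes T(\mathfrak h\oplus\mathfrak h^*)$ by the relations $$[x,x']=0,\qquad [y,y']=0,\qquad [y,x]=(y,x)-\sum_{s\in S}c_s\,(y,\alpha_s)(x,\alpha_s^\vee)\,s\qquad(x,x'\in\mathfrak h^*,\ y,y'\in\mathfrak h).$$ For $\lambda\in\mathfrak h^*$ let $\mathcal O_c(W,\mathfrak h)_\lambda$ be the full subcategory of $H_c(W,\mathfrak h)$-modules that are finitely generated over $\mathbb C[\mathfrak h]=S\mathfrak h^*$, locally finite under $\mathfrak h$, and on which $\mathbb C[\mathfrak h^*]^W=(S\mathfrak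 h)^W$ acts with generalized eigenvalue $\lambda$ (that is, $p-p(\lambda)$ is locally nilpotent for every $p\in\mathbb C[\mathfrak h^*]^W$). Let $W_\lambda$ be the stabilizer of $\lambda$ in $W$, $\bar{\mathfrak h}=\mathfrak h/\mathfrak h^{W_\lambda}$, and $c'$ the restriction of $c$ to the reflections in $W_\lambda$. Then: 1. An $H_c(W,\mathfrak h)$-module belongs to $\mathcal O_c(W,\mathfrak h)_\lambda$ if and only if it is finitely generated over $\mathbb C[\mathfrak h]$ and $\mathbb C[\mathfrak h^*]^W$ acts on it with generalized eigenvalue $\lambda$. 2. There is a natural equivalence of categories $$\psi_\lambda:\ \mathcal O_c(W,\mathfrak h)_\lambda\ \longrightarrow\ \mathcal O_{c'}(W_\lambda,\bar{\mathfrak h})_0 .$$ For $\mu\in\mathfrak h^*$ let $M_\mu$ denote the generalized eigenspace of $\mathfrak h$ in $M$ of weight $\mu$. The equivalence can be chosen so that, functorially in $M$, the vector space underlying $\psi_\lambda(M)$ is $$\{v\in M_\lambda:\ yv=\lambda(y)v\ \text{ for all } y\in\mathfrak h^{W_\lambda}\},$$ on which $W_\lambda$ acts as in $M$, the class in $\bar{\mathfrak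 h}$ of $y\in\mathfrak h$ acts as $y-\lambda(y)$, and $x\in\bar{\mathfrak h}^*\subset\mathfrak h^*$ acts by sending $v$ to an element congruent to $xv$ modulo $\sum_{\mu\ne\lambda}M_\mu$ (the component of $xv$ in $M_\lambda$). -/

import Mathlib

open CategoryTheory Module
open scoped ModuleCat

universe u

noncomputable section

namespace Cherednik

section SymmetricLift

variable {U A : Type*} [AddCommGroup U] [Module ℂ U] [Ring A] [Algebra ℂ A]

theorem adjoin_range_comm (f : U →ₗ[ℂ] A) (hf : ∀ u v, f u * f v = f v * f u)
    (a b : Algebra.adjoin ℂ (Set.range f)) : a * b = b * a :=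
  (Algebra.isMulCommutative_adjoin ℂ (s := Set.range f) (by
    rintro _ ⟨u, rfl⟩ _ ⟨v, rfl⟩
    exact hf u v)).is_comm.comm a b

/-- The commutative semiring structure on the subalgebra generated by the values of `f`. -/
abbrev adjoinCommSemiring (f : U →ₗ[ℂ] A) (hf : ∀ u v, f u * f v = f v * f u) :
    CommSemiring (Algebra.adjoin ℂ (Set.range f)) :=
  { (Algebra.adjoin ℂ (Set.range f)).toSemiring with mul_comm := adjoin_range_comm f hf }

/-- The map `f`, with values in the subalgebra that it generates. -/
def toAdjoin (f : U →ₗ[ℂ] A) : U →ₗ[ℂ] Algebra.adjoin ℂ (Set.range f) where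
  toFun u := ⟨f u, Algebra.subset_adjoin ⟨u, rfl⟩⟩
  map_add' u v := Subtype.ext (map_add f u v)
  map_smul' a u := Subtype.ext (map_smul f a u)

/-- The algebra homomorphism `S(U) → A` extending a linear map `f : U → A` whose values commute
(the algebra `A` need not be commutative). -/
def symLift (f : U →ₗ[ℂ] A) (hf : ∀ u v, f u * f v = f v * f u) :
    SymmetricAlgebra ℂ U →ₐ[ℂ] A :=
  letI := adjoinCommSemiring f hf
  (Algebra.adjoin ℂ (Set.range f)).val.comp
    (SymmetricAlgebra.lift (R := ℂ) (A := Algebra.adjoin ℂ (Set.range f)) (toAdjoin f))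

theorem symLift_ι (f : U →ₗ[ℂ] A) (hf : ∀ u v, f u * f v = f v * f u) (u : U) :
    symLift f hf (SymmetricAlgebra.ι ℂ U u) = f u := by
  let _ := adjoinCommSemiring f hf
  exact congrArg Subtype.val
    (SymmetricAlgebra.lift_ι_apply (R := ℂ) (A := Algebra.adjoin ℂ (Set.range f)) (toAdjoin f) u)

end SymmetricLift

variable {V W : Type u} [AddCommGroup V] [Module ℂ V] [Group W]

/-- A reflection: an element `s ≠ 1` such that `s - 1` has rank one on `V`. -/
def IsReflection (ρ : Representation ℂ W V) (s : W) : Prop :=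
  s ≠ 1 ∧ finrank ℂ (LinearMap.range (ρ s - 1)) = 1

/-- `α s ∈ V*` and `αv s ∈ V` are roots and coroots: for every reflection `s`, they generate the
images of `s - 1` on `V*` and on `V`, and `⟨α s, αv s⟩ = 2`. Values at other `s` play no role. -/
def IsRootFamily (ρ : Representation ℂ W V) (α : W → Dual ℂ V) (αv : W → V) : Prop :=
  ∀ s, IsReflection ρ s →
    Submodule.span ℂ {α s} = LinearMap.range (ρ.dual s - 1) ∧
    Submodule.span ℂ {αv s} = LinearMap.range (ρ s - 1) ∧
    α s (αv s) = 2

theorem exists_root_coroot [Finite W] (ρ : Representation ℂ W V) (s : W)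
    (hs : IsReflection ρ s) :
    ∃ (a : Dual ℂ V) (b : V),
      Submodule.span ℂ {a} = LinearMap.range (ρ.dual s - 1) ∧
      Submodule.span ℂ {b} = LinearMap.range (ρ s - 1) ∧ a b = 2 := by
  obtain ⟨u, hu, hspan⟩ : ∃ u : V, u ≠ 0 ∧
      LinearMap.range (ρ s - 1) = Submodule.span ℂ {u} := by
    obtain ⟨v, hv, hall⟩ := finrank_eq_one_iff'.1 hs.2
    refine ⟨v, fun h => hv (Subtype.ext h), le_antisymm ?_ ?_⟩
    · intro z hz
      obtain ⟨a, ha⟩ := hall ⟨z, hz⟩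
      exact Submodule.mem_span_singleton.2 ⟨a, congrArg Subtype.val ha⟩
    · rw [Submodule.span_singleton_le_iff_mem]
      exact v.2
  have hmem : ∀ y, (ρ s - 1) y ∈ Submodule.span ℂ {u} := fun y => hspan ▸ ⟨y, rfl⟩
  let f : Dual ℂ V := (LinearEquiv.toSpanNonzeroSingleton ℂ V u hu).symm.toLinearMap ∘ₗ
    (ρ s - 1).codRestrict (Submodule.span ℂ {u}) hmem
  have hf : ∀ y, ρ s y = y + f y • u := by
    intro y
    have h := (LinearEquiv.toSpanNonzeroSingleton ℂ V u hu).apply_symm_apply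
      ((ρ s - 1).codRestrict (Submodule.span ℂ {u}) hmem y)
    have h2 := congrArg Subtype.val h
    rw [LinearEquiv.toSpanNonzeroSingleton_apply] at h2
    have h3 : f y • u = ρ s y - y := h2
    rw [h3]
    abel
  have hfu : f u ≠ 0 := by
    intro h0
    have hn : ∀ (n : ℕ) (y : V), ρ (s ^ n) y = y + ((n : ℂ) * f y) • u := by
      intro n
      induction n with
      | zero => intro y; simp
      | succ k ih =>
        intro y
        rw [pow_succ, map_mul, End.mul_apply, hf, ih, map_add, map_smul, h0]
        push_cast
        simp only [smul_zero, add_zero]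
        rw [add_assoc, ← add_smul]
        congr 2
        ring
    have hz : ρ s - 1 = 0 := by
      ext y
      have h1 := hn (orderOf s) y
      rw [pow_orderOf_eq_one, map_one, End.one_apply] at h1
      have h2 : ((orderOf s : ℂ) * f y) • u = 0 := by simpa using h1
      have h3 : (orderOf s : ℂ) ≠ 0 := by exact_mod_cast (orderOf_pos s).ne'
      have h4 : f y = 0 := by
        rcases smul_eq_zero.1 h2 with h | h
        · exact (mul_eq_zero.1 h).resolve_left h3
        · exact absurd h hu
      simp [hf, h4]
    have h1 := hs.2
    rw [hz, LinearMap.range_zero, finrank_bot] at h1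
    exact zero_ne_one h1
  have hinv : ∀ y, ρ s⁻¹ (ρ s y) = y := by
    intro y
    rw [← End.mul_apply, ← map_mul]
    simp
  have hsu : ρ s u = (1 + f u) • u := by rw [hf, add_smul, one_smul]
  have ht : 1 + f u ≠ 0 := by
    intro h
    have h1 := hinv u
    rw [hsu, h, zero_smul, map_zero] at h1
    exact hu h1.symm
  have hsu' : ρ s⁻¹ u = (1 + f u)⁻¹ • u := by
    have h1 := hinv u
    rw [hsu, map_smul] at h1
    rw [eq_inv_smul_iff₀ ht, h1]
  have hd : ∀ ξ : Dual ℂ V, (ρ.dual s - 1) ξ = (-((1 + f u)⁻¹ * ξ u)) • f := by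
    intro ξ
    ext y
    have h1 := hinv y
    rw [hf, map_add, map_smul, hsu'] at h1
    have h2 : ρ s⁻¹ y = y - f y • (1 + f u)⁻¹ • u := by
      rw [eq_sub_iff_add_eq]; exact h1
    change ξ (ρ s⁻¹ y) - ξ y = -((1 + f u)⁻¹ * ξ u) * f y
    rw [h2]
    simp only [map_sub, map_smul, smul_eq_mul]
    ring
  refine ⟨(2 / f u) • f, u, ?_, hspan.symm, ?_⟩
  · rw [Submodule.span_singleton_smul_eq (IsUnit.mk0 _ (div_ne_zero two_ne_zero hfu))]
    apply le_antisymm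
    · rw [Submodule.span_singleton_le_iff_mem]
      refine ⟨(-((1 + f u) * (f u)⁻¹)) • f, ?_⟩
      rw [hd]
      have : -((1 + f u)⁻¹ * ((-((1 + f u) * (f u)⁻¹)) • f) u) = 1 := by
        simp only [LinearMap.smul_apply, smul_eq_mul]
        field_simp
      rw [this, one_smul]
    · rintro _ ⟨ξ, rfl⟩
      rw [hd]
      exact Submodule.smul_mem _ _ (Submodule.mem_span_singleton_self f)
  · simp only [LinearMap.smul_apply, smul_eq_mul]
    field_simp

/-- For a finite group, roots and coroots exist. -/
theorem exists_isRootFamily [Finite W] (ρ : Representation ℂ W V) :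
    ∃ (α : W → Dual ℂ V) (αv : W → V), IsRootFamily ρ α αv := by
  classical
  have h : ∀ s : W, ∃ (a : Dual ℂ V) (b : V), IsReflection ρ s →
      Submodule.span ℂ {a} = LinearMap.range (ρ.dual s - 1) ∧
      Submodule.span ℂ {b} = LinearMap.range (ρ s - 1) ∧ a b = 2 := by
    intro s
    by_cases hs : IsReflection ρ s
    · obtain ⟨a, b, hab⟩ := exists_root_coroot ρ s hs
      exact ⟨a, b, fun _ => hab⟩
    · exact ⟨0, 0, fun h => absurd h hs⟩
  choose α αv hα using h
  exact ⟨α, αv, hα⟩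

section Algebra

/-- The free algebra on the (underlying sets of the) group `W`, the space `V` and its dual. -/
abbrev FreeAlg (V W : Type u) [AddCommGroup V] [Module ℂ V] : Type u :=
  FreeAlgebra ℂ (W ⊕ V ⊕ Dual ℂ V)

/-- The generator `w ∈ W`. -/
def fg (V : Type u) {W : Type u} [AddCommGroup V] [Module ℂ V] (w : W) : FreeAlg V W :=
  FreeAlgebra.ι ℂ (Sum.inl w)

/-- The generator `y ∈ V`. -/
def fy (W : Type u) {V : Type u} [AddCommGroup V] [Module ℂ V] (y : V) : FreeAlg V W :=
  FreeAlgebra.ι ℂ (Sum.inr (Sum.inl y))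

/-- The generator `x ∈ V*`. -/
def fx (W : Type u) {V : Type u} [AddCommGroup V] [Module ℂ V] (x : Dual ℂ V) : FreeAlg V W :=
  FreeAlgebra.ι ℂ (Sum.inr (Sum.inr x))

/-- Defining relations of the rational Cherednik algebra. The first eight families say that the
algebra is a quotient of the smash product `ℂW ⋉ T(V ⊕ V*)`; the last three are
`[x, x'] = 0`, `[y, y'] = 0` and
`[y, x] = ⟨y, x⟩ - ∑ c_s ⟨y, α_s⟩ ⟨x, α_s^∨⟩ s`, the sum being over all reflections `s`. The
products `⟨y, α_s⟩ ⟨x, α_s^∨⟩` do not depend on the choice of roots and coroots. -/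
inductive Rel (ρ : Representation ℂ W V) (c : W → ℂ) : FreeAlg V W → FreeAlg V W → Prop
  | g_one : Rel ρ c (fg V 1) 1
  | g_mul (w w' : W) : Rel ρ c (fg V (w * w')) (fg V w * fg V w')
  | y_add (y y' : V) : Rel ρ c (fy W (y + y')) (fy W y + fy W y')
  | y_smul (a : ℂ) (y : V) : Rel ρ c (fy W (a • y)) (a • fy W y)
  | x_add (x x' : Dual ℂ V) : Rel ρ c (fx W (x + x')) (fx W x + fx W x')
  | x_smul (a : ℂ) (x : Dual ℂ V) : Rel ρ c (fx W (a • x)) (a • fx W x)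
  | g_y (w : W) (y : V) : Rel ρ c (fg V w * fy W y) (fy W (ρ w y) * fg V w)
  | g_x (w : W) (x : Dual ℂ V) : Rel ρ c (fg V w * fx W x) (fx W (ρ.dual w x) * fg V w)
  | xx (x x' : Dual ℂ V) : Rel ρ c (fx W x * fx W x') (fx W x' * fx W x)
  | yy (y y' : V) : Rel ρ c (fy W y * fy W y') (fy W y' * fy W y)
  | yx (α : W → Dual ℂ V) (αv : W → V) (hα : IsRootFamily ρ α αv) (y : V) (x : Dual ℂ V) :
      Rel ρ c (fy W y * fx W x - fx W x * fy W y)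
        (algebraMap ℂ _ (x y) -
          ∑ᶠ (s : W) (_ : IsReflection ρ s), (c s * α s y * x (αv s)) • fg V s)

/-- The rational Cherednik algebra `H_c(W, V)`. Only the values of `c` at reflections matter. -/
def RCA (ρ : Representation ℂ W V) (c : W → ℂ) : Type u := RingQuot (Rel ρ c)

instance (ρ : Representation ℂ W V) (c : W → ℂ) : Ring (RCA ρ c) :=
  inferInstanceAs (Ring (RingQuot (Rel ρ c)))

instance (ρ : Representation ℂ W V) (c : W → ℂ) : Algebra ℂ (RCA ρ c) :=
  inferInstanceAs (Algebra ℂ (RingQuot (Rel ρ c)))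

variable (ρ : Representation ℂ W V) (c : W → ℂ)

/-- The quotient map onto the rational Cherednik algebra. -/
def mk : FreeAlg V W →ₐ[ℂ] RCA ρ c := RingQuot.mkAlgHom ℂ (Rel ρ c)

theorem mk_rel {a b : FreeAlg V W} (h : Rel ρ c a b) : mk ρ c a = mk ρ c b :=
  RingQuot.mkAlgHom_rel ℂ h

/-- The image of `w ∈ W` in `H_c(W, V)`. -/
def gGen (w : W) : RCA ρ c := mk ρ c (fg V w)

/-- The map `V → H_c(W, V)`. -/
def yGen : V →ₗ[ℂ] RCA ρ c where
  toFun y := mk ρ c (fy W y)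
  map_add' y y' := by rw [mk_rel ρ c (Rel.y_add y y'), map_add]
  map_smul' a y := by rw [mk_rel ρ c (Rel.y_smul a y), map_smul, RingHom.id_apply]

/-- The map `V* → H_c(W, V)`. -/
def xGen : Dual ℂ V →ₗ[ℂ] RCA ρ c where
  toFun x := mk ρ c (fx W x)
  map_add' x x' := by rw [mk_rel ρ c (Rel.x_add x x'), map_add]
  map_smul' a x := by rw [mk_rel ρ c (Rel.x_smul a x), map_smul, RingHom.id_apply]

/-- The homomorphism `ℂ[V] = S(V*) → H_c(W, V)`. -/
def polyX : SymmetricAlgebra ℂ (Dual ℂ V) →ₐ[ℂ] RCA ρ c :=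
  symLift (xGen ρ c) fun x x' => by
    change mk ρ c (fx W x) * mk ρ c (fx W x') = mk ρ c (fx W x') * mk ρ c (fx W x)
    rw [← map_mul, mk_rel ρ c (Rel.xx x x'), map_mul]

/-- The homomorphism `ℂ[V*] = S(V) → H_c(W, V)`. -/
def polyY : SymmetricAlgebra ℂ V →ₐ[ℂ] RCA ρ c :=
  symLift (yGen ρ c) fun y y' => by
    change mk ρ c (fy W y) * mk ρ c (fy W y') = mk ρ c (fy W y') * mk ρ c (fy W y)
    rw [← map_mul, mk_rel ρ c (Rel.yy y y'), map_mul]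

end Algebra

/-- The element `p ∈ S(V) = ℂ[V*]` is invariant under `W`. -/
def IsInvariant (ρ : Representation ℂ W V) (p : SymmetricAlgebra ℂ V) : Prop :=
  ∀ w, SymmetricAlgebra.lift (SymmetricAlgebra.ι ℂ V ∘ₗ ρ w) p = p

section Modules

variable (ρ : Representation ℂ W V) (c : W → ℂ)
variable (M : Type u) [AddCommGroup M] [Module ℂ M] [Module (RCA ρ c) M]
  [IsScalarTower ℂ (RCA ρ c) M]

/-- `M` is finitely generated over `ℂ[V]`. -/
def IsFGOverPoly : Prop := Module.Finite (polyX ρ c).range M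

/-- `V` acts locally finitely on `M`: every vector lies in a finite-dimensional subspace that is
stable under all `y ∈ V`. -/
def IsLocallyFinite : Prop :=
  ∀ m : M, ∃ N : Submodule ℂ M, FiniteDimensional ℂ N ∧ m ∈ N ∧
    ∀ y : V, ∀ n ∈ N, yGen ρ c y • n ∈ N

/-- `ℂ[V*]^W` acts on `M` with generalized eigenvalue `lam ∈ V*`: for every invariant `p`, the
operator `p - p(lam)` is locally nilpotent. -/
def HasGenEigenvalue (lam : Dual ℂ V) : Prop :=
  ∀ p : SymmetricAlgebra ℂ V, IsInvariant ρ p → ∀ m : M, ∃ n : ℕ,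
    (polyY ρ c p - algebraMap ℂ (RCA ρ c) (SymmetricAlgebra.lift lam p)) ^ n • m = 0

/-- The generalized weight space of `M` for the commuting operators `y ∈ V`, of weight `μ`. -/
def genWeightSpace (μ : Dual ℂ V) : Submodule ℂ M :=
  ⨅ y : V, End.maxGenEigenspace (Algebra.lsmul ℂ ℂ M (yGen ρ c y)) (μ y)

end Modules

/-- The class of objects of `O_c(W, V)_lam`: the modules over `H_c(W, V)` that are finitely
generated over `ℂ[V]`, locally finite over `V`, and on which `ℂ[V*]^W` acts with generalized
eigenvalue `lam`. -/
def catO (ρ : Representation ℂ W V) (c : W → ℂ) (lam : Dual ℂ V) :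
    ObjectProperty (ModuleCat.{u} (RCA ρ c)) :=
  fun M => IsFGOverPoly ρ c M ∧ IsLocallyFinite ρ c M ∧ HasGenEigenvalue ρ c M lam

/-- The category `O_c(W, V)_lam`, a full subcategory of the category of `H_c(W, V)`-modules. -/
abbrev CatO (ρ : Representation ℂ W V) (c : W → ℂ) (lam : Dual ℂ V) : Type (u + 1) :=
  (catO ρ c lam).FullSubcategory

section Parabolic

variable (ρ : Representation ℂ W V) (lam : Dual ℂ V)

/-- The stabilizer `W_lam` of `lam ∈ V*`. -/
def stab : Subgroup W where
  carrier := {w | ρ.dual w lam = lam}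
  one_mem' := by
    change ρ.dual 1 lam = lam
    rw [map_one, End.one_apply]
  mul_mem' {a b} ha hb := by
    change ρ.dual (a * b) lam = lam
    rw [map_mul, End.mul_apply, show ρ.dual b lam = lam from hb]
    exact ha
  inv_mem' {a} ha := by
    change ρ.dual a⁻¹ lam = lam
    nth_rewrite 1 [← show ρ.dual a lam = lam from ha]
    rw [← End.mul_apply, ← map_mul, inv_mul_cancel, map_one, End.one_apply]

/-- The subspace of `W_lam`-invariant vectors in `V`. -/
def fixedSpace : Submodule ℂ V :=
  Representation.invariants (ρ.comp (stab ρ lam).subtype)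

/-- The representation of `W_lam` on the quotient of `V` by the `W_lam`-invariants. -/
def quotRep : Representation ℂ (stab ρ lam) (V ⧸ fixedSpace ρ lam) :=
  Representation.quotient (ρ.comp (stab ρ lam).subtype) (fixedSpace ρ lam) (by
    intro g v hv h
    have e : (ρ.comp (stab ρ lam).subtype) g v = v := hv g
    rw [e]
    exact hv h)

/-- The restriction of the parameter `c` to `W_lam`. -/
def resParam (c : W → ℂ) : stab ρ lam → ℂ := fun w => c w

end Parabolic

end Cherednik

end

/-! For the first claim, the coefficients of `∏ (X - w v)`, taken over `w` in `W`, are invariant and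
`v` is a root. Replacing them by their values at `lam` shows that `∏ (v - lam (w v))` is nilpotent
on each vector. So every vector generates a finite-dimensional module over `S(V)`, which is local
finiteness, and its weights lie in the orbit `W lam`, because a complex vector space is not a finite
union of proper subspaces. Thus `M` is the sum of the weight spaces of weights `w lam`, and `W`
permutes them.

The equivalence is a composite of two. The first sends `M` to its weight space `E` of weight `lam`.
If `t` lies outside the stabilizer and `t - 1` has image spanned by `α_t`, then `lam α_t ≠ 0`, so
`α_t` acts invertibly on `E`. Comparing `[y, x]` on different weight spaces yields `pr (x m) = x_E
(pr m) + ∑ b_t ⟨x, α_t⟩ α_t⁻¹ pr (t m)`, the sum being over `t` outside the stabilizer (`pr_x`).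
Hence the action of `x` on all of `M` is recovered from its diagonal part `x_E`. The operators `x_E`
commute because a double sum is symmetric (`sum_theta_theta`), which is the two-form identity that
makes Dunkl operators commute (`sum_wedge_coProd_eq_zero`). Read backwards, the formula defines the
action of `x` on the induced space (`indX`), where the relations have to be checked (`indY_indX`,
`indX_indX`).

The second equivalence removes the directions fixed by the stabilizer. They contribute a Weyl
algebra, on which `y - lam y` is locally nilpotent, so Taylor expansion identifies `E` with
polynomials on the fixed space with values in `N`, the vectors on which the fixed directions act
through `lam` (`taylor_surjective`, `taylor_injective`).

Everything is done for families of operators with a relation that involves no roots; `coef`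
translates the parameter, and `coef_quotRep` says that the translation is compatible with passing to
the quotient. Projecting alters the action of `x`, so generation over `ℂ[V]` is awkward to
transport. It is replaced by generation under all operators, which for these modules is equivalent
(`FG.xfg`, `catO_iff`). -/

set_option linter.unusedSectionVars false

noncomputable section

namespace Cherednik

/-! ### Operators with the Cherednik relations, and their weight spaces. -/

section Operators

section LocallyNilpotent

variable {E : Type*} [AddCommGroup E] [Module ℂ E]

/-- On a vector killed by `f`, the operator `f - c` is multiplication by `-c ≠ 0`, which is not
nilpotent unless the vector vanishes. -/
theorem eq_zero_of_apply_eq_zero {f : End ℂ E} {c : ℂ} (hc : c ≠ 0) {e : E}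
    (he : ∃ n : ℕ, ((f - c • 1) ^ n) e = 0) (h0 : f e = 0) : e = 0 := by
  obtain ⟨n, hn⟩ := he
  have h : ∀ n : ℕ, ((f - c • 1) ^ n) e = (-c) ^ n • e := by
    intro n
    induction n with
    | zero => simp
    | succ k ih =>
      rw [pow_succ, End.mul_apply]
      have : (f - c • (1 : End ℂ E)) e = (-c) • e := by simp [h0]
      rw [this, map_smul, ih, smul_smul, pow_succ']
  rw [h] at hn
  exact (smul_eq_zero.1 hn).resolve_left (pow_ne_zero _ (neg_ne_zero.2 hc))

/-- A nonzero scalar plus a locally nilpotent operator is invertible. That the preimage stays in `K`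
makes the inverse preserve stable subspaces. -/
theorem exists_apply_eq_of_mem {f : End ℂ E} {c : ℂ} (hc : c ≠ 0) (K : Submodule ℂ E)
    (hK : ∀ k ∈ K, f k ∈ K) (n : ℕ) :
    ∀ e ∈ K, ((f - c • 1) ^ n) e = 0 → ∃ k ∈ K, f k = e := by
  induction n with
  | zero =>
    intro e _ h
    exact ⟨0, K.zero_mem, by simpa using h.symm⟩
  | succ n ih =>
    intro e he h
    rw [pow_succ, End.mul_apply] at h
    have hm : (f - c • (1 : End ℂ E)) e ∈ K := by
      simpa using K.sub_mem (hK e he) (K.smul_mem c he)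
    obtain ⟨k, hk, hfk⟩ := ih _ hm h
    -- Since `f k = f e - c e`, the vector `e - k` is mapped to `c e`.
    refine ⟨c⁻¹ • (e - k), K.smul_mem _ (K.sub_mem he hk), ?_⟩
    rw [map_smul, map_sub, hfk]
    simp [smul_smul, inv_mul_cancel₀ hc]

end LocallyNilpotent

theorem dual_apply_apply {G U : Type*} [Group G] [AddCommGroup U] [Module ℂ U]
    {σ : Representation ℂ G U} (w : G) (ξ : Dual ℂ U) (u : U) : σ.dual w ξ u = ξ (σ w⁻¹ u) := rfl

/-- Operators of a group `G`, of a representation `U` of `G` and of its dual on a vector space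
`M`, subject to the relations of a rational Cherednik algebra. The relation
`[u, ξ] = ⟨u, ξ⟩ - ∑ b_s ⟨s u - u, ξ⟩ s` does not involve roots. -/
structure Operators {G U : Type*} [Group G] [Fintype G] [AddCommGroup U] [Module ℂ U]
    (σ : Representation ℂ G U) (b : G → ℂ) (M : Type*) [AddCommGroup M] [Module ℂ M] where
  g : Representation ℂ G M
  y : U →ₗ[ℂ] End ℂ M
  x : Dual ℂ U →ₗ[ℂ] End ℂ M
  g_y : ∀ w u m, g w (y u m) = y (σ w u) (g w m)
  g_x : ∀ w ξ m, g w (x ξ m) = x (σ.dual w ξ) (g w m)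
  x_x : ∀ ξ ξ' m, x ξ (x ξ' m) = x ξ' (x ξ m)
  y_y : ∀ u u' m, y u (y u' m) = y u' (y u m)
  y_x : ∀ u ξ m, y u (x ξ m) = x ξ (y u m) + ξ u • m - ∑ s, (b s * ξ (σ s u - u)) • g s m

namespace Operators

variable {G U : Type*} [Group G] [Fintype G] [AddCommGroup U] [Module ℂ U]
  {σ : Representation ℂ G U} {b : G → ℂ} {M : Type*} [AddCommGroup M] [Module ℂ M]
  {M' : Type*} [AddCommGroup M'] [Module ℂ M']

theorem comm (A : Operators σ b M) (u v : U) : A.y u * A.y v = A.y v * A.y u :=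
  LinearMap.ext (A.y_y u v)

/-- The generalized weight space of weight `μ`. -/
def wt (A : Operators σ b M) (μ : Dual ℂ U) : Submodule ℂ M :=
  ⨅ u : U, End.maxGenEigenspace (A.y u) (μ u)

theorem mem_wt {A : Operators σ b M} {μ : Dual ℂ U} {m : M} :
    m ∈ A.wt μ ↔ ∀ u, ∃ n : ℕ, ((A.y u - μ u • 1) ^ n) m = 0 := by
  simp [wt]

/-- A linear map that commutes with all operators. -/
structure Intertwines (A : Operators σ b M) (B : Operators σ b M') (f : M →ₗ[ℂ] M') : Prop where
  g : ∀ w m, f (A.g w m) = B.g w (f m)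
  y : ∀ u m, f (A.y u m) = B.y u (f m)
  x : ∀ ξ m, f (A.x ξ m) = B.x ξ (f m)

/-- A subspace that is stable under all operators. -/
structure Stable (A : Operators σ b M) (K : Submodule ℂ M) : Prop where
  g : ∀ w, ∀ m ∈ K, A.g w m ∈ K
  y : ∀ u, ∀ m ∈ K, A.y u m ∈ K
  x : ∀ ξ, ∀ m ∈ K, A.x ξ m ∈ K

/-- A finite set generates `M`. -/
def FG (A : Operators σ b M) : Prop :=
  ∃ F : Set M, F.Finite ∧ ∀ K : Submodule ℂ M, F ⊆ K → A.Stable K → K = ⊤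

theorem g_g_inv (A : Operators σ b M) (w : G) (m : M) : A.g w (A.g w⁻¹ m) = m := by
  rw [← End.mul_apply, ← map_mul]; simp

theorem g_mul (A : Operators σ b M) (w w' : G) (m : M) : A.g (w * w') m = A.g w (A.g w' m) := by
  rw [map_mul, End.mul_apply]

/-- Powers of shifted operators are intertwined. -/
theorem map_sub_pow {f : M →ₗ[ℂ] M'} {p : End ℂ M} {q : End ℂ M'} (h : ∀ m, f (p m) = q (f m))
    (c : ℂ) (n : ℕ) (m : M) : f (((p - c • 1) ^ n) m) = ((q - c • 1) ^ n) (f m) := by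
  induction n generalizing m with
  | zero => simp
  | succ n ih =>
    rw [pow_succ, pow_succ, End.mul_apply, End.mul_apply, ih]
    congr 1
    simp [h]

theorem y_mem_wt (A : Operators σ b M) {μ : Dual ℂ U} {m : M} (hm : m ∈ A.wt μ) (u : U) :
    A.y u m ∈ A.wt μ := by
  rw [mem_wt] at hm ⊢
  intro v
  obtain ⟨n, hn⟩ := hm v
  exact ⟨n, by rw [← map_sub_pow (f := A.y u) (A.y_y u v), hn, map_zero]⟩

theorem g_mem_wt (A : Operators σ b M) {μ : Dual ℂ U} {m : M} (hm : m ∈ A.wt μ) (w : G) :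
    A.g w m ∈ A.wt (σ.dual w μ) := by
  rw [mem_wt] at hm ⊢
  intro v
  obtain ⟨n, hn⟩ := hm (σ w⁻¹ v)
  refine ⟨n, ?_⟩
  rw [dual_apply_apply, ← map_sub_pow (f := A.g w) (p := A.y (σ w⁻¹ v)), hn, map_zero]
  intro m
  rw [A.g_y, σ.self_inv_apply]

/-- An operator between weight spaces of different weights that commutes with `U` vanishes. -/
theorem eq_zero_of_wt_ne {f : M →ₗ[ℂ] M'} {A : Operators σ b M} {y' : U → End ℂ M'}
    {μ ν : Dual ℂ U} (h : μ ≠ ν) {m : M} (hm : m ∈ A.wt μ)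
    (hf : ∀ u, ∀ m ∈ A.wt μ, f (A.y u m) = y' u (f m))
    (hν : ∀ u m, ∃ n : ℕ, ((y' u - ν u • 1) ^ n) m = 0) : f m = 0 := by
  obtain ⟨u, hu⟩ : ∃ u, μ u ≠ ν u := by
    by_contra! h'
    exact h (LinearMap.ext h')
  obtain ⟨n, hn⟩ := mem_wt.1 hm u
  have key : ∀ (n : ℕ), ∀ m ∈ A.wt μ, ((A.y u - μ u • 1) ^ n) m = 0 → f m = 0 := by
    intro n
    induction n with
    | zero => intro m _ h; simp at h; simp [h]
    | succ n ih =>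
      intro m hm h
      rw [pow_succ, End.mul_apply] at h
      have h2 := ih _ (by
        simpa using (A.wt μ).sub_mem (A.y_mem_wt hm u) ((A.wt μ).smul_mem (μ u) hm)) h
      have h3 : (y' u - μ u • (1 : End ℂ M')) (f m) = 0 := by
        rw [← h2]; simp [hf u m hm]
      refine eq_zero_of_apply_eq_zero (c := ν u - μ u) (sub_ne_zero.2 hu.symm) ?_ h3
      obtain ⟨k, hk⟩ := hν u (f m)
      refine ⟨k, ?_⟩
      convert hk using 3
      rw [sub_smul]; abel
  exact key n m hm hn

end Operators

end Operators

/-! ### The two-form identity for products of two reflections. -/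

section SymmetricAlgebra

section Omega

variable {W V : Type*} [Fintype W] [AddCommGroup V] [Module ℂ V]

open Classical in
/-- The product of all `α s`, `s ≠ t`, over the support of `β`. -/
def coProd (β : W → ℂ) (α : W → V) (t : W) : SymmetricAlgebra ℂ V :=
  ∏ s ∈ (Finset.univ.filter fun s => β s ≠ 0).erase t, SymmetricAlgebra.ι ℂ V (α s)

open Classical in
theorem ι_mul_coProd (β : W → ℂ) (α : W → V) {t : W} (ht : β t ≠ 0) :
    SymmetricAlgebra.ι ℂ V (α t) * coProd β α t =
      ∏ s ∈ Finset.univ.filter fun s => β s ≠ 0, SymmetricAlgebra.ι ℂ V (α s) :=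
  Finset.mul_prod_erase _ (fun s => SymmetricAlgebra.ι ℂ V (α s)) (by simp [ht])

/-- The identity behind the commutativity of Dunkl operators: the two-forms
`∑ β_t β_t' dlog α_t ∧ dlog α_t'`, summed over `t' t = w`, vanish. -/
theorem sum_wedge_coProd_eq_zero [Group W] (ρ : Representation ℂ W V) (β : W → ℂ) (α : W → V)
    (a : W → Dual ℂ V) (hα : ∀ t, β t ≠ 0 → ∀ v, ρ t v = v + a t v • α t)
    (hne : ∀ t, β t ≠ 0 → ∃ v, ρ t v ≠ v) (w : W)
    (hβ : ∀ p, β (p⁻¹ * w) = β (w * p⁻¹)) (hw : w = 1 ∨ ∃ v, ρ w v ≠ v) (ξ ξ' : Dual ℂ V) :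
    ∑ t, (β t * β (w * t⁻¹) *
      (ξ (α t) * ξ' (α (w * t⁻¹)) - ξ' (α t) * ξ (α (w * t⁻¹)))) •
        (coProd β α t * coProd β α (w * t⁻¹)) = 0 := by
  classical
  rcases hw with rfl | ⟨v, hv⟩
  -- For `w = 1` the second factor is `t⁻¹`, whose root vector is proportional to that of `t`; every
  -- antisymmetric coefficient vanishes.
  · refine Finset.sum_eq_zero fun t _ => ?_
    by_cases ht : β t = 0
    · simp [ht]
    by_cases ht' : β (1 * t⁻¹) = 0
    · rw [ht', mul_zero, zero_mul, zero_smul]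
    obtain ⟨v, hv⟩ := hne t ht
    have h1 := hα t ht v
    have h2 := hα _ ht' (ρ t v)
    rw [one_mul, ρ.inv_self_apply, h1, add_assoc] at h2
    have hav : a t v ≠ 0 := by
      intro h
      rw [h, zero_smul, add_zero] at h1
      exact hv h1
    have h3 : α t = (-((a t v)⁻¹ * a t⁻¹ (v + a t v • α t))) • α t⁻¹ := by
      have h4 : a t v • α t = -(a t⁻¹ (v + a t v • α t) • α t⁻¹) :=
        eq_neg_of_add_eq_zero_left (by simpa using h2.symm)
      calc α t = (a t v)⁻¹ • a t v • α t := by rw [smul_smul, inv_mul_cancel₀ hav, one_smul]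
        _ = (a t v)⁻¹ • -(a t⁻¹ (v + a t v • α t) • α t⁻¹) := congrArg _ h4
        _ = _ := by rw [smul_neg, smul_smul, neg_smul]
    generalize -((a t v)⁻¹ * a t⁻¹ (v + a t v • α t)) = k at h3
    have h5 : ξ (α t) * ξ' (α (1 * t⁻¹)) - ξ' (α t) * ξ (α (1 * t⁻¹)) = 0 := by
      rw [h3, one_mul]; simp; ring
    rw [h5, mul_zero, zero_smul]
  -- The symmetric algebra is a domain, so one may multiply by the nonzero vector `w v - v`. With
  -- `t' = w t⁻¹` it equals `a_t'(t v) α_t' + a_t(v) α_t`, and each summand completes one of the two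
  -- cofactors to `D`.
  · set D := ∏ s ∈ Finset.univ.filter fun s => β s ≠ 0, SymmetricAlgebra.ι ℂ V (α s) with hD
    have hι : SymmetricAlgebra.ι ℂ V (ρ w v - v) ≠ 0 := by
      intro h
      refine hv (sub_eq_zero.1 ((forall_dual_apply_eq_zero_iff ℂ _).1 fun f => ?_))
      rw [← SymmetricAlgebra.lift_ι_apply f, h, map_zero]
    refine (mul_eq_zero.1 ?_).resolve_left hι
    have hterm : ∀ t, SymmetricAlgebra.ι ℂ V (ρ w v - v) * ((β t * β (w * t⁻¹) *
          (ξ (α t) * ξ' (α (w * t⁻¹)) - ξ' (α t) * ξ (α (w * t⁻¹)))) •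
            (coProd β α t * coProd β α (w * t⁻¹))) =
        (β t * β (w * t⁻¹) * (ξ (α t) * ξ' (ρ w v - ρ t v) - ξ' (α t) * ξ (ρ w v - ρ t v))) •
            (D * coProd β α t) +
        (β t * β (w * t⁻¹) * (ξ (ρ t v - v) * ξ' (α (w * t⁻¹)) -
          ξ' (ρ t v - v) * ξ (α (w * t⁻¹)))) • (D * coProd β α (w * t⁻¹)) := by
      intro t
      by_cases ht : β t = 0
      · simp [ht]
      by_cases ht' : β (w * t⁻¹) = 0
      · simp [ht']
      have h1 := hα t ht v
      have h2 := hα _ ht' (ρ t v)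
      rw [← End.mul_apply, ← map_mul, inv_mul_cancel_right] at h2
      have e1 : ρ w v - ρ t v = a (w * t⁻¹) (ρ t v) • α (w * t⁻¹) := by rw [h2]; abel
      have e2 : ρ t v - v = a t v • α t := by rw [h1]; abel
      have e3 : ρ w v - v = a (w * t⁻¹) (ρ t v) • α (w * t⁻¹) + a t v • α t := by
        rw [← e1, ← e2]; abel
      have d1 := ι_mul_coProd β α ht
      have d2 := ι_mul_coProd β α ht'
      rw [← hD] at d1 d2
      rw [e1, e2, e3]
      simp only [map_add, map_smul, smul_eq_mul, Algebra.smul_def, map_mul, map_sub]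
      generalize algebraMap ℂ (SymmetricAlgebra ℂ V) = φ
      linear_combination (φ (β t) * φ (β (w * t⁻¹)) *
        (φ (ξ (α t)) * φ (ξ' (α (w * t⁻¹))) - φ (ξ' (α t)) * φ (ξ (α (w * t⁻¹))))) *
          (φ (a (w * t⁻¹) (ρ t v)) * coProd β α t * d2 + φ (a t v) * coProd β α (w * t⁻¹) * d1)
    rw [Finset.mul_sum, Finset.sum_congr rfl fun t _ => hterm t, Finset.sum_add_distrib]
    -- Substituting `p = w t⁻¹` in the second group makes both groups sums of multiples of the same
    -- elements `D * coProd β α p`.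
    have hre := Equiv.sum_comp (Equiv.divLeft w) fun p =>
      (β (p⁻¹ * w) * β p * (ξ (ρ (p⁻¹ * w) v - v) * ξ' (α p) -
          ξ' (ρ (p⁻¹ * w) v - v) * ξ (α p))) • (D * coProd β α p)
    have hre' : ∀ t, (Equiv.divLeft w t)⁻¹ * w = t := by
      intro t; simp [Equiv.divLeft, div_eq_mul_inv]
    simp only [hre'] at hre
    simp only [Equiv.divLeft_apply, div_eq_mul_inv] at hre
    rw [hre, ← Finset.sum_add_distrib]
    refine Finset.sum_eq_zero fun p _ => ?_
    by_cases hp : β p = 0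
    · simp [hp]
    rw [hβ, ← add_smul]
    -- The vectors `w v - p v` and `p⁻¹ w v - v` differ by a multiple of `α p`, on which the
    -- antisymmetric form with `α p` vanishes, so the coefficients cancel.
    have h1 := hα p hp v
    have h2 := hα p hp (ρ (p⁻¹ * w) v)
    rw [← End.mul_apply, ← map_mul, mul_inv_cancel_left] at h2
    rw [h1, h2]
    simp only [map_sub, map_add, map_smul, smul_eq_mul]
    convert zero_smul ℂ _ using 2
    ring

end Omega

end SymmetricAlgebra

/-! ### Inverses of root vectors outside the stabilizer. -/

section Theta

/-- A class function supported on elements `s` such that `s - 1` has rank at most one. -/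
structure IsParam {W V : Type*} [Group W] [AddCommGroup V] [Module ℂ V]
    (ρ : Representation ℂ W V) (b : W → ℂ) : Prop where
  conj : ∀ s w, b (w * s * w⁻¹) = b s
  rank_one : ∀ s, b s ≠ 0 → ∃ (a : Dual ℂ V) (α : V), ∀ v, ρ s v = v + a v • α

section Stab

variable {V W : Type u} [AddCommGroup V] [Module ℂ V] [Group W]
  (ρ : Representation ℂ W V) (lam : Dual ℂ V)

/-- The restriction of the representation to the stabilizer of `lam`. -/
abbrev parRep : Representation ℂ (stab ρ lam) V := ρ.comp (stab ρ lam).subtype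

variable {ρ lam}

theorem mem_stab {w : W} : w ∈ stab ρ lam ↔ ρ.dual w lam = lam := Iff.rfl

theorem apply_of_mem_stab {w : W} (hw : w ∈ stab ρ lam) (v : V) : lam (ρ w v) = lam v := by
  have h := LinearMap.congr_fun (mem_stab.1 (inv_mem hw)) v
  rwa [dual_apply_apply, inv_inv] at h

theorem exists_of_notMem_stab {w : W} (hw : w ∉ stab ρ lam) : ∃ v, lam (ρ w v - v) ≠ 0 := by
  by_contra! h
  refine hw (mem_stab.2 (LinearMap.ext fun v => ?_))
  have := h (ρ w⁻¹ v)
  rw [ρ.self_inv_apply, map_sub, sub_eq_zero] at this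
  exact this.symm

end Stab

/-- The operators `Y v - lam v` are locally nilpotent. -/
def IsNil {U E : Type*} [AddCommGroup U] [Module ℂ U] [AddCommGroup E] [Module ℂ E]
    (Y : U →ₗ[ℂ] End ℂ E) (lam : Dual ℂ U) : Prop :=
  ∀ v e, ∃ n : ℕ, ((Y v - lam v • 1) ^ n) e = 0

section Theta

variable {V W : Type u} [AddCommGroup V] [Module ℂ V] [Group W]
  {ρ : Representation ℂ W V} {lam : Dual ℂ V} {b : W → ℂ}
  {E : Type*} [AddCommGroup E] [Module ℂ E] {E' : Type*} [AddCommGroup E'] [Module ℂ E']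
  {Y : V →ₗ[ℂ] End ℂ E} {Y' : V →ₗ[ℂ] End ℂ E'}

/-- If `t - 1` is `a ⊗ α` and `t` does not fix `lam`, then `lam α ≠ 0`, so `Y α` is bijective and `θ
t ξ = b t * ξ α • (Y α)⁻¹`. Testing against all `t v - v` characterizes it without a choice of `α`.
-/
theorem exists_theta (hb : IsParam ρ b) (hY : IsNil Y lam) :
    ∃ θ : W → Dual ℂ V →ₗ[ℂ] End ℂ E, (∀ t ∈ stab ρ lam, θ t = 0) ∧
      ∀ t ∉ stab ρ lam, ∀ v ξ e,
        Y (ρ t v - v) (θ t ξ e) = (b t * ξ (ρ t v - v)) • e := by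
  classical
  have key : ∀ t, ∃ θ : Dual ℂ V →ₗ[ℂ] End ℂ E, (t ∈ stab ρ lam → θ = 0) ∧
      (t ∉ stab ρ lam → ∀ v ξ e,
        Y (ρ t v - v) (θ ξ e) = (b t * ξ (ρ t v - v)) • e) := by
    intro t
    by_cases ht : t ∈ stab ρ lam
    · exact ⟨0, fun _ => rfl, fun h => absurd ht h⟩
    by_cases hbt : b t = 0
    · exact ⟨0, fun _ => rfl, fun _ v ξ e => by simp [hbt]⟩
    obtain ⟨a, α, hα⟩ := hb.rank_one t hbt
    obtain ⟨v₀, hv₀⟩ := exists_of_notMem_stab ht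
    have hl : lam α ≠ 0 := by
      intro h
      apply hv₀
      rw [hα]
      simp [h]
    have hinj : Function.Injective (Y α) :=
      (injective_iff_map_eq_zero _).2 fun e he => eq_zero_of_apply_eq_zero hl (hY α e) he
    have hsurj : Function.Surjective (Y α) := fun e => by
      obtain ⟨n, hn⟩ := hY α e
      obtain ⟨k, -, hk⟩ := exists_apply_eq_of_mem hl ⊤ (fun _ _ => trivial) n e trivial hn
      exact ⟨k, hk⟩
    let i := LinearEquiv.ofBijective (Y α) ⟨hinj, hsurj⟩
    refine ⟨LinearMap.smulRight (b t • Dual.eval ℂ V α) (i.symm.toLinearMap : End ℂ E),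
      fun h => absurd h ht, fun _ v ξ e => ?_⟩
    have hi : Y α (i.symm e) = e := i.apply_symm_apply e
    have hd : ρ t v - v = a v • α := by rw [hα]; abel
    rw [hd]
    simp only [LinearMap.smulRight_apply, LinearMap.smul_apply, Dual.eval_apply, map_smul,
      LinearEquiv.coe_coe, hi, smul_smul, smul_eq_mul]
    congr 1
    ring
  choose θ h1 h2 using key
  exact ⟨θ, h1, h2⟩

variable (hb : IsParam ρ b) (hY : IsNil Y lam)

/-- The operators `b_t ⟨ξ, α_t⟩ α_t⁻¹`, for `t` outside the stabilizer of `lam`. -/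
def theta : W → Dual ℂ V →ₗ[ℂ] End ℂ E := (exists_theta hb hY).choose

theorem theta_of_mem {t : W} (ht : t ∈ stab ρ lam) : theta hb hY t = 0 :=
  (exists_theta hb hY).choose_spec.1 t ht

theorem theta_spec {t : W} (ht : t ∉ stab ρ lam) (v : V) (ξ : Dual ℂ V) (e : E) :
    Y (ρ t v - v) (theta hb hY t ξ e) = (b t * ξ (ρ t v - v)) • e :=
  (exists_theta hb hY).choose_spec.2 t ht v ξ e

theorem apply_eq_zero (hY : IsNil Y lam) {v : V} (hv : lam v ≠ 0) {e : E} (h : Y v e = 0) :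
    e = 0 := eq_zero_of_apply_eq_zero hv (hY v e) h

/-- A single `v` with `lam (t v - v) ≠ 0` suffices, as `Y (t v - v)` is then injective. Naturality
and equivariance of `theta` follow from this. -/
theorem theta_unique {t : W} (ht : t ∉ stab ρ lam) {ξ : Dual ℂ V} {e e' : E}
    (h : ∀ v, Y (ρ t v - v) e' = (b t * ξ (ρ t v - v)) • e) : theta hb hY t ξ e = e' := by
  obtain ⟨v, hv⟩ := exists_of_notMem_stab ht
  refine sub_eq_zero.1 (apply_eq_zero hY hv ?_)
  rw [map_sub, h, theta_spec hb hY ht, sub_self]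

variable (hY' : IsNil Y' lam)

theorem theta_natural (f : E →ₗ[ℂ] E') (hf : ∀ v e, f (Y v e) = Y' v (f e)) (t : W)
    (ξ : Dual ℂ V) (e : E) : f (theta hb hY t ξ e) = theta hb hY' t ξ (f e) := by
  by_cases ht : t ∈ stab ρ lam
  · simp [theta_of_mem _ _ ht]
  · refine (theta_unique hb hY' ht fun v => ?_).symm
    rw [← hf, theta_spec hb hY ht, map_smul]

theorem apply_theta (hc : ∀ u v, Y u * Y v = Y v * Y u) (v : V) (t : W) (ξ : Dual ℂ V) (e : E) :
    Y v (theta hb hY t ξ e) = theta hb hY t ξ (Y v e) :=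
  theta_natural hb hY hY (Y v) (fun u => LinearMap.congr_fun (hc v u)) t ξ e

theorem equivariant_theta {u : W} (hu : u ∈ stab ρ lam) (T : End ℂ E)
    (hT : ∀ v e, T (Y v e) = Y (ρ u v) (T e)) (t : W) (ξ : Dual ℂ V) (e : E) :
    T (theta hb hY t ξ e) =
      theta hb hY (u * t * u⁻¹) (ρ.dual u ξ) (T e) := by
  by_cases ht : t ∈ stab ρ lam
  · rw [theta_of_mem _ _ ht, theta_of_mem _ _ (mul_mem (mul_mem hu ht) (inv_mem hu))]
    simp
  · have ht' : u * t * u⁻¹ ∉ stab ρ lam := fun h => ht (by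
      simpa [mul_assoc] using mul_mem (mul_mem (inv_mem hu) h) hu)
    refine (theta_unique hb hY ht' fun v => ?_).symm
    have e1 : ρ (u * t * u⁻¹) v - v = ρ u (ρ t (ρ u⁻¹ v) - ρ u⁻¹ v) := by
      rw [map_sub, ρ.self_inv_apply]
      simp [map_mul]
    have e2 := hT (ρ t (ρ u⁻¹ v) - ρ u⁻¹ v) (theta hb hY t ξ e)
    rw [theta_spec hb hY ht, map_smul] at e2
    rw [e1, dual_apply_apply, ρ.inv_self_apply, hb.conj]
    exact e2.symm

theorem theta_mem (K : Submodule ℂ E) (hK : ∀ v, ∀ k ∈ K, Y v k ∈ K) (t : W) (ξ : Dual ℂ V)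
    {e : E} (he : e ∈ K) : theta hb hY t ξ e ∈ K := by
  by_cases ht : t ∈ stab ρ lam
  · simp [theta_of_mem _ _ ht]
  · obtain ⟨v, hv⟩ := exists_of_notMem_stab ht
    have hmem : (b t * ξ (ρ t v - v)) • e ∈ K := K.smul_mem _ he
    obtain ⟨n, hn⟩ := hY (ρ t v - v) ((b t * ξ (ρ t v - v)) • e)
    obtain ⟨k, hk, hk'⟩ := exists_apply_eq_of_mem hv K (hK _) n _ hmem hn
    have : theta hb hY t ξ e = k := by
      refine sub_eq_zero.1 (apply_eq_zero hY hv ?_)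
      rw [map_sub, hk', theta_spec hb hY ht, sub_self]
    rwa [this]

/-- Multiplying by the square of the product of all root vectors involved clears the inverses and
reduces the symmetry to `sum_wedge_coProd_eq_zero`. Faithfulness enters here: it provides a vector
moved by `u` when `u ≠ 1`. -/
theorem sum_theta_theta [Fintype W] (hc : ∀ u v, Y u * Y v = Y v * Y u)
    (hρ : Function.Injective ρ) (u : W) (hu : u ∈ stab ρ lam)
    (ξ ξ' : Dual ℂ V) (e : E) :
    ∑ t, theta hb hY t ξ (theta hb hY (u * t⁻¹) (ρ.dual t ξ') e) =
    ∑ t, theta hb hY t ξ' (theta hb hY (u * t⁻¹) (ρ.dual t ξ) e) := by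
  classical
  have hex : ∀ t, ∃ (a : Dual ℂ V) (α : V), b t ≠ 0 → ∀ v, ρ t v = v + a v • α := by
    intro t
    by_cases h : b t = 0
    · exact ⟨0, 0, fun h' => absurd h h'⟩
    · obtain ⟨a, α, h⟩ := hb.rank_one t h
      exact ⟨a, α, fun _ => h⟩
  choose a α hα using hex
  -- Elements of the stabilizer must be discarded: their `theta` is zero, and their root vectors
  -- need not act injectively.
  let β : W → ℂ := fun t => if t ∈ stab ρ lam then 0 else b t
  have hβ : ∀ t, β t ≠ 0 → t ∉ stab ρ lam ∧ b t ≠ 0 := by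
    intro t h
    by_cases ht : t ∈ stab ρ lam
    · exact absurd (if_pos ht) h
    · exact ⟨ht, by simpa [β, ht] using h⟩
  set D := ∏ s ∈ Finset.univ.filter fun s => β s ≠ 0, SymmetricAlgebra.ι ℂ V (α s) with hD
  -- Each factor `α s` of `D` satisfies `lam (α s) ≠ 0`, hence acts injectively.
  have hDinj : ∀ e, symLift Y hc D e = 0 → e = 0 := by
    have : ∀ (T : Finset W), (∀ t ∈ T, β t ≠ 0) →
        ∀ e, symLift Y hc (∏ s ∈ T, SymmetricAlgebra.ι ℂ V (α s)) e = 0 → e = 0 := by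
      intro T
      induction T using Finset.induction_on with
      | empty => intro _ e h; simpa using h
      | insert t T ht ih =>
        intro hT e h
        rw [Finset.prod_insert ht, map_mul, End.mul_apply, symLift_ι] at h
        obtain ⟨h1, h2⟩ := hβ t (hT t (Finset.mem_insert_self _ _))
        refine ih (fun s hs => hT s (Finset.mem_insert_of_mem hs)) e (apply_eq_zero hY ?_ h)
        intro h0
        obtain ⟨v, hv⟩ := exists_of_notMem_stab h1
        apply hv
        rw [hα t h2]
        simp [h0]
    exact this _ fun t ht => (Finset.mem_filter.1 ht).2
  have hDθ : ∀ t ξ e, symLift Y hc D (theta hb hY t ξ e) =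
      (β t * ξ (α t)) • symLift Y hc (coProd β α t) e := by
    intro t ξ e
    by_cases ht : t ∈ stab ρ lam
    · simp [theta_of_mem _ _ ht, β, ht]
    obtain ⟨v, hv⟩ := exists_of_notMem_stab ht
    have hs := theta_spec hb hY ht v ξ e
    have hβt : β t = b t := if_neg ht
    by_cases hbt : b t = 0
    · rw [hbt, zero_mul, zero_smul] at hs
      rw [apply_eq_zero hY hv hs, hβt, hbt]
      simp
    have hd : ρ t v - v = a t v • α t := by rw [hα t hbt]; abel
    rw [hd] at hs hv
    have hav : a t v ≠ 0 := by
      intro h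
      simp [h] at hv
    have hDt : D = SymmetricAlgebra.ι ℂ V (α t) * coProd β α t := by
      rw [ι_mul_coProd β α (hβt ▸ hbt), hD]
    rw [hDt, mul_comm, map_mul, End.mul_apply, symLift_ι, ← map_smul]
    congr 1
    apply smul_right_injective E hav
    simp only [map_smul, LinearMap.smul_apply, smul_eq_mul] at hs
    simp only [hs, smul_smul, hβt]
    congr 1
    ring
  have hterm : ∀ t ξ ξ', symLift Y hc D (symLift Y hc D
      (theta hb hY t ξ (theta hb hY (u * t⁻¹) (ρ.dual t ξ') e))) =
        (β t * β (u * t⁻¹) * (ξ (α t) * ρ.dual t ξ' (α (u * t⁻¹)))) •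
          symLift Y hc (coProd β α t * coProd β α (u * t⁻¹)) e := by
    intro t ξ ξ'
    rw [hDθ, map_smul, ← End.mul_apply, ← map_mul, mul_comm D, map_mul, End.mul_apply, hDθ,
      map_smul, smul_smul, ← End.mul_apply, ← map_mul]
    congr 1
    ring
  have hmain := sum_wedge_coProd_eq_zero ρ β α a (fun t ht => hα t (hβ t ht).2)
    (fun t ht => by
      obtain ⟨v, hv⟩ := exists_of_notMem_stab (hβ t ht).1
      exact ⟨v, fun h => hv (by rw [h, sub_self, map_zero])⟩) u
    (fun p => by
      have h1 : p⁻¹ * u ∈ stab ρ lam ↔ u * p⁻¹ ∈ stab ρ lam := by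
        rw [Subgroup.mul_mem_cancel_right _ hu, Subgroup.mul_mem_cancel_left _ hu]
      have h2 : b (p⁻¹ * u) = b (u * p⁻¹) := by
        rw [← hb.conj (u * p⁻¹) p⁻¹]
        congr 1
        group
      simp only [β, h1, h2])
    (by
      by_cases h1 : u = 1
      · exact Or.inl h1
      · refine Or.inr ?_
        by_contra! h
        exact h1 (hρ (by rw [map_one]; exact LinearMap.ext h))) ξ ξ'
  refine sub_eq_zero.1 (hDinj _ (hDinj _ ?_))
  rw [← Finset.sum_sub_distrib, map_sum, map_sum]
  simp only [map_sub, hterm]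
  have := congrArg (fun p => symLift Y hc p e) hmain
  simp only [map_sum, map_smul, LinearMap.sum_apply, LinearMap.smul_apply, map_zero,
    LinearMap.zero_apply] at this
  rw [← this]
  refine Finset.sum_congr rfl fun t _ => ?_
  by_cases ht : β t = 0
  · simp [ht]
  rw [← sub_smul]
  congr 1
  -- The twist of `ξ'` by `t` changes the pairing by a multiple of `ξ' (α t)`; multiplied by `ξ (α
  -- t)`, this correction is symmetric in `ξ`, `ξ'` and cancels.
  have hinv : ρ t⁻¹ (α (u * t⁻¹)) = α (u * t⁻¹) - a t (ρ t⁻¹ (α (u * t⁻¹))) • α t := by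
    have := hα t (hβ t ht).2 (ρ t⁻¹ (α (u * t⁻¹)))
    rw [ρ.self_inv_apply] at this
    exact eq_sub_of_add_eq this.symm
  rw [dual_apply_apply, dual_apply_apply, hinv]
  simp only [map_sub, map_smul, smul_eq_mul]
  ring

end Theta

end Theta

/-! ### Restriction to the weight space of weight `lam`. -/

section Restriction

theorem sum_stab {V W : Type u} [AddCommGroup V] [Module ℂ V] [Group W] [Fintype W]
    {ρ : Representation ℂ W V} {lam : Dual ℂ V} [Fintype (stab ρ lam)] {E : Type*}
    [AddCommMonoid E] (f : W → E) (hf : ∀ s ∉ stab ρ lam, f s = 0) :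
    ∑ s : stab ρ lam, f s = ∑ s, f s :=
  Fintype.sum_of_injective _ Subtype.val_injective _ _ (fun s hs => hf s fun h => hs ⟨⟨s, h⟩, rfl⟩)
    fun _ => rfl

namespace Operators

variable {V W : Type u} [AddCommGroup V] [Module ℂ V] [Group W] [Fintype W]
  {ρ : Representation ℂ W V} {b : W → ℂ}
  {M : Type*} [AddCommGroup M] [Module ℂ M] {M' : Type*} [AddCommGroup M'] [Module ℂ M']
  (A : Operators ρ b M) (A' : Operators ρ b M') (lam : Dual ℂ V)

/-- Every `V`-stable subspace is the sum of its weight spaces for the weights `w lam`. -/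
def Supp : Prop :=
  ∀ K : Submodule ℂ M, (∀ v, ∀ m ∈ K, A.y v m ∈ K) → K ≤ ⨆ w, K ⊓ A.wt (ρ.dual w lam)

/-- The sum of the weight spaces of weights other than `lam`. -/
def cowt : Submodule ℂ M := ⨆ (μ : Dual ℂ V) (_ : μ ≠ lam), A.wt μ

theorem iSupIndep_wt : iSupIndep A.wt := by
  have h := End.independent_iInf_maxGenEigenspace_of_forall_mapsTo (fun v : V => A.y v)
    (fun i j φ => End.mapsTo_maxGenEigenspace_of_comm (A.comm j i) φ)
  exact h.comp (f := fun μ : Dual ℂ V => (μ : V → ℂ)) DFunLike.coe_injective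

variable {A A' lam}

theorem Supp.iSup_eq_top (h : A.Supp lam) : ⨆ w, A.wt (ρ.dual w lam) = ⊤ := by
  refine top_le_iff.1 ((h ⊤ fun _ _ _ => trivial).trans ?_)
  simp

theorem Supp.hom_ext (h : A.Supp lam) {f f' : M →ₗ[ℂ] M'}
    (hf : ∀ w, ∀ m ∈ A.wt (ρ.dual w lam), f m = f' m) : f = f' := by
  have : ⨆ w, A.wt (ρ.dual w lam) ≤ LinearMap.eqLocus f f' := iSup_le fun w m hm => hf w m hm
  rw [h.iSup_eq_top] at this
  exact LinearMap.ext fun m => this trivial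

theorem Supp.isCompl (h : A.Supp lam) : IsCompl (A.wt lam) (A.cowt lam) := by
  refine ⟨A.iSupIndep_wt lam, codisjoint_iff.2 (top_le_iff.1 ?_)⟩
  rw [← h.iSup_eq_top]
  refine iSup_le fun w => ?_
  by_cases hw : ρ.dual w lam = lam
  · rw [hw]; exact le_sup_left
  · exact le_sup_of_le_right (le_iSup₂_of_le (ρ.dual w lam) hw le_rfl)

/-- The projection onto the weight space of weight `lam`. -/
def pr (h : A.Supp lam) : M →ₗ[ℂ] A.wt lam := Submodule.projectionOnto _ _ h.isCompl

theorem pr_of_mem (h : A.Supp lam) {m : M} (hm : m ∈ A.wt lam) : pr h m = ⟨m, hm⟩ :=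
  Submodule.projectionOnto_apply_left h.isCompl ⟨m, hm⟩

theorem pr_coe (h : A.Supp lam) (m : A.wt lam) : pr h m = m := pr_of_mem h m.2

theorem pr_of_wt_ne (h : A.Supp lam) {μ : Dual ℂ V} (hμ : μ ≠ lam) {m : M} (hm : m ∈ A.wt μ) :
    pr h m = 0 :=
  (Submodule.projectionOnto_apply_eq_zero_iff h.isCompl).2
    (Submodule.mem_iSup_of_mem μ (Submodule.mem_iSup_of_mem hμ hm))

theorem sub_pr_mem (h : A.Supp lam) (m : M) : m - pr h m ∈ A.cowt lam := by
  rw [← Submodule.projectionOnto_apply_eq_zero_iff h.isCompl]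
  exact (map_sub (pr h) m _).trans (by rw [pr_coe, sub_self])

theorem map_mem_wt {f : M →ₗ[ℂ] M'} (hf : ∀ v m, f (A.y v m) = A'.y v (f m)) {μ : Dual ℂ V}
    {m : M} (hm : m ∈ A.wt μ) : f m ∈ A'.wt μ := by
  rw [mem_wt] at hm ⊢
  intro v
  obtain ⟨n, hn⟩ := hm v
  exact ⟨n, by rw [← map_sub_pow (hf v), hn, map_zero]⟩

theorem map_pr (h : A.Supp lam) (h' : A'.Supp lam) {f : M →ₗ[ℂ] M'}
    (hf : ∀ v m, f (A.y v m) = A'.y v (f m)) (m : M) : f (pr h m) = pr h' (f m) := by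
  suffices f ∘ₗ (A.wt lam).subtype ∘ₗ pr h = (A'.wt lam).subtype ∘ₗ pr h' ∘ₗ f from
    LinearMap.congr_fun this m
  refine h.hom_ext fun w m hm => ?_
  have hm' := map_mem_wt hf hm
  simp only [LinearMap.comp_apply, Submodule.subtype_apply]
  by_cases hw : ρ.dual w lam = lam
  · rw [hw] at hm hm'
    rw [pr_of_mem h hm, pr_of_mem h' hm']
  · rw [pr_of_wt_ne h hw hm, pr_of_wt_ne h' hw hm']
    simp

variable (A lam) in
/-- The action of `V` on the weight space of weight `lam`. -/
def yE : V →ₗ[ℂ] End ℂ (A.wt lam) where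
  toFun v := (A.y v).restrict fun _ hm => A.y_mem_wt hm v
  map_add' _ _ := by ext; simp
  map_smul' _ _ := by ext; simp

theorem isNil_yE : IsNil (A.yE lam) lam := by
  intro v e
  obtain ⟨n, hn⟩ := mem_wt.1 e.2 v
  refine ⟨n, Subtype.ext ?_⟩
  have := map_sub_pow (f := (A.wt lam).subtype) (p := A.yE lam v) (q := A.y v) (fun _ => rfl)
    (lam v) n e
  simp only [Submodule.subtype_apply] at this
  rw [this, hn]
  rfl

theorem comm_yE (u v : V) : A.yE lam u * A.yE lam v = A.yE lam v * A.yE lam u := by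
  ext e
  exact A.y_y u v e

theorem pr_y (h : A.Supp lam) (v : V) (m : M) : pr h (A.y v m) = A.yE lam v (pr h m) :=
  Subtype.ext (map_pr h h (f := A.y v) (A.y_y v) m).symm

variable (A lam) in
/-- The action of the stabilizer on the weight space of weight `lam`. -/
def gE : Representation ℂ (stab ρ lam) (A.wt lam) where
  toFun u := (A.g u).restrict fun m hm => by
    have := A.g_mem_wt hm u
    rwa [mem_stab.1 u.2] at this
  map_one' := by ext; simp
  map_mul' _ _ := by ext; simp

theorem pr_g (h : A.Supp lam) (u : stab ρ lam) (m : M) :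
    pr h (A.g u m) = A.gE lam u (pr h m) := by
  suffices pr h ∘ₗ A.g u = A.gE lam u ∘ₗ pr h from LinearMap.congr_fun this m
  refine h.hom_ext fun w m hm => ?_
  have hm' := A.g_mem_wt hm u
  have huw : ρ.dual u (ρ.dual w lam) = lam ↔ ρ.dual w lam = lam := by
    constructor
    · intro h
      have h2 : ρ.dual (u * w) lam = lam := by rw [map_mul]; exact h
      exact (Subgroup.mul_mem_cancel_left (stab ρ lam) u.2).1 h2
    · intro h
      rw [h]; exact u.2
  simp only [LinearMap.comp_apply]
  by_cases hw : ρ.dual w lam = lam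
  · rw [huw.2 hw] at hm'
    rw [hw] at hm
    rw [pr_of_mem h hm, pr_of_mem h hm']
    rfl
  · rw [pr_of_wt_ne h hw hm, pr_of_wt_ne h (huw.not.2 hw) hm', map_zero]

theorem pr_g_of_notMem (h : A.Supp lam) {s : W} (hs : s ∉ stab ρ lam) (e : A.wt lam) :
    pr h (A.g s e) = 0 :=
  pr_of_wt_ne h hs (A.g_mem_wt e.2 s)

/-- The action of `x` on the weight space of weight `lam`. -/
def xE (h : A.Supp lam) : Dual ℂ V →ₗ[ℂ] End ℂ (A.wt lam) where
  toFun ξ := pr h ∘ₗ A.x ξ ∘ₗ (A.wt lam).subtype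
  map_add' _ _ := by ext; simp
  map_smul' _ _ := by ext; simp

theorem xE_apply (h : A.Supp lam) (ξ : Dual ℂ V) (e : A.wt lam) :
    xE h ξ e = pr h (A.x ξ e) := rfl

/-- Let `T` be the left side minus the sum over `t`. On weight `lam` the sum vanishes, since `t`
outside the stabilizer moves `m` to another weight. On any other weight space of the orbit `T`
commutes with `V`, so it vanishes by comparison of weights. Thus the off-diagonal part of `x` is
forced by the relations. -/
theorem pr_x (hb : IsParam ρ b) (h : A.Supp lam) (ξ : Dual ℂ V) (m : M) :
    pr h (A.x ξ m) =
      xE h ξ (pr h m) + ∑ t, theta hb isNil_yE t ξ (pr h (A.g t m)) := by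
  let T : M →ₗ[ℂ] A.wt lam :=
    pr h ∘ₗ A.x ξ - ∑ t, theta hb isNil_yE t ξ ∘ₗ pr h ∘ₗ A.g t
  have hT : ∀ m, T m = pr h (A.x ξ m) - ∑ t, theta hb isNil_yE t ξ (pr h (A.g t m)) := by
    intro m
    simp [T]
  suffices T = xE h ξ ∘ₗ pr h by
    have := LinearMap.congr_fun this m
    rw [hT] at this
    exact sub_eq_iff_eq_add.1 this
  refine h.hom_ext fun w m hm => ?_
  simp only [LinearMap.comp_apply]
  by_cases hw : ρ.dual w lam = lam
  · rw [hw] at hm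
    rw [hT, pr_of_mem h hm, xE_apply, sub_eq_self]
    refine Finset.sum_eq_zero fun t _ => ?_
    by_cases ht : t ∈ stab ρ lam
    · simp [theta_of_mem _ _ ht]
    · rw [pr_g_of_notMem h ht ⟨m, hm⟩, map_zero]
  rw [pr_of_wt_ne h hw hm, map_zero]
  -- The term `⟨y, x⟩` projects to zero, and so do the group terms from the stabilizer, which do not
  -- lead into weight `lam`. The remaining group terms are the commutators of `y` with the terms
  -- `θ_t pr t`.
  refine eq_zero_of_wt_ne (y' := A.yE lam) hw hm (fun v m hm => ?_) isNil_yE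
  rw [hT, hT, map_sub, ← pr_y, A.y_x, map_sum]
  simp only [map_sub, map_add, map_smul, map_sum, pr_of_wt_ne h hw hm, smul_zero, add_zero]
  rw [sub_sub, sub_right_inj, ← Finset.sum_add_distrib]
  refine Finset.sum_congr rfl fun t _ => ?_
  by_cases ht : t ∈ stab ρ lam
  · have : pr h (A.g t m) = 0 := by
      have := pr_g h ⟨t, ht⟩ m
      rw [pr_of_wt_ne h hw hm, map_zero] at this
      exact this
    simp [this, theta_of_mem _ _ ht]
  · rw [← map_sub, ← theta_spec hb isNil_yE ht v ξ (pr h (A.g t m)), A.g_y, pr_y,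
      ← apply_theta hb isNil_yE comm_yE, map_sub, LinearMap.sub_apply]
    abel

variable [Fintype (stab ρ lam)]

/-- The operators on the weight space of weight `lam` for the stabilizer of `lam`. -/
def res (hρ : Function.Injective ρ) (hb : IsParam ρ b) (h : A.Supp lam) :
    Operators (parRep ρ lam) (resParam ρ lam b) (A.wt lam) where
  g := A.gE lam
  y := A.yE lam
  x := xE h
  g_y w u m := Subtype.ext (A.g_y w u m)
  g_x w ξ m := by
    rw [xE_apply, xE_apply, ← pr_g, A.g_x]
    rfl
  y_y u v m := Subtype.ext (A.y_y u v m)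
  y_x v ξ e := by
    rw [xE_apply, ← pr_y, A.y_x, map_sub, map_add, map_smul, pr_coe, map_sum]
    congr 1
    rw [← sum_stab (ρ := ρ) (lam := lam)]
    · refine Finset.sum_congr rfl fun s _ => ?_
      rw [map_smul, pr_g, pr_coe]
      rfl
    · intro s hs
      rw [map_smul, pr_g_of_notMem h hs, smul_zero]
  x_x ξ ξ' e := by
    -- Two applications of `pr_x`: in the inner one only products `(u t⁻¹) t = u` in the stabilizer
    -- survive, all others moving `e` out of weight `lam`.
    have key : ∀ ξ ξ' : Dual ℂ V, pr h (A.x ξ (A.x ξ' e)) = xE h ξ (xE h ξ' e) +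
        ∑ u : stab ρ lam, ∑ t, theta hb isNil_yE t ξ
          (theta hb isNil_yE (u * t⁻¹) (ρ.dual t ξ') (A.gE lam u e)) := by
      intro ξ ξ'
      rw [pr_x hb h, ← xE_apply]
      congr 1
      rw [Finset.sum_comm]
      refine Finset.sum_congr rfl fun t _ => ?_
      by_cases ht : t ∈ stab ρ lam
      · simp [theta_of_mem _ _ ht]
      rw [A.g_x, pr_x hb h, pr_g_of_notMem h ht, map_zero, zero_add, map_sum]
      rw [← Equiv.sum_comp (Equiv.mulRight t⁻¹), ← sum_stab (ρ := ρ) (lam := lam)]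
      · refine Finset.sum_congr rfl fun u _ => ?_
        rw [Equiv.coe_mulRight, ← A.g_mul, inv_mul_cancel_right, pr_g, pr_coe]
      · intro s hs
        rw [Equiv.coe_mulRight, ← A.g_mul, inv_mul_cancel_right, pr_g_of_notMem h hs, map_zero,
          map_zero]
    have h1 := key ξ ξ'
    rw [A.x_x, key ξ' ξ] at h1
    have h2 : ∀ u : stab ρ lam, _ := fun u =>
      sum_theta_theta hb isNil_yE comm_yE hρ (u : W) u.2 ξ ξ' (A.gE lam u e)
    rw [Finset.sum_congr rfl fun u _ => h2 u, add_left_inj] at h1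
    exact h1.symm

theorem res_isNil (hρ : Function.Injective ρ) (hb : IsParam ρ b) (h : A.Supp lam) :
    IsNil (A.res hρ hb h).y lam := isNil_yE

end Operators

end Restriction

/-! ### The induced space and its operators. -/

section Induction

namespace Operators

/-- A vector in a generalized eigenspace that is mapped into one for another eigenvalue, by a map
that intertwines the operators, is mapped to zero. -/
theorem eq_zero_of_intertwine {M M' : Type*} [AddCommGroup M] [Module ℂ M] [AddCommGroup M']
    [Module ℂ M'] {f : M →ₗ[ℂ] M'} {p : End ℂ M} {q : End ℂ M'} (hf : ∀ m, f (p m) = q (f m))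
    {c d : ℂ} (hcd : c ≠ d) {m : M} (hm : ∃ n : ℕ, ((p - c • 1) ^ n) m = 0)
    (hm' : ∃ n : ℕ, ((q - d • 1) ^ n) (f m) = 0) : f m = 0 := by
  obtain ⟨n, hn⟩ := hm
  have h1 : f m ∈ q.maxGenEigenspace c :=
    End.mem_maxGenEigenspace _ _ _ |>.2 ⟨n, by rw [← map_sub_pow hf, hn, map_zero]⟩
  have h2 : f m ∈ q.maxGenEigenspace d := End.mem_maxGenEigenspace _ _ _ |>.2 hm'
  exact Submodule.disjoint_def.1 (End.disjoint_genEigenspace q hcd ⊤ ⊤) _ h1 h2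

/-- With `s - 1 = a ⊗ α`, both sides are products of `ξ α`, `ξ' α` and a factor that involves
neither form. The rank-one condition is what makes commutators of the `x` operators commute with
`V`. -/
theorem apply_smul_dual_sub {W V : Type*} [AddCommGroup V] [Module ℂ V] [Group W]
    {ρ : Representation ℂ W V} {b : W → ℂ} (hb : IsParam ρ b) {s : W} (hs : b s ≠ 0) (v : V)
    (ξ ξ' : Dual ℂ V) :
    ξ (ρ s v - v) • (ρ.dual s ξ' - ξ') = ξ' (ρ s v - v) • (ρ.dual s ξ - ξ) := by
  obtain ⟨a, α, hα⟩ := hb.rank_one s hs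
  have h1 : ∀ ξ : Dual ℂ V, ξ (ρ s v - v) = a v * ξ α := by
    intro ξ
    rw [hα]
    simp
  ext z
  have h2 : ∀ ξ : Dual ℂ V, (ρ.dual s ξ - ξ) z = -(a (ρ s⁻¹ z) * ξ α) := by
    intro ξ
    have := hα (ρ s⁻¹ z)
    rw [ρ.self_inv_apply] at this
    rw [LinearMap.sub_apply, dual_apply_apply]
    nth_rewrite 2 [this]
    simp
  rw [LinearMap.smul_apply, LinearMap.smul_apply, h1, h1, h2, h2]
  simp only [smul_eq_mul]
  ring

/-- The commutators `[ξ, ξ']` commute with `V`. -/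
theorem y_commutator {W V M : Type*} [AddCommGroup V] [Module ℂ V] [Group W] [Fintype W]
    [AddCommGroup M] [Module ℂ M] {ρ : Representation ℂ W V} {b : W → ℂ} (hb : IsParam ρ b)
    (g : W → End ℂ M) (y : V → End ℂ M) (x : Dual ℂ V →ₗ[ℂ] End ℂ M)
    (g_x : ∀ w ξ m, g w (x ξ m) = x (ρ.dual w ξ) (g w m))
    (y_x : ∀ u ξ m, y u (x ξ m) =
      x ξ (y u m) + ξ u • m - ∑ s, (b s * ξ (ρ s u - u)) • g s m)
    (v : V) (ξ ξ' : Dual ℂ V) (m : M) :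
    y v (x ξ (x ξ' m) - x ξ' (x ξ m)) = x ξ (x ξ' (y v m)) - x ξ' (x ξ (y v m)) := by
  have h1 : ∀ ξ ξ' : Dual ℂ V, y v (x ξ (x ξ' m)) = x ξ (x ξ' (y v m)) + ξ' v • x ξ m +
      ξ v • x ξ' m - ∑ s, ((b s * ξ' (ρ s v - v)) • x ξ (g s m) +
        (b s * ξ (ρ s v - v)) • x (ρ.dual s ξ') (g s m)) := by
    intro ξ ξ'
    rw [y_x, y_x]
    simp only [map_sub, map_add, map_smul, map_sum, g_x, Finset.sum_add_distrib]
    abel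
  have h2 : ∑ s, ((b s * ξ' (ρ s v - v)) • x ξ (g s m) +
        (b s * ξ (ρ s v - v)) • x (ρ.dual s ξ') (g s m)) =
      ∑ s, ((b s * ξ (ρ s v - v)) • x ξ' (g s m) +
        (b s * ξ' (ρ s v - v)) • x (ρ.dual s ξ) (g s m)) := by
    refine Finset.sum_congr rfl fun s _ => ?_
    by_cases hs : b s = 0
    · simp [hs]
    have h3 := congrArg (fun η => b s • x η (g s m)) (apply_smul_dual_sub hb hs v ξ ξ')
    simp only [map_smul, map_sub x, LinearMap.smul_apply, LinearMap.sub_apply, smul_sub,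
      smul_smul] at h3
    rw [sub_eq_sub_iff_add_eq_add] at h3
    rw [add_comm, h3]
    abel
  rw [map_sub, h1, h1, h2]
  abel

variable {V W : Type u} [AddCommGroup V] [Module ℂ V] [Group W]
  {ρ : Representation ℂ W V} {lam : Dual ℂ V} [Fintype (stab ρ lam)] {b : W → ℂ}
  {E : Type*} [AddCommGroup E] [Module ℂ E]
  (B : Operators (parRep ρ lam) (resParam ρ lam b) E)

/-- The representation of `W` induced from the stabilizer of `lam`, as a space of functions. -/
def ind : Submodule ℂ (W → E) where
  carrier := {f | ∀ w (u : stab ρ lam), f (w * u) = B.g u⁻¹ (f w)}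
  add_mem' hf hf' w u := by simp [hf w u, hf' w u]
  zero_mem' w u := by simp
  smul_mem' a f hf w u := by simp [hf w u]

variable {B}

theorem ind_apply_mul (f : B.ind) (w : W) (u : stab ρ lam) :
    f.1 (w * u) = B.g u⁻¹ (f.1 w) := f.2 w u

variable (B)

/-- The action of `W` by left translations. -/
def indG : Representation ℂ W B.ind where
  toFun g :=
    { toFun f := ⟨fun w => f.1 (g⁻¹ * w), fun w u => by rw [← ind_apply_mul, mul_assoc]⟩
      map_add' _ _ := rfl
      map_smul' _ _ := rfl }
  map_one' := by ext f w; simp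
  map_mul' g g' := by ext f w; simp [mul_assoc]

theorem indG_apply (g : W) (f : B.ind) (w : W) : (B.indG g f).1 w = f.1 (g⁻¹ * w) := rfl

/-- The action of `V` on the induced space. -/
def indY : V →ₗ[ℂ] End ℂ B.ind where
  toFun v :=
    { toFun f := ⟨fun w => B.y (ρ w⁻¹ v) (f.1 w), fun w u => by
        beta_reduce
        rw [ind_apply_mul, B.g_y, mul_inv_rev, map_mul]
        rfl⟩
      map_add' _ _ := by ext w; simp
      map_smul' _ _ := by ext w; simp }
  map_add' _ _ := by ext f w; simp
  map_smul' _ _ := by ext f w; simp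

theorem indY_apply (v : V) (f : B.ind) (w : W) : (B.indY v f).1 w = B.y (ρ w⁻¹ v) (f.1 w) := rfl

variable {B} (hb : IsParam ρ b) (hB : IsNil B.y lam) [Fintype W]

/-- The action of the dual of `V` on the induced space. -/
def indX : Dual ℂ V →ₗ[ℂ] End ℂ B.ind where
  -- This is `pr_x` with the value at `w` in the role of `pr (w⁻¹ m)`; the value at `w t⁻¹` then
  -- stands for `pr (t w⁻¹ m)`.
  toFun ξ :=
    { toFun f := ⟨fun w => B.x (ρ.dual w⁻¹ ξ) (f.1 w) +
          ∑ t, theta hb hB t (ρ.dual w⁻¹ ξ) (f.1 (w * t⁻¹)), fun w u => by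
        beta_reduce
        rw [ind_apply_mul, mul_inv_rev, map_mul, map_add, B.g_x, map_sum]
        congr 1
        rw [← Equiv.sum_comp (MulAut.conj (u : W)⁻¹).toEquiv]
        refine Finset.sum_congr rfl fun t _ => ?_
        have h1 : w * u * ((MulAut.conj (u : W)⁻¹).toEquiv t)⁻¹ = w * t⁻¹ * u := by
          simp [mul_assoc]
        rw [h1, ind_apply_mul, equivariant_theta hb hB (u⁻¹).2 (B.g u⁻¹) (B.g_y u⁻¹)]
        rfl⟩
      map_add' f f' := by
        ext w
        simp [Finset.sum_add_distrib]
        abel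
      map_smul' a f := by
        ext w
        simp [Finset.smul_sum] }
  map_add' ξ ξ' := by
    ext f w
    simp [Finset.sum_add_distrib]
    abel
  map_smul' a ξ := by
    ext f w
    simp [Finset.smul_sum]

theorem indX_apply (ξ : Dual ℂ V) (f : B.ind) (w : W) : (indX hb hB ξ f).1 w =
    B.x (ρ.dual w⁻¹ ξ) (f.1 w) + ∑ t, theta hb hB t (ρ.dual w⁻¹ ξ) (f.1 (w * t⁻¹)) := rfl

theorem indG_indX (w : W) (ξ : Dual ℂ V) (f : B.ind) :
    B.indG w (indX hb hB ξ f) = indX hb hB (ρ.dual w ξ) (B.indG w f) := by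
  ext w'
  simp only [indG_apply, indX_apply, mul_assoc, mul_inv_rev, inv_inv, map_mul, End.mul_apply]

/-- After conjugating the sum by `w`, the terms with `s` in the stabilizer come from the relation in
`B`, and the others from `V` acting differently at `w` and at `w s⁻¹`: `theta` inverts exactly that
difference. -/
theorem indY_indX (v : V) (ξ : Dual ℂ V) (f : B.ind) :
    B.indY v (indX hb hB ξ f) = indX hb hB ξ (B.indY v f) + ξ v • f -
      ∑ s, (b s * ξ (ρ s v - v)) • B.indG s f := by
  ext w
  have hsum : (∑ s, (b s * ξ (ρ s v - v)) • B.indG s f).1 w =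
      ∑ s, (b s * ξ (ρ s v - v)) • f.1 (s⁻¹ * w) := by
    rw [AddSubmonoidClass.coe_finsetSum, Finset.sum_apply]
    rfl
  have e1 : (indX hb hB ξ (B.indY v f) + ξ v • f -
      ∑ s, (b s * ξ (ρ s v - v)) • B.indG s f).1 w = (indX hb hB ξ (B.indY v f)).1 w +
        ξ v • f.1 w - ∑ s, (b s * ξ (ρ s v - v)) • f.1 (s⁻¹ * w) := by
    rw [← hsum]; rfl
  rw [e1, indY_apply, indX_apply, indX_apply, map_add, B.y_x, indY_apply, map_sum]
  have e2 : (ρ.dual w⁻¹ ξ) (ρ w⁻¹ v) = ξ v := by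
    rw [dual_apply_apply, inv_inv, ρ.self_inv_apply]
  have e3 : ∑ s, (b s * ξ (ρ s v - v)) • f.1 (s⁻¹ * w) =
      ∑ s, (b s * (ρ.dual w⁻¹ ξ) (ρ s (ρ w⁻¹ v) - ρ w⁻¹ v)) • f.1 (w * s⁻¹) := by
    rw [← Equiv.sum_comp (MulAut.conj w).toEquiv]
    refine Finset.sum_congr rfl fun s _ => ?_
    have h1 : (MulAut.conj w).toEquiv s = w * s * w⁻¹ := rfl
    rw [h1, hb.conj, dual_apply_apply, inv_inv]
    simp [mul_assoc, map_mul, map_sub]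
  have e6 : ∀ s, (B.indY v f).1 (w * s⁻¹) = B.y (ρ s (ρ w⁻¹ v)) (f.1 (w * s⁻¹)) := by
    intro s
    rw [indY_apply]
    simp
  simp only [e2, e3, e6]
  generalize ρ.dual w⁻¹ ξ = η
  generalize ρ w⁻¹ v = z
  have e4 : ∀ s, (b s * η (ρ s z - z)) • f.1 (w * s⁻¹) =
      (open Classical in if s ∈ stab ρ lam then (b s * η (ρ s z - z)) • f.1 (w * s⁻¹) else 0) +
      (theta hb hB s η (B.y (ρ s z) (f.1 (w * s⁻¹))) - B.y z (theta hb hB s η (f.1 (w * s⁻¹)))) := by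
    intro s
    by_cases hs : s ∈ stab ρ lam
    · simp [hs, theta_of_mem _ _ hs]
    · rw [if_neg hs, zero_add, ← theta_spec hb hB hs, ← apply_theta hb hB B.comm, map_sub,
        LinearMap.sub_apply]
  rw [Finset.sum_congr rfl fun s _ => e4 s, Finset.sum_add_distrib, Finset.sum_sub_distrib,
    ← sum_stab (ρ := ρ) (lam := lam) _ fun s hs => if_neg hs]
  have e5 : ∑ s : stab ρ lam, (open Classical in if (s : W) ∈ stab ρ lam then
        (b s * η (ρ s z - z)) • f.1 (w * (s : W)⁻¹) else 0) =
      ∑ s : stab ρ lam, (resParam ρ lam b s * η (parRep ρ lam s z - z)) • B.g s (f.1 w) := by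
    refine Finset.sum_congr rfl fun s _ => ?_
    have := ind_apply_mul f w s⁻¹
    rw [inv_inv, InvMemClass.coe_inv] at this
    rw [if_pos s.2, this]
    rfl
  rw [e5]
  abel

end Operators

end Induction

/-! ### Commutativity, weights and the fibre at `1` of the induced space. -/

section InducedOperators

namespace Operators

theorem apply_inv_eq_of_mk_eq {V W : Type u} [AddCommGroup V] [Module ℂ V] [Group W]
    {ρ : Representation ℂ W V} {lam : Dual ℂ V} {w w₀ : W} (h : (w : W ⧸ stab ρ lam) = w₀) (v : V) :
    lam (ρ w⁻¹ v) = lam (ρ w₀⁻¹ v) := by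
  have := apply_of_mem_stab (QuotientGroup.eq.1 h.symm) (ρ w⁻¹ v)
  rw [map_mul, End.mul_apply, ρ.self_inv_apply] at this
  exact this.symm

variable {V W : Type u} [AddCommGroup V] [Module ℂ V] [Group W]
  {ρ : Representation ℂ W V} {lam : Dual ℂ V} [Fintype (stab ρ lam)] {b : W → ℂ}
  {E : Type*} [AddCommGroup E] [Module ℂ E]
  (B : Operators (parRep ρ lam) (resParam ρ lam b) E)

open Classical in
/-- The restriction of a function to a coset of the stabilizer, extended by zero. -/
def cosetPart (q : W ⧸ stab ρ lam) (f : B.ind) : B.ind :=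
  ⟨fun w => if (w : W ⧸ stab ρ lam) = q then f.1 w else 0, fun w u => by
    beta_reduce
    rw [QuotientGroup.mk_mul_of_mem w u.2, ind_apply_mul]
    split_ifs
    · rfl
    · rw [map_zero]⟩

open Classical in
theorem cosetPart_apply (q : W ⧸ stab ρ lam) (f : B.ind) (w : W) :
    (B.cosetPart q f).1 w = if (w : W ⧸ stab ρ lam) = q then f.1 w else 0 := rfl

theorem sum_cosetPart [Fintype (W ⧸ stab ρ lam)] (f : B.ind) : ∑ q, B.cosetPart q f = f := by
  classical
  ext w
  rw [AddSubmonoidClass.coe_finsetSum, Finset.sum_apply]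
  simp [cosetPart_apply]

/-- Evaluation at an element of the group. -/
def indEval (w : W) : B.ind →ₗ[ℂ] E := LinearMap.proj w ∘ₗ B.ind.subtype

theorem indEval_apply (w : W) (f : B.ind) : B.indEval w f = f.1 w := rfl

theorem indEval_pow (w : W) (v : V) (c : ℂ) (n : ℕ) (f : B.ind) :
    (((B.indY v - c • 1) ^ n) f).1 w = ((B.y (ρ w⁻¹ v) - c • 1) ^ n) (f.1 w) :=
  map_sub_pow (f := B.indEval w) (p := B.indY v) (fun f => B.indY_apply v f w) c n f

variable {B} [Fintype W]

/-- At `w` the operator `v` acts as `w⁻¹ v`, with eigenvalue `lam (w⁻¹ v)`, which depends only on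
the coset of `w`. As `W` is finite, one exponent serves all points. -/
theorem cosetPart_nil (hB : IsNil B.y lam) (w₀ : W) (f : B.ind) (v : V) :
    ∃ n : ℕ, ((B.indY v - ρ.dual w₀ lam v • 1) ^ n) (B.cosetPart w₀ f) = 0 := by
  classical
  choose n hn using fun w => hB (ρ w⁻¹ v) (f.1 w)
  refine ⟨Finset.univ.sup n, ?_⟩
  ext w
  rw [indEval_pow, cosetPart_apply]
  split_ifs with h
  · rw [dual_apply_apply, ← apply_inv_eq_of_mk_eq h,
      ← Nat.sub_add_cancel (Finset.le_sup (Finset.mem_univ w) : n w ≤ Finset.univ.sup n),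
      pow_add, End.mul_apply, hn, map_zero]
    rfl
  · rw [map_zero]
    rfl

variable (hB : IsNil B.y lam) (hb : IsParam ρ b)

/-- By equivariance the commutator needs to vanish only at the point `1`, and by linearity only on
functions supported on one coset. Since it commutes with `V`, weights dispose of every coset except
the stabilizer itself. There the double sum is computed as for the restriction, and
`sum_theta_theta` applies. -/
theorem indX_indX (hρ : Function.Injective ρ) (ξ ξ' : Dual ℂ V) (f : B.ind) :
    indX hb hB ξ (indX hb hB ξ' f) = indX hb hB ξ' (indX hb hB ξ f) := by
  classical
  have : Fintype (W ⧸ stab ρ lam) := Fintype.ofFinite _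
  suffices h : ∀ (ξ ξ' : Dual ℂ V) (f : B.ind),
      (indX hb hB ξ (indX hb hB ξ' f)).1 1 = (indX hb hB ξ' (indX hb hB ξ f)).1 1 by
    ext w
    have := h (ρ.dual w⁻¹ ξ) (ρ.dual w⁻¹ ξ') (B.indG w⁻¹ f)
    simpa only [← indG_indX, indG_apply, inv_inv, mul_one] using this
  intro ξ ξ' f
  let C : End ℂ B.ind := indX hb hB ξ * indX hb hB ξ' - indX hb hB ξ' * indX hb hB ξ
  have hC : ∀ f, C f = indX hb hB ξ (indX hb hB ξ' f) - indX hb hB ξ' (indX hb hB ξ f) :=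
    fun f => rfl
  have hCy : ∀ v f, C (B.indY v f) = B.indY v (C f) := fun v f => by
    rw [hC, hC]
    exact (y_commutator hb B.indG B.indY (indX hb hB) (indG_indX hb hB) (indY_indX hb hB)
      v ξ ξ' f).symm
  suffices h : ∀ q f, B.indEval 1 (C (B.cosetPart q f)) = 0 by
    have h2 : B.indEval 1 (C f) = 0 := by
      rw [← B.sum_cosetPart f, map_sum, map_sum, Finset.sum_eq_zero fun q _ => h q f]
    rw [hC, map_sub, sub_eq_zero] at h2
    exact h2
  intro q f
  obtain ⟨w₀, rfl⟩ := QuotientGroup.mk_surjective q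
  by_cases hw : w₀ ∈ stab ρ lam
  · have hf : ∀ w ∉ stab ρ lam, (B.cosetPart w₀ f).1 w = 0 := by
      intro w hw'
      rw [cosetPart_apply, if_neg]
      intro h
      exact hw' (by simpa using mul_mem hw (QuotientGroup.eq.1 h.symm))
    generalize B.cosetPart w₀ f = f at hf
    have h0 : ∀ ξ t, theta hb hB t ξ (f.1 t⁻¹) = 0 := by
      intro ξ t
      by_cases ht : t ∈ stab ρ lam
      · simp [theta_of_mem _ _ ht]
      · rw [hf _ (fun h => ht (by simpa using inv_mem h)), map_zero]
    have h1 : ∀ ξ, (indX hb hB ξ f).1 1 = B.x ξ (f.1 1) := by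
      intro ξ
      rw [indX_apply]
      simp only [inv_one, map_one, End.one_apply, one_mul, h0, Finset.sum_const_zero, add_zero]
    have key : ∀ ξ ξ' : Dual ℂ V, (indX hb hB ξ (indX hb hB ξ' f)).1 1 = B.x ξ (B.x ξ' (f.1 1)) +
        ∑ u : stab ρ lam, ∑ t, theta hb hB t ξ
          (theta hb hB (u * t⁻¹) (ρ.dual t ξ') (f.1 (u : W)⁻¹)) := by
      intro ξ ξ'
      rw [indX_apply, h1]
      simp only [inv_one, map_one, End.one_apply, one_mul]
      congr 1
      rw [Finset.sum_comm]
      refine Finset.sum_congr rfl fun t _ => ?_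
      by_cases ht : t ∈ stab ρ lam
      · simp [theta_of_mem _ _ ht]
      rw [indX_apply, hf t⁻¹ (fun h => ht (by simpa using inv_mem h)), map_zero, zero_add,
        map_sum, ← Equiv.sum_comp (Equiv.mulRight t⁻¹), ← sum_stab (ρ := ρ) (lam := lam)]
      · refine Finset.sum_congr rfl fun u _ => ?_
        simp
      · intro s hs
        have : t⁻¹ * ((Equiv.mulRight t⁻¹) s)⁻¹ = s⁻¹ := by simp
        rw [this, hf _ (fun h => hs (by simpa using inv_mem h)), map_zero, map_zero]
    rw [indEval_apply, hC]
    change (indX hb hB ξ (indX hb hB ξ' f)).1 1 - (indX hb hB ξ' (indX hb hB ξ f)).1 1 = 0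
    rw [key, key, B.x_x, sub_eq_zero, add_right_inj]
    exact Finset.sum_congr rfl fun u _ =>
      sum_theta_theta hb hB B.comm hρ (u : W) u.2 ξ ξ' (f.1 (u : W)⁻¹)
  -- A function on this coset has weight `w₀ lam ≠ lam`, whereas the values at `1` have weight
  -- `lam`.
  · obtain ⟨v, hv⟩ : ∃ v, ρ.dual w₀ lam v ≠ lam v := by
      by_contra! h
      exact hw (mem_stab.2 (LinearMap.ext h))
    refine eq_zero_of_intertwine (f := B.indEval 1 ∘ₗ C) (p := B.indY v) (q := B.y v)
      (fun f => ?_) hv (cosetPart_nil hB w₀ f v) (hB v _)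
    rw [LinearMap.comp_apply, hCy, LinearMap.comp_apply, indEval_apply, indEval_apply, indY_apply]
    simp

/-- The operators on the induced space. -/
def indOps (hρ : Function.Injective ρ) : Operators ρ b B.ind where
  g := B.indG
  y := B.indY
  x := indX hb hB
  g_y w v f := by
    ext w'
    simp [indG_apply, indY_apply]
  g_x := indG_indX hb hB
  x_x := indX_indX hB hb hρ
  y_y u v f := by
    ext w
    exact B.y_y _ _ _
  y_x := indY_indX hb hB

theorem indOps_iSup (hρ : Function.Injective ρ) :
    ⨆ w, (indOps hB hb hρ).wt (ρ.dual w lam) = ⊤ := by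
  have : Fintype (W ⧸ stab ρ lam) := Fintype.ofFinite _
  refine top_le_iff.1 fun f _ => ?_
  rw [← B.sum_cosetPart f]
  refine Submodule.sum_mem _ fun q _ => ?_
  obtain ⟨w₀, rfl⟩ := QuotientGroup.mk_surjective q
  exact Submodule.mem_iSup_of_mem w₀ (mem_wt.2 (cosetPart_nil hB w₀ f))

theorem indOps_wt_apply (hρ : Function.Injective ρ) {f : B.ind} {w₀ : W}
    (hf : f ∈ (indOps hB hb hρ).wt (ρ.dual w₀ lam)) {w : W}
    (hw : (w : W ⧸ stab ρ lam) ≠ w₀) : f.1 w = 0 := by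
  obtain ⟨v, hv⟩ : ∃ v, ρ.dual w₀ lam v ≠ ρ.dual w lam v := by
    by_contra! h
    refine hw (QuotientGroup.eq.2 (mem_stab.2 ?_))
    rw [map_mul, End.mul_apply, LinearMap.ext h]
    exact ρ.dual.inv_self_apply w lam
  exact eq_zero_of_intertwine (f := B.indEval w) (p := B.indY v) (q := B.y (ρ w⁻¹ v))
    (fun f => rfl) hv (mem_wt.1 hf v) (hB _ _)

/-- Evaluation at `1` identifies the weight space of weight `lam` of the induced space with `E`. -/
def indWtEval (hρ : Function.Injective ρ) : (indOps hB hb hρ).wt lam →ₗ[ℂ] E :=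
  B.indEval 1 ∘ₗ ((indOps hB hb hρ).wt lam).subtype

/-- Vectors of weight `lam` are the functions supported on the stabilizer, and equivariance recovers
such a function from its value at `1`. -/
theorem indWtEval_bijective (hρ : Function.Injective ρ) :
    Function.Bijective (indWtEval hB hb hρ) := by
  classical
  have hwt : ∀ f ∈ (indOps hB hb hρ).wt lam, ∀ w ∉ stab ρ lam, f.1 w = 0 := by
    intro f hf w hw
    refine indOps_wt_apply hB hb hρ (w₀ := 1) (by rwa [map_one]) fun h => hw ?_
    simpa using QuotientGroup.eq.1 h
  constructor
  · refine (injective_iff_map_eq_zero _).2 fun f hf => ?_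
    ext w
    by_cases hw : w ∈ stab ρ lam
    · have := ind_apply_mul f.1 1 ⟨w, hw⟩
      rw [one_mul] at this
      rw [this, show f.1.1 1 = 0 from hf, map_zero]
      rfl
    · exact hwt _ f.2 w hw
  · intro e
    let f : B.ind := ⟨fun w => if hw : w ∈ stab ρ lam then B.g ⟨w, hw⟩⁻¹ e else 0, fun w u => by
      beta_reduce
      by_cases hw : w ∈ stab ρ lam
      · have hwu : w * u ∈ stab ρ lam := mul_mem hw u.2
        rw [dif_pos hwu, dif_pos hw, ← g_mul]
        congr 2
        ext
        simp
      · have hwu : w * u ∉ stab ρ lam := fun h => hw ((Subgroup.mul_mem_cancel_right _ u.2).1 h)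
        rw [dif_neg hwu, dif_neg hw, map_zero]⟩
    have h1 : B.cosetPart ((1 : W) : W ⧸ stab ρ lam) f = f := by
      ext w
      rw [cosetPart_apply]
      split_ifs with h
      · rfl
      · have hw : w ∉ stab ρ lam := fun hw => h (QuotientGroup.eq.2 (by simpa using hw))
        have : f.1 w = 0 := dif_neg hw
        exact this.symm
    refine ⟨⟨f, mem_wt.2 fun v => ?_⟩, ?_⟩
    · have := cosetPart_nil hB 1 f v
      rwa [h1, map_one] at this
    · change (if hw : (1 : W) ∈ stab ρ lam then B.g ⟨1, hw⟩⁻¹ e else 0) = e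
      rw [dif_pos (one_mem _)]
      have : (⟨1, one_mem _⟩ : stab ρ lam)⁻¹ = 1 := inv_one
      rw [this, map_one, End.one_apply]

theorem indWtEval_intertwines (hρ : Function.Injective ρ) (h : (indOps hB hb hρ).Supp lam) :
    Intertwines ((indOps hB hb hρ).res hρ hb h) B (indWtEval hB hb hρ) := by
  have hpr : ∀ f, B.indEval 1 (pr h f) = B.indEval 1 f := by
    intro f
    suffices B.indEval 1 ∘ₗ ((indOps hB hb hρ).wt lam).subtype ∘ₗ pr h = B.indEval 1 from
      LinearMap.congr_fun this f
    refine h.hom_ext fun w f hf => ?_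
    simp only [LinearMap.comp_apply, Submodule.subtype_apply]
    by_cases hw : ρ.dual w lam = lam
    · rw [hw] at hf
      rw [pr_of_mem h hf]
    · rw [pr_of_wt_ne h hw hf]
      symm
      refine indOps_wt_apply hB hb hρ hf fun h => hw (mem_stab.1 ?_)
      simpa using QuotientGroup.eq.1 h
  refine ⟨fun u f => ?_, fun v f => ?_, fun ξ f => ?_⟩
  · have := ind_apply_mul f.1 1 u⁻¹
    rw [inv_inv, one_mul] at this
    change f.1.1 ((u : W)⁻¹ * 1) = B.g u (f.1.1 1)
    rw [mul_one, ← this]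
    rfl
  · change B.y (ρ 1⁻¹ v) (f.1.1 1) = B.y v (f.1.1 1)
    simp
  · change B.indEval 1 (pr h (indX hb hB ξ f)) = B.x ξ (f.1.1 1)
    rw [hpr, indEval_apply, indX_apply]
    simp only [inv_one, map_one, End.one_apply, one_mul, add_eq_left]
    refine Finset.sum_eq_zero fun t _ => ?_
    by_cases ht : t ∈ stab ρ lam
    · simp [theta_of_mem _ _ ht]
    · rw [indOps_wt_apply hB hb hρ (w₀ := 1) (f := f.1) (by rw [map_one]; exact f.2), map_zero]
      intro h
      exact ht (by simpa using QuotientGroup.eq.1 h)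

end Operators

end InducedOperators

/-! ### Recovering modules, maps and generators from the weight space. -/

section RestrictionEquivalence

namespace Operators

variable {V W : Type u} [AddCommGroup V] [Module ℂ V] [Group W] [Fintype W]
  {ρ : Representation ℂ W V} {lam : Dual ℂ V} {b : W → ℂ}
  {M : Type*} [AddCommGroup M] [Module ℂ M] {M' : Type*} [AddCommGroup M'] [Module ℂ M']
  {A : Operators ρ b M} {A' : Operators ρ b M'}

theorem g_inv_mem_wt {w : W} {m : M} (hm : m ∈ A.wt (ρ.dual w lam)) : A.g w⁻¹ m ∈ A.wt lam := by
  have := A.g_mem_wt hm w⁻¹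
  rwa [ρ.dual.inv_self_apply] at this

/-- The vectors with this property form a `V`-stable subspace, so `Supp` splits it into weight
components. A component of weight `w lam` is carried by `w⁻¹` to weight `lam`, where `pr` is the
identity. -/
theorem eq_zero_of_pr_eq_zero (h : A.Supp lam) {m : M} (hm : ∀ w, pr h (A.g w m) = 0) :
    m = 0 := by
  let K : Submodule ℂ M := ⨅ w, LinearMap.ker (pr h ∘ₗ A.g w)
  have hK : ∀ {m}, m ∈ K ↔ ∀ w, pr h (A.g w m) = 0 := by
    intro m
    simp [K]
  have hKy : ∀ v, ∀ m ∈ K, A.y v m ∈ K := by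
    intro v m hm
    rw [hK] at hm ⊢
    intro w
    rw [A.g_y, pr_y, hm, map_zero]
  have hbot : K ≤ ⊥ := by
    refine (h K hKy).trans (iSup_le fun w m hm => ?_)
    have h1 := g_inv_mem_wt hm.2
    have h2 := hK.1 hm.1 w⁻¹
    rw [pr_of_mem h h1] at h2
    have h3 : A.g w⁻¹ m = 0 := congrArg Subtype.val h2
    rw [Submodule.mem_bot, ← A.g_g_inv w m, h3, map_zero]
  exact (Submodule.mem_bot ℂ).1 (hbot (hK.2 hm))

theorem Intertwines.ext_wt (h : A.Supp lam) {f f' : M →ₗ[ℂ] M'} (hf : Intertwines A A' f)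
    (hf' : Intertwines A A' f') (heq : ∀ m ∈ A.wt lam, f m = f' m) : f = f' := by
  refine h.hom_ext fun w m hm => ?_
  rw [← A.g_g_inv w m, hf.g, hf'.g, heq _ (g_inv_mem_wt hm)]

theorem Stable.pr_mem {K : Submodule ℂ M} (hK : A.Stable K) (h : A.Supp lam) {m : M}
    (hm : m ∈ K) : (pr h m : M) ∈ K := by
  have : ⨆ w, K ⊓ A.wt (ρ.dual w lam) ≤ K.comap ((A.wt lam).subtype ∘ₗ pr h) := by
    refine iSup_le fun w m hm => ?_
    simp only [Submodule.mem_comap, LinearMap.comp_apply, Submodule.subtype_apply]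
    by_cases hw : ρ.dual w lam = lam
    · rw [pr_of_mem h (hw ▸ hm.2)]
      exact hm.1
    · rw [pr_of_wt_ne h hw hm.2]
      exact K.zero_mem
  exact this (h K hK.y hm)

theorem Stable.eq_top_of_wt_le {K : Submodule ℂ M} (hK : A.Stable K) (h : A.Supp lam)
    (hle : A.wt lam ≤ K) : K = ⊤ := by
  rw [← top_le_iff, ← h.iSup_eq_top]
  refine iSup_le fun w m hm => ?_
  rw [← A.g_g_inv w m]
  exact hK.g w _ (hle (g_inv_mem_wt hm))

variable [Fintype (stab ρ lam)] (hρ : Function.Injective ρ) (hb : IsParam ρ b)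

/-- The restriction of an intertwining map to weight spaces. -/
def wtMap (lam : Dual ℂ V) {f : M →ₗ[ℂ] M'} (hf : Intertwines A A' f) : A.wt lam →ₗ[ℂ] A'.wt lam :=
  f.restrict fun _ hm => map_mem_wt hf.y hm

theorem wtMap_intertwines (h : A.Supp lam) (h' : A'.Supp lam) {f : M →ₗ[ℂ] M'}
    (hf : Intertwines A A' f) :
    Intertwines (A.res hρ hb h) (A'.res hρ hb h') (wtMap lam hf) where
  g u e := Subtype.ext (hf.g u e)
  y v e := Subtype.ext (hf.y v e)
  x ξ e := Subtype.ext (by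
    change f (pr h (A.x ξ e)) = pr h' (A'.x ξ (f e))
    rw [map_pr h h' hf.y, hf.x])

/-- The extension is the transfer of `φ` over `W`, normalized so that `pr (w (f m)) = φ (pr (w m))`.
As these projections determine a vector, every intertwining relation may be tested after applying
them; for `x` one uses `pr_x` and the naturality of `theta`. -/
theorem exists_extension_wt (h : A.Supp lam) (h' : A'.Supp lam) {φ : A.wt lam →ₗ[ℂ] A'.wt lam}
    (hφ : Intertwines (A.res hρ hb h) (A'.res hρ hb h') φ) :
    ∃ f : M →ₗ[ℂ] M', Intertwines A A' f ∧ ∀ e : A.wt lam, f e = φ e := by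
  let f : M →ₗ[ℂ] M' := (Fintype.card (stab ρ lam) : ℂ)⁻¹ •
    ∑ w, A'.g w ∘ₗ (A'.wt lam).subtype ∘ₗ φ ∘ₗ pr h ∘ₗ A.g w⁻¹
  have hcard : (Fintype.card (stab ρ lam) : ℂ) ≠ 0 := by
    exact_mod_cast Fintype.card_ne_zero
  have hg : ∀ (u : stab ρ lam) e, φ (A.gE lam u e) = A'.gE lam u (φ e) := hφ.g
  have key : ∀ w m, pr h' (A'.g w (f m)) = φ (pr h (A.g w m)) := by
    intro w₀ m
    have h1 : pr h' (A'.g w₀ (f m)) = (Fintype.card (stab ρ lam) : ℂ)⁻¹ •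
        ∑ w, pr h' (A'.g (w₀ * w) (φ (pr h (A.g w⁻¹ m)))) := by
      simp [f, map_sum]
    -- Only `w` in the coset of `w₀⁻¹` contributes, and its elements contribute equally; hence the
    -- factor `|W_lam|⁻¹`.
    rw [h1, ← Equiv.sum_comp (Equiv.mulLeft w₀⁻¹), ← sum_stab (ρ := ρ) (lam := lam)]
    · have h2 : ∀ u : stab ρ lam, pr h' (A'.g (w₀ * (Equiv.mulLeft w₀⁻¹ (u : W)))
          (φ (pr h (A.g (Equiv.mulLeft w₀⁻¹ (u : W))⁻¹ m)))) = φ (pr h (A.g w₀ m)) := by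
        intro u
        rw [Equiv.coe_mulLeft, mul_inv_cancel_left, mul_inv_rev, inv_inv, g_mul]
        have h3 := pr_g h u⁻¹ (A.g w₀ m)
        rw [InvMemClass.coe_inv] at h3
        rw [pr_g, pr_coe, h3, hg, ← End.mul_apply, ← map_mul, mul_inv_cancel, map_one,
          End.one_apply]
      rw [Finset.sum_congr rfl fun u _ => h2 u, Finset.sum_const, Finset.card_univ,
        ← Nat.cast_smul_eq_nsmul ℂ, smul_smul, inv_mul_cancel₀ hcard, one_smul]
    · intro s hs
      rw [Equiv.coe_mulLeft, mul_inv_cancel_left]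
      exact pr_g_of_notMem h' hs _
  have heq : ∀ {m m' : M'}, (∀ w, pr h' (A'.g w m) = pr h' (A'.g w m')) → m = m' := by
    intro m m' hm
    refine sub_eq_zero.1 (eq_zero_of_pr_eq_zero h' fun w => ?_)
    rw [map_sub, map_sub, hm, sub_self]
  refine ⟨f, ⟨fun w m => heq fun w' => ?_, fun v m => heq fun w' => ?_,
    fun ξ m => heq fun w' => ?_⟩, fun e => heq fun w => ?_⟩
  · rw [key, ← g_mul, ← g_mul, key]
  · rw [key, A.g_y, A'.g_y, pr_y, pr_y, key]
    exact hφ.y _ _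
  · rw [key, A.g_x, A'.g_x, pr_x hb, pr_x hb, map_add, key, map_sum]
    congr 1
    · exact hφ.x _ _
    · refine Finset.sum_congr rfl fun t _ => ?_
      rw [← g_mul, ← g_mul, key]
      exact theta_natural hb isNil_yE isNil_yE φ hφ.y t _ _
  · rw [key]
    by_cases hw : w ∈ stab ρ lam
    · have h1 := pr_g h ⟨w, hw⟩ e
      have h2 := pr_g h' ⟨w, hw⟩ (φ e)
      rw [h1, h2, pr_coe, pr_coe, hg]
    · rw [pr_g_of_notMem h hw, pr_g_of_notMem h' hw, map_zero]

theorem FG_of_res (h : A.Supp lam) (hE : (A.res hρ hb h).FG) : A.FG := by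
  obtain ⟨F, hF, hgen⟩ := hE
  refine ⟨Subtype.val '' F, hF.image _, fun K hFK hK => hK.eq_top_of_wt_le h ?_⟩
  have hst : (A.res hρ hb h).Stable (K.comap (A.wt lam).subtype) :=
    ⟨fun u e he => hK.g u e he, fun v e he => hK.y v e he,
      fun ξ e he => hK.pr_mem h (hK.x ξ e he)⟩
  have htop := hgen _ (fun e he => hFK ⟨e, he, rfl⟩) hst
  intro m hm
  have : (⟨m, hm⟩ : A.wt lam) ∈ K.comap (A.wt lam).subtype := by rw [htop]; trivial
  exact this

/-- Given a stable `K` in the weight space, the vectors all of whose projections `pr (w m)` lie in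
`K` form a stable subspace of `M`: by `pr_x`, multiplication by `x` only adds `theta` terms, which
preserve `K`. Projected translates of generators therefore generate. -/
theorem FG.res (h : A.Supp lam) (hA : A.FG) : (A.res hρ hb h).FG := by
  obtain ⟨F, hF, hgen⟩ := hA
  refine ⟨⋃ w : W, (fun m => pr h (A.g w m)) '' F, Set.finite_iUnion fun w => hF.image _,
    fun K hFK hK => ?_⟩
  let K' : Submodule ℂ M := ⨅ w, K.comap (pr h ∘ₗ A.g w)
  have hK' : ∀ {m}, m ∈ K' ↔ ∀ w, pr h (A.g w m) ∈ K := by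
    intro m
    simp [K']
  have htop := hgen K' (fun m hm => hK'.2 fun w =>
      hFK (Set.mem_iUnion.2 ⟨w, m, hm, rfl⟩)) (by
    refine ⟨fun w m hm => hK'.2 fun w' => ?_, fun v m hm => hK'.2 fun w' => ?_,
      fun ξ m hm => hK'.2 fun w' => ?_⟩
    · rw [← g_mul]
      exact hK'.1 hm _
    · rw [A.g_y, pr_y]
      exact hK.y _ _ (hK'.1 hm _)
    · rw [A.g_x, pr_x hb]
      refine K.add_mem (hK.x _ _ (hK'.1 hm _)) (K.sum_mem fun t _ => ?_)
      rw [← g_mul]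
      exact theta_mem hb isNil_yE K hK.y t _ (hK'.1 hm _))
  refine top_le_iff.1 fun e _ => ?_
  have : (e : M) ∈ K' := by rw [htop]; trivial
  have := hK'.1 this 1
  rwa [map_one, End.one_apply, pr_coe] at this

end Operators

end RestrictionEquivalence

/-! ### Vectors on which the fixed directions act through `lam`. -/

section FixedVectors

section Parabolic

variable {V W : Type u} [AddCommGroup V] [Module ℂ V] [Group W]
  {ρ : Representation ℂ W V} {lam : Dual ℂ V}

theorem parRep_apply_of_mem {z : V} (hz : z ∈ fixedSpace ρ lam) (u : stab ρ lam) :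
    parRep ρ lam u z = z := hz u

theorem quotRep_mk (u : stab ρ lam) (v : V) :
    quotRep ρ lam u (Submodule.Quotient.mk v) =
      (Submodule.Quotient.mk (parRep ρ lam u v) : V ⧸ fixedSpace ρ lam) := rfl

theorem apply_parRep (u : stab ρ lam) (v : V) : lam (parRep ρ lam u v) = lam v :=
  apply_of_mem_stab u.2 v

end Parabolic

namespace Operators

variable {V W : Type u} [AddCommGroup V] [Module ℂ V] [Group W]
  {ρ : Representation ℂ W V} {lam : Dual ℂ V} [Fintype (stab ρ lam)] {b : stab ρ lam → ℂ}
  {E : Type*} [AddCommGroup E] [Module ℂ E] {E' : Type*} [AddCommGroup E'] [Module ℂ E']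
  (B' : Operators (parRep ρ lam) b E') (B : Operators (parRep ρ lam) b E)

/-- The vectors on which the invariants of the stabilizer of `lam` act through `lam`. -/
def fix : Submodule ℂ E where
  carrier := {e | ∀ z ∈ fixedSpace ρ lam, B.y z e = lam z • e}
  add_mem' h h' z hz := by rw [map_add, h z hz, h' z hz, smul_add]
  zero_mem' z _ := by simp
  smul_mem' a e h z hz := by rw [map_smul, h z hz, smul_comm]

theorem mem_fix {e : E} : e ∈ B.fix ↔ ∀ z ∈ fixedSpace ρ lam, B.y z e = lam z • e := Iff.rfl

/-- The operators `v - lam v` on the fixed vectors. -/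
def fixYOfVector : V →ₗ[ℂ] End ℂ B.fix where
  toFun v := (B.y v - lam v • 1).restrict (p := B.fix) (q := B.fix) fun e he z hz => by
    have := B.mem_fix.1 he z hz
    simp only [LinearMap.sub_apply, LinearMap.smul_apply, End.one_apply, map_sub, map_smul,
      B.y_y z v, this, smul_sub]
    rw [smul_comm]
  map_add' v v' := LinearMap.ext fun e => Subtype.ext <| by
    change (B.y (v + v') - lam (v + v') • (1 : End ℂ E)) e =
      (B.y v - lam v • (1 : End ℂ E)) e + (B.y v' - lam v' • (1 : End ℂ E)) e
    simp [add_smul]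
    abel
  map_smul' a v := LinearMap.ext fun e => Subtype.ext <| by
    change (B.y (a • v) - lam (a • v) • (1 : End ℂ E)) e =
      a • (B.y v - lam v • (1 : End ℂ E)) e
    simp [smul_sub, smul_smul]

/-- The action of the quotient of `V` on the fixed vectors. -/
def fixY : (V ⧸ fixedSpace ρ lam) →ₗ[ℂ] End ℂ B.fix :=
  (fixedSpace ρ lam).liftQ B.fixYOfVector fun z hz => by
    rw [LinearMap.mem_ker]
    refine LinearMap.ext fun e => Subtype.ext ?_
    change (B.y z - lam z • (1 : End ℂ E)) e = 0
    simp [B.mem_fix.1 e.2 z hz]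

theorem coe_fixY (v : V) (e : B.fix) :
    (B.fixY (Submodule.Quotient.mk v) e : E) = B.y v e - lam v • (e : E) := rfl

/-- The action of the dual of the quotient of `V` on the fixed vectors. -/
def fixX : Dual ℂ (V ⧸ fixedSpace ρ lam) →ₗ[ℂ] End ℂ B.fix where
  toFun ξ := (B.x (ξ ∘ₗ (fixedSpace ρ lam).mkQ)).restrict (p := B.fix) (q := B.fix)
    fun e he z hz => by
      -- A fixed `z` commutes with forms on the quotient: `s z - z = 0` removes the group terms, and
      -- the form vanishes on `z`.
      rw [B.y_x, B.mem_fix.1 he z hz]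
      simp only [parRep_apply_of_mem hz, sub_self, map_zero, mul_zero, zero_smul,
        Finset.sum_const_zero, sub_zero, map_smul, LinearMap.comp_apply,
        (Submodule.Quotient.mk_eq_zero _).2 hz, Submodule.mkQ_apply, add_zero]
  map_add' ξ ξ' := LinearMap.ext fun e => Subtype.ext <| by
    change B.x ((ξ + ξ') ∘ₗ _) (e : E) = B.x (ξ ∘ₗ _) (e : E) + B.x (ξ' ∘ₗ _) (e : E)
    rw [LinearMap.add_comp, map_add, LinearMap.add_apply]
  map_smul' a ξ := LinearMap.ext fun e => Subtype.ext <| by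
    change B.x ((a • ξ) ∘ₗ _) (e : E) = a • B.x (ξ ∘ₗ _) (e : E)
    rw [LinearMap.smul_comp, map_smul, LinearMap.smul_apply]

theorem coe_fixX (ξ : Dual ℂ (V ⧸ fixedSpace ρ lam)) (e : B.fix) :
    (B.fixX ξ e : E) = B.x (ξ ∘ₗ (fixedSpace ρ lam).mkQ) e := rfl

/-- The action of the stabilizer of `lam` on the fixed vectors. -/
def fixG : Representation ℂ (stab ρ lam) B.fix where
  toFun u := (B.g u).restrict (p := B.fix) (q := B.fix) fun e he => B.mem_fix.2 fun z hz => by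
    have := B.g_y u z e
    rwa [B.mem_fix.1 he z hz, map_smul, parRep_apply_of_mem hz, eq_comm] at this
  map_one' := by ext; simp
  map_mul' u t := LinearMap.ext fun e => Subtype.ext (B.g_mul u t e)

/-- The operators on the fixed vectors, for the quotient representation. -/
def fixOps : Operators (quotRep ρ lam) b B.fix where
  g := B.fixG
  y := B.fixY
  x := B.fixX
  g_y u v e := by
    induction v using Submodule.Quotient.induction_on with | _ v =>
    refine Subtype.ext ?_
    rw [quotRep_mk, coe_fixY, apply_parRep]
    change B.g u (B.fixY (Submodule.Quotient.mk v) e : E) = B.y (parRep ρ lam u v) (B.g u e) -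
      lam v • B.g u e
    rw [coe_fixY, map_sub, map_smul, B.g_y]
  g_x u ξ e := Subtype.ext (by
    change B.g u (B.x _ (e : E)) = B.x _ (B.g u e)
    rw [B.g_x]
    rfl)
  x_x ξ ξ' e := Subtype.ext (B.x_x _ _ _)
  y_y v v' e := by
    induction v using Submodule.Quotient.induction_on with | _ v =>
    induction v' using Submodule.Quotient.induction_on with | _ v' =>
    refine Subtype.ext ?_
    simp only [coe_fixY, map_sub, map_smul, B.y_y v v', smul_sub, smul_comm (lam v)]
    abel
  y_x v ξ e := by
    induction v using Submodule.Quotient.induction_on with | _ v =>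
    refine Subtype.ext ?_
    rw [coe_fixY, coe_fixX, B.y_x]
    have h1 : ((∑ s, (b s * ξ (quotRep ρ lam s (Submodule.Quotient.mk v) -
        Submodule.Quotient.mk v)) • B.fixG s e : B.fix) : E)
        = ∑ s, (b s * (ξ ∘ₗ (fixedSpace ρ lam).mkQ) (parRep ρ lam s v - v)) • B.g s (e : E) := by
      rw [AddSubmonoidClass.coe_finsetSum]
      rfl
    change _ = (B.fixX ξ (B.fixY (Submodule.Quotient.mk v) e) : E) +
      ξ (Submodule.Quotient.mk v) • (e : E) - ((∑ s, _ : B.fix) : E)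
    rw [h1, coe_fixX, coe_fixY, map_sub, map_smul]
    simp only [LinearMap.comp_apply, Submodule.mkQ_apply]
    abel

variable {B'}

theorem fixOps_isNil (hB : IsNil B.y lam) : IsNil B.fixOps.y 0 := by
  intro v e
  induction v using Submodule.Quotient.induction_on with | _ v =>
  obtain ⟨n, hn⟩ := hB v e
  refine ⟨n, Subtype.ext ?_⟩
  have h : ∀ m : B.fix, (B.fix.subtype) (B.fixOps.y (Submodule.Quotient.mk v) m) =
      (B.y v - lam v • 1) (B.fix.subtype m) := fun m => by
    rw [LinearMap.sub_apply]
    exact B.coe_fixY v m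
  have := map_sub_pow h 0 n e
  rw [zero_smul, zero_smul, sub_zero, sub_zero] at this
  rw [LinearMap.zero_apply, zero_smul, sub_zero]
  exact this.trans hn

variable {B}

/-- The restriction of an intertwining map to the fixed vectors. -/
def fixMap {f : E →ₗ[ℂ] E'} (hf : Intertwines B B' f) : B.fix →ₗ[ℂ] B'.fix :=
  f.restrict fun e he z hz => by rw [← hf.y, B.mem_fix.1 he z hz, map_smul]

theorem fixMap_intertwines {f : E →ₗ[ℂ] E'} (hf : Intertwines B B' f) :
    Intertwines B.fixOps B'.fixOps (fixMap hf) where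
  g u e := Subtype.ext (hf.g u e)
  y v e := by
    induction v using Submodule.Quotient.induction_on with | _ v =>
    refine Subtype.ext ?_
    change f (B.y v e - lam v • (e : E)) = B'.y v (f e) - lam v • f e
    rw [map_sub, map_smul, hf.y]
  x ξ e := Subtype.ext (hf.x _ e)

end Operators

end FixedVectors

/-! ### Derivations of polynomials, and the invariant splitting of `V`. -/

section PolynomialDerivations

section Polynomials

open MvPolynomial

variable {k : Type*}

/-- The derivation of a polynomial ring in the direction of a vector. -/
def dirDeriv : (k → ℂ) →ₗ[ℂ] Derivation ℂ (MvPolynomial k ℂ) (MvPolynomial k ℂ) where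
  toFun c := mkDerivation ℂ fun i => C (c i)
  map_add' c c' := by
    ext i
    simp
  map_smul' a c := by
    ext i
    simp [smul_eq_C_mul]

theorem dirDeriv_X (c : k → ℂ) (i : k) : dirDeriv c (X i) = C (c i) := by
  simp [dirDeriv]

theorem dirDeriv_single [DecidableEq k] (i : k) : dirDeriv (Pi.single i (1 : ℂ)) = pderiv i := by
  ext j
  rw [dirDeriv_X, pderiv_X]
  by_cases h : j = i
  · subst h; simp
  · simp [h]

theorem dirDeriv_comm (c c' : k → ℂ) (p : MvPolynomial k ℂ) :
    dirDeriv c (dirDeriv c' p) = dirDeriv c' (dirDeriv c p) := by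
  have : ⁅dirDeriv c, dirDeriv c'⁆ = 0 := by
    ext i
    rw [Derivation.commutator_apply, dirDeriv_X, dirDeriv_X]
    simp
  have h := congrArg (fun d : Derivation ℂ _ _ => d p) this
  rw [Derivation.commutator_apply] at h
  exact sub_eq_zero.1 h

theorem dirDeriv_nil (c : k → ℂ) (p : MvPolynomial k ℂ) :
    ∃ n : ℕ, (((dirDeriv c).toLinearMap : End ℂ (MvPolynomial k ℂ)) ^ n) p = 0 := by
  set d : End ℂ (MvPolynomial k ℂ) := (dirDeriv c).toLinearMap with hd
  have hdX : ∀ p i, d (p * X i) = d p * X i + c i • p := by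
    intro p i
    change dirDeriv c (p * X i) = dirDeriv c p * X i + _
    rw [Derivation.leibniz, dirDeriv_X, smul_eq_mul, smul_eq_mul, smul_eq_C_mul]
    ring
  induction p using MvPolynomial.induction_on with
  | C a => exact ⟨1, by rw [pow_one]; exact Derivation.map_algebraMap _ _⟩
  | add p q hp hq =>
    obtain ⟨n, hn⟩ := hp
    obtain ⟨m, hm⟩ := hq
    refine ⟨n + m, ?_⟩
    rw [map_add]
    nth_rewrite 1 [add_comm n m]
    rw [pow_add, pow_add, End.mul_apply, End.mul_apply, hn, hm, map_zero, map_zero, add_zero]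
  | mul_X p i hp =>
    obtain ⟨n, hn⟩ := hp
    -- Leibniz's rule for iterated derivatives has only two terms here, because the derivative of a
    -- variable is constant.
    have h : ∀ n : ℕ, (d ^ (n + 1)) (p * X i) =
        (d ^ (n + 1)) p * X i + ((n + 1 : ℕ) * c i) • (d ^ n) p := by
      intro n
      induction n with
      | zero => simp [hdX]
      | succ n ih =>
        rw [pow_succ', End.mul_apply, ih, map_add, hdX, map_smul, ← End.mul_apply, ← pow_succ',
          ← End.mul_apply, ← pow_succ', add_assoc, ← add_smul]
        congr 2
        push_cast
        ring
    refine ⟨n + 1, ?_⟩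
    rw [h, pow_succ', End.mul_apply, hn]
    simp

/-- The homotopy of the Poincaré lemma, in degree zero. -/
theorem exists_homotopy [Fintype k] : ∃ J : k → End ℂ (MvPolynomial k ℂ),
    ∀ p, p = C (coeff 0 p) + ∑ i, J i (pderiv i p) := by
  classical
  -- Division by degree plus one compensates for the degree lost in `pderiv i`: on a monomial `m` of
  -- degree `d > 0`, `X i * S (pderiv i ·)` is multiplication by `m i / d`, and these factors add up
  -- to `1`.
  let S : End ℂ (MvPolynomial k ℂ) := (basisMonomials k ℂ).constr ℂ fun m =>
    ((m.degree : ℂ) + 1)⁻¹ • monomial m 1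
  have hS : ∀ m a, S (monomial m a) = ((m.degree : ℂ) + 1)⁻¹ • monomial m a := by
    intro m a
    have h1 : monomial m a = a • basisMonomials k ℂ m := by simp [smul_monomial]
    rw [h1, map_smul, Basis.constr_basis, smul_comm]
    simp
  refine ⟨fun i => LinearMap.mulLeft ℂ (X i) ∘ₗ S, fun p => ?_⟩
  induction p using MvPolynomial.induction_on' with
  | add p q hp hq =>
    nth_rewrite 1 [hp, hq]
    simp only [map_add, coeff_add, Finset.sum_add_distrib]
    abel
  | monomial m a =>
    have h1 : ∀ i, (LinearMap.mulLeft ℂ (X i) ∘ₗ S) (pderiv i (monomial m a)) =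
        ((m.degree : ℂ)⁻¹ * m i) • monomial m a := by
      intro i
      by_cases hi : m i = 0
      · rw [pderiv_monomial]
        simp [hi]
      · rw [LinearMap.comp_apply, LinearMap.mulLeft_apply, pderiv_monomial, hS, mul_smul_comm,
          ← pderiv_monomial, X_mul_pderiv_monomial, ← Nat.cast_smul_eq_nsmul ℂ, smul_smul]
        congr 3
        have : m.degree = (m - Finsupp.single i 1).degree + 1 := by
          have h2 : m = (m - Finsupp.single i 1) + Finsupp.single i 1 :=
            (tsub_add_cancel_of_le (Finsupp.single_le_iff.2 (Nat.one_le_iff_ne_zero.2 hi))).symm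
          conv_lhs => rw [h2]
          rw [map_add, Finsupp.degree_single]
        rw [this]
        push_cast
        rfl
    rw [Finset.sum_congr rfl fun i _ => h1 i, ← Finset.sum_smul, ← Finset.mul_sum]
    by_cases hm : m = 0
    · subst hm
      simp
    · have h2 : (∑ i, (m i : ℂ)) = m.degree := by
        rw [Finsupp.degree_eq_sum]
        push_cast
        rfl
      have h3 : (m.degree : ℂ) ≠ 0 := by
        rw [Nat.cast_ne_zero, Ne, Finsupp.degree_eq_zero_iff]
        exact hm
      rw [h2, inv_mul_cancel₀ h3, one_smul, coeff_monomial, if_neg hm, map_zero, zero_add]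

end Polynomials

section FixedSpace

variable {V W : Type u} [AddCommGroup V] [Module ℂ V] [Group W]
  (ρ : Representation ℂ W V) (lam : Dual ℂ V)

theorem exists_fixedProj [Fintype (stab ρ lam)] : ∃ π : V →ₗ[ℂ] fixedSpace ρ lam,
    (∀ z : fixedSpace ρ lam, π z = z) ∧ ∀ u v, π (parRep ρ lam u v) = π v := by
  have hcard : (Fintype.card (stab ρ lam) : ℂ) ≠ 0 := by exact_mod_cast Fintype.card_ne_zero
  have : Invertible (Fintype.card (stab ρ lam) : ℂ) := invertibleOfNonzero hcard
  refine ⟨(parRep ρ lam).averageMap.codRestrict _ (parRep ρ lam).averageMap_invariant,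
    fun z => Subtype.ext ((parRep ρ lam).averageMap_id z z.2), fun u v => Subtype.ext ?_⟩
  change (parRep ρ lam).averageMap (parRep ρ lam u v) = (parRep ρ lam).averageMap v
  rw [Representation.averageMap, ← Representation.asAlgebraHom_single_one, ← End.mul_apply,
    ← map_mul, GroupAlgebra.mul_average_right]

/-- An invariant projection onto the fixed vectors. -/
def fixedProj [Fintype (stab ρ lam)] : V →ₗ[ℂ] fixedSpace ρ lam :=
  (exists_fixedProj ρ lam).choose

variable {ρ lam}

theorem fixedProj_coe [Fintype (stab ρ lam)] (z : fixedSpace ρ lam) : fixedProj ρ lam z = z :=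
  (exists_fixedProj ρ lam).choose_spec.1 z

theorem fixedProj_parRep [Fintype (stab ρ lam)] (u : stab ρ lam) (v : V) :
    fixedProj ρ lam (parRep ρ lam u v) = fixedProj ρ lam v :=
  (exists_fixedProj ρ lam).choose_spec.2 u v

variable [Fintype (stab ρ lam)]

variable (ρ lam) in
/-- The part of a linear form that vanishes on the fixed vectors. -/
def dualPart : Dual ℂ V →ₗ[ℂ] Dual ℂ (V ⧸ fixedSpace ρ lam) where
  toFun ξ := (fixedSpace ρ lam).liftQ (ξ - ξ ∘ₗ (fixedSpace ρ lam).subtype ∘ₗ fixedProj ρ lam)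
    fun z hz => by
      have := fixedProj_coe (⟨z, hz⟩ : fixedSpace ρ lam)
      simp [this]
  map_add' ξ ξ' := by
    ext v
    simp
    ring
  map_smul' a ξ := by
    ext v
    simp
    ring

theorem dualPart_mk (ξ : Dual ℂ V) (v : V) :
    dualPart ρ lam ξ (Submodule.Quotient.mk v) = ξ v - ξ (fixedProj ρ lam v) := rfl

theorem dualPart_comp_mkQ (ξ : Dual ℂ (V ⧸ fixedSpace ρ lam)) :
    dualPart ρ lam (ξ ∘ₗ (fixedSpace ρ lam).mkQ) = ξ := by
  ext v
  have : (Submodule.Quotient.mk (fixedProj ρ lam v : V) : V ⧸ fixedSpace ρ lam) = 0 :=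
    (Submodule.Quotient.mk_eq_zero _).2 (fixedProj ρ lam v).2
  simp [dualPart_mk, this]

theorem dualPart_dual (u : stab ρ lam) (ξ : Dual ℂ V) :
    dualPart ρ lam ((parRep ρ lam).dual u ξ) = (quotRep ρ lam).dual u (dualPart ρ lam ξ) := by
  ext v
  simp only [LinearMap.comp_apply, Submodule.mkQ_apply, dualPart_mk, dual_apply_apply, quotRep_mk,
    parRep_apply_of_mem (fixedProj ρ lam v).2, fixedProj_parRep]

variable (ρ lam) [FiniteDimensional ℂ V]

/-- The index set of a basis of the fixed vectors. -/
abbrev FixedIndex : Type := Fin (finrank ℂ (fixedSpace ρ lam))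

/-- A basis of the fixed vectors. -/
def fixedBasis : Basis (FixedIndex ρ lam) ℂ (fixedSpace ρ lam) := finBasis ℂ _

/-- The invariant coordinates that are dual to the basis of the fixed vectors. -/
def fixedCoord (i : FixedIndex ρ lam) : Dual ℂ V :=
  (fixedBasis ρ lam).coord i ∘ₗ fixedProj ρ lam

variable {ρ lam}

theorem fixedCoord_parRep (i : FixedIndex ρ lam) (u : stab ρ lam) (v : V) :
    fixedCoord ρ lam i (parRep ρ lam u v) = fixedCoord ρ lam i v := by
  simp only [fixedCoord, LinearMap.comp_apply, fixedProj_parRep]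

theorem fixedCoord_basis (i j : FixedIndex ρ lam) :
    fixedCoord ρ lam i (fixedBasis ρ lam j) = (Pi.single j 1 : FixedIndex ρ lam → ℂ) i := by
  simp only [fixedCoord, LinearMap.comp_apply, fixedProj_coe, Basis.coord_apply,
    Basis.repr_self, Finsupp.single_apply, Pi.single_apply, eq_comm]

theorem dual_fixedCoord (i : FixedIndex ρ lam) (u : stab ρ lam) :
    (parRep ρ lam).dual u (fixedCoord ρ lam i) = fixedCoord ρ lam i :=
  LinearMap.ext fun v => by rw [dual_apply_apply, fixedCoord_parRep]

theorem sum_fixedCoord (v : V) :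
    ∑ i, fixedCoord ρ lam i v • fixedBasis ρ lam i = fixedProj ρ lam v :=
  (fixedBasis ρ lam).sum_repr (fixedProj ρ lam v)

theorem sum_apply_fixedCoord (ξ : Dual ℂ V) (v : V) :
    ∑ i, ξ (fixedBasis ρ lam i) * fixedCoord ρ lam i v = ξ (fixedProj ρ lam v) := by
  rw [← sum_fixedCoord, AddSubmonoidClass.coe_finsetSum, map_sum]
  simp [mul_comm]

end FixedSpace

end PolynomialDerivations

/-! ### Tensoring with polynomials on the fixed vectors. -/

section WeylOperators

namespace Operators

open TensorProduct MvPolynomial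

variable {V W : Type u} [AddCommGroup V] [Module ℂ V] [Group W] [FiniteDimensional ℂ V]
  {ρ : Representation ℂ W V} {lam : Dual ℂ V} [Fintype (stab ρ lam)] {b : stab ρ lam → ℂ}
  {N : Type*} [AddCommGroup N] [Module ℂ N] {N' : Type*} [AddCommGroup N'] [Module ℂ N']
  (C : Operators (quotRep ρ lam) b N)

/-- Polynomial functions on the fixed vectors. -/
abbrev FixedPoly (ρ : Representation ℂ W V) (lam : Dual ℂ V) : Type :=
  MvPolynomial (FixedIndex ρ lam) ℂ

variable (ρ lam) in
/-- The derivation of the polynomial functions on the fixed vectors in the direction of a vector. -/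
def fixedDeriv : V →ₗ[ℂ] Derivation ℂ (FixedPoly ρ lam) (FixedPoly ρ lam) :=
  dirDeriv ∘ₗ LinearMap.pi (fixedCoord ρ lam)

theorem fixedDeriv_X (v : V) (i : FixedIndex ρ lam) :
    fixedDeriv ρ lam v (X i) = MvPolynomial.C (fixedCoord ρ lam i v) := dirDeriv_X _ i

theorem fixedDeriv_basis (i : FixedIndex ρ lam) :
    fixedDeriv ρ lam (fixedBasis ρ lam i) = pderiv i := by
  rw [← dirDeriv_single]
  refine congrArg dirDeriv (funext fun j => fixedCoord_basis j i)

theorem fixedDeriv_comm (v v' : V) (p : FixedPoly ρ lam) :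
    fixedDeriv ρ lam v (fixedDeriv ρ lam v' p) = fixedDeriv ρ lam v' (fixedDeriv ρ lam v p) :=
  dirDeriv_comm _ _ p

theorem fixedDeriv_parRep (u : stab ρ lam) (v : V) :
    fixedDeriv ρ lam (parRep ρ lam u v) = fixedDeriv ρ lam v :=
  congrArg dirDeriv (funext fun j => fixedCoord_parRep j u v)

variable (ρ lam) in
/-- The restriction of a linear form to the fixed vectors, as a polynomial. -/
def fixedLin : Dual ℂ V →ₗ[ℂ] FixedPoly ρ lam where
  toFun ξ := ∑ i, ξ (fixedBasis ρ lam i) • X i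
  map_add' ξ ξ' := by simp [add_smul, Finset.sum_add_distrib]
  map_smul' a ξ := by simp [Finset.smul_sum, mul_smul]

theorem fixedLin_apply (ξ : Dual ℂ V) :
    fixedLin ρ lam ξ = ∑ i, ξ (fixedBasis ρ lam i) • X i := rfl

theorem fixedLin_dual (u : stab ρ lam) (ξ : Dual ℂ V) :
    fixedLin ρ lam ((parRep ρ lam).dual u ξ) = fixedLin ρ lam ξ := by
  simp only [fixedLin_apply, dual_apply_apply, parRep_apply_of_mem (Subtype.prop _)]

theorem fixedLin_comp_mkQ (ξ : Dual ℂ (V ⧸ fixedSpace ρ lam)) :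
    fixedLin ρ lam (ξ ∘ₗ (fixedSpace ρ lam).mkQ) = 0 := by
  rw [fixedLin_apply]
  refine Finset.sum_eq_zero fun i _ => ?_
  have : (Submodule.Quotient.mk (fixedBasis ρ lam i : V) : V ⧸ fixedSpace ρ lam) = 0 :=
    (Submodule.Quotient.mk_eq_zero _).2 (Subtype.prop _)
  simp [this]

theorem fixedDeriv_fixedLin (v : V) (ξ : Dual ℂ V) :
    fixedDeriv ρ lam v (fixedLin ρ lam ξ) = MvPolynomial.C (ξ (fixedProj ρ lam v)) := by
  rw [fixedLin_apply, map_sum, ← sum_apply_fixedCoord, map_sum]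
  refine Finset.sum_congr rfl fun i _ => ?_
  rw [Derivation.map_smul, fixedDeriv_X, smul_eq_C_mul, map_mul]

/-- The action of `V` on polynomials with values in `N`. -/
def weylY : V →ₗ[ℂ] End ℂ (N ⊗[ℂ] FixedPoly ρ lam) where
  toFun v := (C.y (Submodule.Quotient.mk v)).rTensor _ + lam v • 1 +
    (fixedDeriv ρ lam v).toLinearMap.lTensor _
  map_add' v v' := TensorProduct.ext' fun n p => by
    simp [add_smul]
    abel
  map_smul' a v := TensorProduct.ext' fun n p => by
    simp [TensorProduct.smul_tmul', mul_smul]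

theorem weylY_tmul (v : V) (n : N) (p : FixedPoly ρ lam) : C.weylY v (n ⊗ₜ p) =
    C.y (Submodule.Quotient.mk v) n ⊗ₜ p + lam v • (n ⊗ₜ p) + n ⊗ₜ fixedDeriv ρ lam v p := rfl

/-- The action of the dual of `V` on polynomials with values in `N`. -/
def weylX : Dual ℂ V →ₗ[ℂ] End ℂ (N ⊗[ℂ] FixedPoly ρ lam) where
  toFun ξ := (C.x (dualPart ρ lam ξ)).rTensor _ +
    (LinearMap.mulLeft ℂ (fixedLin ρ lam ξ)).lTensor _
  map_add' ξ ξ' := TensorProduct.ext' fun n p => by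
    simp [add_mul, TensorProduct.tmul_add]
    abel
  map_smul' a ξ := TensorProduct.ext' fun n p => by
    simp [TensorProduct.smul_tmul']

theorem weylX_tmul (ξ : Dual ℂ V) (n : N) (p : FixedPoly ρ lam) : C.weylX ξ (n ⊗ₜ p) =
    C.x (dualPart ρ lam ξ) n ⊗ₜ p + n ⊗ₜ (fixedLin ρ lam ξ * p) := rfl

/-- The action of the stabilizer on polynomials with values in `N`. -/
def weylG : Representation ℂ (stab ρ lam) (N ⊗[ℂ] FixedPoly ρ lam) where
  toFun u := (C.g u).rTensor _
  map_one' := by rw [map_one]; exact LinearMap.rTensor_id _ _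
  map_mul' u u' := by rw [map_mul, LinearMap.rTensor_mul]

theorem weylG_tmul (u : stab ρ lam) (n : N) (p : FixedPoly ρ lam) :
    C.weylG u (n ⊗ₜ p) = C.g u n ⊗ₜ p := rfl

theorem linearMap_eq_of_tmul {P Q : Type*} [AddCommGroup P] [Module ℂ P] [AddCommGroup Q]
    [Module ℂ Q] {f f' : N ⊗[ℂ] P →ₗ[ℂ] Q} (h : ∀ n p, f (n ⊗ₜ p) = f' (n ⊗ₜ p))
    (m : N ⊗[ℂ] P) : f m = f' m := by
  rw [TensorProduct.ext' h]

/-- The operators on polynomials with values in `N`. -/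
def weylOps : Operators (parRep ρ lam) b (N ⊗[ℂ] FixedPoly ρ lam) where
  g := C.weylG
  y := C.weylY
  x := C.weylX
  g_y u v m := linearMap_eq_of_tmul (f := C.weylG u * C.weylY v)
    (f' := C.weylY (parRep ρ lam u v) * C.weylG u) (fun n p => by
      simp only [End.mul_apply, weylY_tmul, weylG_tmul, map_add, map_smul, C.g_y, quotRep_mk,
        apply_parRep, fixedDeriv_parRep]) m
  g_x u ξ m := linearMap_eq_of_tmul (f := C.weylG u * C.weylX ξ)
    (f' := C.weylX ((parRep ρ lam).dual u ξ) * C.weylG u) (fun n p => by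
      simp only [End.mul_apply, weylX_tmul, weylG_tmul, map_add, C.g_x, dualPart_dual,
        fixedLin_dual]) m
  x_x ξ ξ' m := linearMap_eq_of_tmul (f := C.weylX ξ * C.weylX ξ')
    (f' := C.weylX ξ' * C.weylX ξ) (fun n p => by
      simp only [End.mul_apply, weylX_tmul, map_add, C.x_x (dualPart ρ lam ξ),
        mul_left_comm (fixedLin ρ lam ξ)]
      abel) m
  y_y v v' m := linearMap_eq_of_tmul (f := C.weylY v * C.weylY v')
    (f' := C.weylY v' * C.weylY v) (fun n p => by
      simp only [End.mul_apply, weylY_tmul, map_add, map_smul, fixedDeriv_comm v v', smul_add,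
        C.y_y (Submodule.Quotient.mk v), smul_comm (lam v)]
      abel) m
  y_x v ξ m := by
    -- The projection onto the fixed vectors is invariant, so `s v - v` has no fixed component and
    -- the group terms live entirely in the factor `N`.
    have h1 : ∀ s, dualPart ρ lam ξ (quotRep ρ lam s (Submodule.Quotient.mk v) -
        Submodule.Quotient.mk v) = ξ (parRep ρ lam s v - v) := by
      intro s
      rw [quotRep_mk, map_sub, dualPart_mk, dualPart_mk, fixedProj_parRep, map_sub]
      ring
    have key := linearMap_eq_of_tmul (f := C.weylY v * C.weylX ξ)
      (f' := C.weylX ξ * C.weylY v + ξ v • 1 -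
        ∑ s, (b s * ξ (parRep ρ lam s v - v)) • C.weylG s) (fun n p => by
        simp only [End.mul_apply, weylY_tmul, weylX_tmul, map_add, map_smul, smul_add,
          LinearMap.sub_apply, LinearMap.add_apply, LinearMap.smul_apply, LinearMap.sum_apply,
          End.one_apply, weylG_tmul, C.y_x, h1, Derivation.leibniz, fixedDeriv_fixedLin,
          TensorProduct.sub_tmul, TensorProduct.add_tmul, TensorProduct.sum_tmul,
          TensorProduct.tmul_add, ← TensorProduct.smul_tmul', smul_eq_mul, dualPart_mk]
        rw [mul_comm p, ← smul_eq_C_mul, TensorProduct.tmul_smul, sub_smul]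
        abel) m
    simpa [LinearMap.sum_apply] using key

end Operators

end WeylOperators

/-! ### Taylor expansion along the fixed directions. -/

section TaylorExpansion

namespace Operators

open TensorProduct MvPolynomial

variable {V W : Type u} [AddCommGroup V] [Module ℂ V] [Group W] [FiniteDimensional ℂ V]
  {ρ : Representation ℂ W V} {lam : Dual ℂ V} [Fintype (stab ρ lam)] {b : stab ρ lam → ℂ}
  {N : Type*} [AddCommGroup N] [Module ℂ N] {N' : Type*} [AddCommGroup N'] [Module ℂ N']
  {E : Type*} [AddCommGroup E] [Module ℂ E] {E' : Type*} [AddCommGroup E'] [Module ℂ E']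

section LocallyNilpotent

variable {P : Type*} [AddCommGroup P] [Module ℂ P]

theorem mem_maxGenEigenspace_rTensor {f : End ℂ N} (hf : ∀ n, ∃ k : ℕ, (f ^ k) n = 0)
    (m : N ⊗[ℂ] P) : m ∈ End.maxGenEigenspace (f.rTensor P : End ℂ (N ⊗[ℂ] P)) 0 := by
  induction m using TensorProduct.induction_on with
  | zero => exact Submodule.zero_mem _
  | add m m' h h' => exact Submodule.add_mem _ h h'
  | tmul n p =>
    obtain ⟨k, hk⟩ := hf n
    refine (End.mem_maxGenEigenspace _ _ _).2 ⟨k, ?_⟩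
    rw [zero_smul, sub_zero, LinearMap.rTensor_pow, LinearMap.rTensor_tmul, hk,
      TensorProduct.zero_tmul]

theorem mem_maxGenEigenspace_lTensor {f : End ℂ P} (hf : ∀ p, ∃ k : ℕ, (f ^ k) p = 0)
    (m : N ⊗[ℂ] P) : m ∈ End.maxGenEigenspace (f.lTensor N : End ℂ (N ⊗[ℂ] P)) 0 := by
  induction m using TensorProduct.induction_on with
  | zero => exact Submodule.zero_mem _
  | add m m' h h' => exact Submodule.add_mem _ h h'
  | tmul n p =>
    obtain ⟨k, hk⟩ := hf p
    refine (End.mem_maxGenEigenspace _ _ _).2 ⟨k, ?_⟩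
    rw [zero_smul, sub_zero, LinearMap.lTensor_pow, LinearMap.lTensor_tmul, hk,
      TensorProduct.tmul_zero]

theorem exists_pow_eq_zero_of_mem {f : End ℂ E} {e : E} (h : e ∈ f.maxGenEigenspace 0) :
    ∃ k : ℕ, (f ^ k) e = 0 := by
  obtain ⟨k, hk⟩ := (End.mem_maxGenEigenspace _ _ _).1 h
  exact ⟨k, by rwa [zero_smul, sub_zero] at hk⟩

theorem exists_add_pow_eq_zero {f g : End ℂ E} (hc : Commute f g) {e : E}
    (hf : e ∈ f.maxGenEigenspace 0) (hg : e ∈ g.maxGenEigenspace 0) :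
    ∃ k : ℕ, ((f + g) ^ k) e = 0 := by
  have h := End.genEigenspace_inf_le_add f g 0 0 ⊤ ⊤ hc ⟨hf, hg⟩
  rw [top_add, add_zero] at h
  exact exists_pow_eq_zero_of_mem h

end LocallyNilpotent

section Weyl

variable (C : Operators (quotRep ρ lam) b N) (C' : Operators (quotRep ρ lam) b N')

theorem weylOps_isNil (hC : IsNil C.y 0) : IsNil C.weylOps.y lam := by
  intro v m
  have hC' : ∀ n, ∃ k : ℕ, (C.y (Submodule.Quotient.mk v) ^ k) n = 0 := fun n => by
    obtain ⟨k, hk⟩ := hC (Submodule.Quotient.mk v) n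
    exact ⟨k, by rwa [LinearMap.zero_apply, zero_smul, sub_zero] at hk⟩
  obtain ⟨k, hk⟩ := exists_add_pow_eq_zero
    (f := (C.y (Submodule.Quotient.mk v)).rTensor (FixedPoly ρ lam))
    (g := (fixedDeriv ρ lam v).toLinearMap.lTensor N)
    (TensorProduct.ext' fun n p => rfl)
    (mem_maxGenEigenspace_rTensor hC' m)
    (mem_maxGenEigenspace_lTensor (dirDeriv_nil fun i => fixedCoord ρ lam i v) m)
  refine ⟨k, ?_⟩
  rw [← hk]
  congr 2
  change (C.y (Submodule.Quotient.mk v)).rTensor (FixedPoly ρ lam) + lam v • 1 +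
    (fixedDeriv ρ lam v).toLinearMap.lTensor N - lam v • 1 = _
  abel

variable (ρ lam N) in
/-- Evaluation at zero of polynomials with values in `N`. -/
def evalZero : N ⊗[ℂ] FixedPoly ρ lam →ₗ[ℂ] N :=
  (TensorProduct.rid ℂ N).toLinearMap ∘ₗ (lcoeff ℂ 0).lTensor N

theorem evalZero_tmul (n : N) (p : FixedPoly ρ lam) :
    evalZero ρ lam N (n ⊗ₜ p) = coeff 0 p • n := rfl

/-- The homotopy of `exists_homotopy`, tensored with `N`, writes `m` as its constant term plus
operators applied to its derivatives. -/
theorem eq_evalZero_tmul {m : N ⊗[ℂ] FixedPoly ρ lam}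
    (hm : ∀ i, (pderiv i).toLinearMap.lTensor N m = 0) : m = evalZero ρ lam N m ⊗ₜ 1 := by
  obtain ⟨J, hJ⟩ := exists_homotopy (k := FixedIndex ρ lam)
  have key := linearMap_eq_of_tmul (f := LinearMap.id)
    (f' := (TensorProduct.mk ℂ N (FixedPoly ρ lam)).flip 1 ∘ₗ evalZero ρ lam N +
      ∑ i, (J i).lTensor N ∘ₗ (pderiv i).toLinearMap.lTensor N) (fun n p => by
      simp only [LinearMap.id_apply, LinearMap.add_apply, LinearMap.comp_apply,
        evalZero_tmul, LinearMap.flip_apply, TensorProduct.mk_apply, LinearMap.sum_apply,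
        LinearMap.lTensor_tmul, Derivation.coeFn_coe]
      rw [← TensorProduct.tmul_sum, TensorProduct.smul_tmul, ← TensorProduct.tmul_add,
        smul_eq_C_mul, mul_one, ← hJ p]) m
  simpa [LinearMap.sum_apply, hm] using key

theorem weylOps_y_basis (i : FixedIndex ρ lam) (m : N ⊗[ℂ] FixedPoly ρ lam) :
    C.weylOps.y (fixedBasis ρ lam i) m = lam (fixedBasis ρ lam i) • m +
      (pderiv i).toLinearMap.lTensor N m := by
  have h0 : (Submodule.Quotient.mk (fixedBasis ρ lam i : V) : V ⧸ fixedSpace ρ lam) = 0 :=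
    (Submodule.Quotient.mk_eq_zero _).2 (Subtype.prop _)
  refine linearMap_eq_of_tmul (f := C.weylY (fixedBasis ρ lam i))
    (f' := lam (fixedBasis ρ lam i) • 1 + (pderiv i).toLinearMap.lTensor N) (fun n p => ?_) m
  rw [weylY_tmul, h0, map_zero, LinearMap.zero_apply, TensorProduct.zero_tmul, zero_add,
    fixedDeriv_basis]
  rfl

theorem mem_fix_iff_basis {B : Operators (parRep ρ lam) b E} {e : E} :
    e ∈ B.fix ↔ ∀ i, B.y (fixedBasis ρ lam i) e = lam (fixedBasis ρ lam i) • e := by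
  refine ⟨fun h i => h _ (Subtype.prop _), fun h z hz => ?_⟩
  have hz' : z = ∑ i, fixedCoord ρ lam i z • (fixedBasis ρ lam i : V) := by
    have := congrArg Subtype.val (sum_fixedCoord (ρ := ρ) (lam := lam) z)
    have h2 := congrArg Subtype.val (fixedProj_coe (ρ := ρ) (lam := lam) ⟨z, hz⟩)
    rw [h2, AddSubmonoidClass.coe_finsetSum] at this
    exact this.symm
  rw [hz']
  simp [map_sum, LinearMap.sum_apply, h, Finset.sum_smul, smul_smul]

/-- The constants, among polynomials with values in `N`. -/
def weylConst : N →ₗ[ℂ] C.weylOps.fix :=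
  ((TensorProduct.mk ℂ N (FixedPoly ρ lam)).flip 1).codRestrict _ fun n =>
    mem_fix_iff_basis.2 fun i => by
      rw [weylOps_y_basis, add_eq_left]
      change n ⊗ₜ pderiv i 1 = 0
      rw [pderiv_one, TensorProduct.tmul_zero]

/-- Fixed directions act on the tensor product as `lam` plus derivatives, so the fixed vectors are
those with zero derivatives, that is, the constants. -/
theorem weylConst_bijective : Function.Bijective C.weylConst := by
  have h : ∀ n, evalZero ρ lam N (n ⊗ₜ 1) = n := fun n => by simp [evalZero_tmul]
  constructor
  · intro n n' hn
    rw [← h n, ← h n']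
    exact congrArg (fun m => evalZero ρ lam N m.1) hn
  · intro m
    refine ⟨evalZero ρ lam N m, Subtype.ext (eq_evalZero_tmul fun i => ?_).symm⟩
    have := mem_fix_iff_basis.1 m.2 i
    rwa [weylOps_y_basis, add_eq_left] at this

theorem weylConst_intertwines : Intertwines C C.weylOps.fixOps C.weylConst where
  g u n := rfl
  y v n := by
    induction v using Submodule.Quotient.induction_on with | _ v =>
    refine Subtype.ext ?_
    change C.y (Submodule.Quotient.mk v) n ⊗ₜ 1 = C.weylY v (n ⊗ₜ 1) - lam v • (n ⊗ₜ 1)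
    rw [weylY_tmul, Derivation.map_one_eq_zero, TensorProduct.tmul_zero]
    abel
  x ξ n := by
    refine Subtype.ext ?_
    change C.x ξ n ⊗ₜ 1 = C.weylX (ξ ∘ₗ (fixedSpace ρ lam).mkQ) (n ⊗ₜ 1)
    rw [weylX_tmul, dualPart_comp_mkQ, fixedLin_comp_mkQ, zero_mul, TensorProduct.tmul_zero,
      add_zero]

variable {C C'}

theorem rTensor_intertwines {f : N →ₗ[ℂ] N'} (hf : Intertwines C C' f) :
    Intertwines C.weylOps C'.weylOps (f.rTensor (FixedPoly ρ lam)) where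
  g u m := linearMap_eq_of_tmul (f := f.rTensor _ ∘ₗ C.weylG u)
    (f' := C'.weylG u ∘ₗ f.rTensor _) (fun n p => by
      simp only [LinearMap.comp_apply, weylG_tmul, LinearMap.rTensor_tmul, hf.g]) m
  y v m := linearMap_eq_of_tmul (f := f.rTensor _ ∘ₗ C.weylY v)
    (f' := C'.weylY v ∘ₗ f.rTensor _) (fun n p => by
      simp only [LinearMap.comp_apply, weylY_tmul, LinearMap.rTensor_tmul, hf.y, map_add,
        map_smul]) m
  x ξ m := linearMap_eq_of_tmul (f := f.rTensor _ ∘ₗ C.weylX ξ)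
    (f' := C'.weylX ξ ∘ₗ f.rTensor _) (fun n p => by
      simp only [LinearMap.comp_apply, weylX_tmul, LinearMap.rTensor_tmul, hf.x, map_add]) m

end Weyl

section Taylor

variable (B' : Operators (parRep ρ lam) b E') (B : Operators (parRep ρ lam) b E)

/-- The action of the polynomial functions on the fixed vectors. -/
def fixedAct : FixedPoly ρ lam →ₐ[ℂ] End ℂ E :=
  (symLift (B.x ∘ₗ (Pi.basisFun ℂ (FixedIndex ρ lam)).constr ℂ (fixedCoord ρ lam))
    fun _ _ => LinearMap.ext fun e => B.x_x _ _ e).comp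
    (SymmetricAlgebra.equivMvPolynomial (Pi.basisFun ℂ (FixedIndex ρ lam))).symm.toAlgHom

theorem fixedAct_X (i : FixedIndex ρ lam) : B.fixedAct (X i) = B.x (fixedCoord ρ lam i) := by
  have h : (SymmetricAlgebra.equivMvPolynomial (Pi.basisFun ℂ (FixedIndex ρ lam))).symm.toAlgHom
      (X i) = SymmetricAlgebra.ι ℂ _ (Pi.basisFun ℂ (FixedIndex ρ lam) i) :=
    SymmetricAlgebra.equivMvPolynomial_symm_X _ i
  rw [fixedAct, AlgHom.comp_apply, h, symLift_ι, LinearMap.comp_apply, Basis.constr_basis]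

theorem fixedAct_mul_X (p : FixedPoly ρ lam) (i : FixedIndex ρ lam) (e : E) :
    B.fixedAct (p * X i) e = B.fixedAct p (B.x (fixedCoord ρ lam i) e) := by
  rw [map_mul, End.mul_apply, fixedAct_X]

theorem fixedAct_C (a : ℂ) (e : E) : B.fixedAct (MvPolynomial.C a) e = a • e := by
  have : B.fixedAct (MvPolynomial.C a) = algebraMap ℂ _ a := B.fixedAct.commutes a
  rw [this]
  rfl

variable {B B'} in
theorem map_fixedAct {f : E →ₗ[ℂ] E'} (hf : ∀ i e, f (B.x (fixedCoord ρ lam i) e) =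
    B'.x (fixedCoord ρ lam i) (f e)) (p : FixedPoly ρ lam) (e : E) :
    f (B.fixedAct p e) = B'.fixedAct p (f e) := by
  induction p using MvPolynomial.induction_on generalizing e with
  | C a => rw [fixedAct_C, fixedAct_C, map_smul]
  | add p q hp hq => simp only [map_add, LinearMap.add_apply, hp, hq]
  | mul_X p i hp => rw [fixedAct_mul_X, fixedAct_mul_X, hp, hf]

/-- The coordinates are invariant, so the group terms disappear and only the Weyl algebra relation
remains. -/
theorem y_fixedCoord (v : V) (i : FixedIndex ρ lam) (e : E) :
    B.y v (B.x (fixedCoord ρ lam i) e) =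
      B.x (fixedCoord ρ lam i) (B.y v e) + fixedCoord ρ lam i v • e := by
  rw [B.y_x, sub_eq_self]
  refine Finset.sum_eq_zero fun s _ => ?_
  rw [map_sub, fixedCoord_parRep, sub_self, mul_zero, zero_smul]

theorem y_fixedAct (v : V) (p : FixedPoly ρ lam) (e : E) :
    B.y v (B.fixedAct p e) = B.fixedAct p (B.y v e) + B.fixedAct (fixedDeriv ρ lam v p) e := by
  induction p using MvPolynomial.induction_on generalizing e with
  | C a =>
    have : fixedDeriv ρ lam v (MvPolynomial.C a) = 0 := Derivation.map_algebraMap _ a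
    rw [fixedAct_C, fixedAct_C, map_smul, this]
    simp
  | add p q hp hq =>
    simp only [map_add, LinearMap.add_apply, hp, hq]
    abel
  | mul_X p i hp =>
    rw [fixedAct_mul_X, fixedAct_mul_X, hp, y_fixedCoord, Derivation.leibniz, fixedDeriv_X,
      smul_eq_mul, smul_eq_mul, mul_comm p, ← smul_eq_C_mul, mul_comm (X i)]
    simp only [map_add, map_smul, LinearMap.add_apply, LinearMap.smul_apply, fixedAct_mul_X]
    abel

theorem fixedAct_fixedLin (ξ : Dual ℂ V) (e : E) : B.fixedAct (fixedLin ρ lam ξ) e =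
    B.x (ξ ∘ₗ (fixedSpace ρ lam).subtype ∘ₗ fixedProj ρ lam) e := by
  have : ξ ∘ₗ (fixedSpace ρ lam).subtype ∘ₗ fixedProj ρ lam =
      ∑ i, ξ (fixedBasis ρ lam i) • fixedCoord ρ lam i := by
    ext v
    simpa using (sum_apply_fixedCoord ξ v).symm
  rw [this, fixedLin_apply]
  simp [map_sum, fixedAct_X]

/-- The comparison of polynomials with values in the fixed vectors with the whole space. -/
def taylor : B.fix ⊗[ℂ] FixedPoly ρ lam →ₗ[ℂ] E :=
  TensorProduct.lift (B.fixedAct.toLinearMap.flip ∘ₗ B.fix.subtype)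

theorem taylor_tmul (n : B.fix) (p : FixedPoly ρ lam) :
    B.taylor (n ⊗ₜ p) = B.fixedAct p n := rfl

theorem taylor_intertwines : Intertwines B.fixOps.weylOps B B.taylor where
  g u m := linearMap_eq_of_tmul (f := B.taylor ∘ₗ B.fixOps.weylG u)
    (f' := B.g u ∘ₗ B.taylor) (fun n p => by
      simp only [LinearMap.comp_apply, weylG_tmul, taylor_tmul]
      rw [map_fixedAct (B := B) (B' := B) (f := B.g u)]
      · rfl
      · intro i e
        rw [B.g_x, dual_fixedCoord]) m
  y v m := linearMap_eq_of_tmul (f := B.taylor ∘ₗ B.fixOps.weylY v)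
    (f' := B.y v ∘ₗ B.taylor) (fun n p => by
      simp only [LinearMap.comp_apply, weylY_tmul, taylor_tmul, map_add, map_smul, y_fixedAct]
      have : (B.fixOps.y (Submodule.Quotient.mk v) n : E) = B.y v n - lam v • (n : E) := rfl
      rw [this, map_sub, map_smul]
      abel) m
  x ξ m := linearMap_eq_of_tmul (f := B.taylor ∘ₗ B.fixOps.weylX ξ)
    (f' := B.x ξ ∘ₗ B.taylor) (fun n p => by
      simp only [LinearMap.comp_apply, weylX_tmul, taylor_tmul, map_add, map_mul, End.mul_apply,
        fixedAct_fixedLin]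
      have h1 : (B.fixOps.x (dualPart ρ lam ξ) n : E) =
          B.x (dualPart ρ lam ξ ∘ₗ (fixedSpace ρ lam).mkQ) n := rfl
      rw [h1, ← map_fixedAct (f := B.x _) (fun i e => B.x_x _ _ e), ← LinearMap.add_apply,
        ← map_add]
      congr 2
      ext v
      simp [dualPart_mk]) m

variable {B B'} in
theorem map_taylor {f : E →ₗ[ℂ] E'} (hf : Intertwines B B' f)
    (m : B.fix ⊗[ℂ] FixedPoly ρ lam) :
    f (B.taylor m) = B'.taylor ((fixMap hf).rTensor _ m) :=
  linearMap_eq_of_tmul (f := f ∘ₗ B.taylor) (f' := B'.taylor ∘ₗ (fixMap hf).rTensor _)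
    (fun n p => map_fixedAct (fun _ e => hf.x _ e) p n) m

variable {B}

/-- Induction on a set of directions outside which all `d i` kill the vector, and inside one
direction on the order of nilpotency: the top Taylor term is subtracted, which lowers the order. A
vector killed by every `d i` is fixed and hence a constant term. -/
theorem taylor_surjective (hB : IsNil B.y lam) : Function.Surjective B.taylor := by
  classical
  let d : FixedIndex ρ lam → End ℂ E := fun i =>
    B.y (fixedBasis ρ lam i) - lam (fixedBasis ρ lam i) • 1
  let T : FixedIndex ρ lam → End ℂ E := fun i => B.x (fixedCoord ρ lam i)
  have hdT : ∀ i j e, d i (T j e) = T j (d i e) + (Pi.single i (1 : ℂ) : _ → ℂ) j • e := by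
    intro i j e
    simp only [d, T, LinearMap.sub_apply, LinearMap.smul_apply, End.one_apply, y_fixedCoord,
      fixedCoord_basis, map_sub, map_smul]
    abel
  have hdd : ∀ i j e, d i (d j e) = d j (d i e) := by
    intro i j e
    simp only [d, LinearMap.sub_apply, LinearMap.smul_apply, End.one_apply, map_sub, map_smul,
      B.y_y (fixedBasis ρ lam i), smul_sub]
    rw [smul_comm]
    abel
  have hfact : ∀ i e, d i e = 0 → ∀ n : ℕ,
      d i ((T i ^ (n + 1)) e) = ((n : ℂ) + 1) • (T i ^ n) e := by
    intro i e he n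
    induction n with
    | zero => simp [hdT, he]
    | succ n ih =>
      rw [pow_succ', End.mul_apply, hdT, ih, map_smul, ← End.mul_apply, ← pow_succ',
        Pi.single_eq_same, ← add_smul]
      push_cast
      ring_nf
  have hfact' : ∀ i e, d i e = 0 → ∀ n : ℕ, (d i ^ n) ((T i ^ n) e) = (n.factorial : ℂ) • e := by
    intro i e he n
    induction n with
    | zero => simp
    | succ n ih =>
      rw [pow_succ, End.mul_apply, hfact i e he, map_smul, ih, smul_smul, Nat.factorial_succ]
      push_cast
      rfl
  have hTr : ∀ i e, e ∈ LinearMap.range B.taylor → T i e ∈ LinearMap.range B.taylor := by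
    rintro i _ ⟨m, rfl⟩
    exact ⟨_, B.taylor_intertwines.x _ m⟩
  have main : ∀ (S : Finset (FixedIndex ρ lam)) (e : E), (∀ i ∉ S, d i e = 0) →
      e ∈ LinearMap.range B.taylor := by
    intro S
    induction S using Finset.induction_on with
    | empty =>
      intro e he
      have hfix : e ∈ B.fix := mem_fix_iff_basis.2 fun i => sub_eq_zero.1 (he i (by simp))
      refine ⟨(⟨e, hfix⟩ : B.fix) ⊗ₜ 1, ?_⟩
      rw [taylor_tmul, map_one, End.one_apply]
    | insert i S hi ih =>
      have inner : ∀ (n : ℕ) (e : E), (∀ j ∉ insert i S, d j e = 0) → (d i ^ n) e = 0 →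
          e ∈ LinearMap.range B.taylor := by
        intro n
        induction n with
        | zero =>
          intro e _ h
          rw [pow_zero, End.one_apply] at h
          rw [h]
          exact Submodule.zero_mem _
        | succ n ihn =>
          intro e he h
          set u := (d i ^ n) e with hu
          have hdu : d i u = 0 := by rw [hu, ← End.mul_apply, ← pow_succ', h]
          have hju : ∀ j ∉ insert i S, d j u = 0 := by
            intro j hj
            have hc : Commute (d j) (d i ^ n) := by
              refine Commute.pow_right ?_ n
              exact LinearMap.ext (hdd j i)
            rw [hu, ← End.mul_apply, hc.eq, End.mul_apply, he j hj, map_zero]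
          have hur : u ∈ LinearMap.range B.taylor := by
            refine ih u fun j hj => ?_
            by_cases hji : j = i
            · rw [hji, hdu]
            · exact hju j (by simp [hji, hj])
          have hTu : (T i ^ n) u ∈ LinearMap.range B.taylor := by
            have : ∀ n : ℕ, (T i ^ n) u ∈ LinearMap.range B.taylor := by
              intro n
              induction n with
              | zero => simpa using hur
              | succ n ih' =>
                rw [pow_succ', End.mul_apply]
                exact hTr i _ ih'
            exact this n
          have hn : (n.factorial : ℂ) ≠ 0 := by exact_mod_cast n.factorial_ne_zero
          -- Since `d i` kills `u`, applying `d i ^ n` to `T i ^ n` of `u` gives `n! u`, so the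
          -- difference is killed by `d i ^ n`. The other directions stay killed because they
          -- commute with `T i`.
          have he' : e - (n.factorial : ℂ)⁻¹ • (T i ^ n) u ∈ LinearMap.range B.taylor := by
            refine ihn _ (fun j hj => ?_) ?_
            · have hji : j ≠ i := fun h => hj (by simp [h])
              have hc : ∀ n : ℕ, d j ((T i ^ n) u) = 0 := by
                intro n
                induction n with
                | zero => simpa using hju j hj
                | succ n ih' =>
                  rw [pow_succ', End.mul_apply, hdT, ih', map_zero, zero_add,
                    Pi.single_eq_of_ne hji.symm, zero_smul]
              rw [map_sub, map_smul, hc, he j hj, smul_zero, sub_zero]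
            · rw [map_sub, map_smul, hfact' i u hdu, smul_smul, inv_mul_cancel₀ hn, one_smul,
                sub_self]
          have := Submodule.add_mem _ he' (Submodule.smul_mem _ (n.factorial : ℂ)⁻¹ hTu)
          rwa [sub_add_cancel] at this
      intro e he
      obtain ⟨n, hn⟩ := hB (fixedBasis ρ lam i) e
      exact inner n e he hn
  exact fun e => main Finset.univ e (by simp)

/-- The kernel is stable under the derivatives, which commute and are locally nilpotent. A nonzero
kernel would therefore contain a nonzero constant, but on constants the map is the inclusion of the
fixed vectors. -/
theorem taylor_injective : Function.Injective B.taylor := by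
  classical
  let d : FixedIndex ρ lam → End ℂ (B.fix ⊗[ℂ] FixedPoly ρ lam) := fun i =>
    (pderiv i).toLinearMap.lTensor B.fix
  have hd : ∀ i m, B.taylor m = 0 → B.taylor (d i m) = 0 := by
    intro i m hm
    have h1 := B.taylor_intertwines.y (fixedBasis ρ lam i) m
    rwa [weylOps_y_basis, map_add, map_smul, hm, map_zero, smul_zero, zero_add] at h1
  have hdd : ∀ i j m, d i (d j m) = d j (d i m) := by
    intro i j m
    refine linearMap_eq_of_tmul (f := d i ∘ₗ d j) (f' := d j ∘ₗ d i) (fun n p => ?_) m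
    change n ⊗ₜ pderiv i (pderiv j p) = n ⊗ₜ pderiv j (pderiv i p)
    rw [← dirDeriv_single, ← dirDeriv_single, dirDeriv_comm]
  have hnil : ∀ i m, ∃ n : ℕ, (d i ^ n) m = 0 := fun i m =>
    exists_pow_eq_zero_of_mem (mem_maxGenEigenspace_lTensor (fun p => by
      have := dirDeriv_nil (Pi.single i (1 : ℂ)) p
      rwa [dirDeriv_single] at this) m)
  have main : ∀ (S : Finset (FixedIndex ρ lam)) m, B.taylor m = 0 → (∀ i ∉ S, d i m = 0) →
      m = 0 := by
    intro S
    induction S using Finset.induction_on with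
    | empty =>
      intro m hm h
      have h1 := eq_evalZero_tmul fun i => h i (by simp)
      rw [h1, taylor_tmul, map_one, End.one_apply, ZeroMemClass.coe_eq_zero] at hm
      rw [h1, hm, TensorProduct.zero_tmul]
    | insert i S hi ih =>
      have inner : ∀ (n : ℕ) m, B.taylor m = 0 → (∀ j ∉ insert i S, d j m = 0) →
          (d i ^ n) m = 0 → m = 0 := by
        intro n
        induction n with
        | zero => intro m _ _ h; simpa using h
        | succ n ihn =>
          intro m hm h hn
          have h1 : d i m = 0 := by
            refine ihn _ (hd i m hm) (fun j hj => ?_) ?_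
            · rw [hdd, h j hj, map_zero]
            · rwa [pow_succ, End.mul_apply] at hn
          refine ih m hm fun j hj => ?_
          by_cases hji : j = i
          · rw [hji, h1]
          · exact h j (by simp [hji, hj])
      intro m hm h
      obtain ⟨n, hn⟩ := hnil i m
      exact inner n m hm h hn
  exact (injective_iff_map_eq_zero _).2 fun m hm => main Finset.univ m hm (by simp)

end Taylor

end Operators

end TaylorExpansion

/-! ### Maps and generators under Taylor expansion. -/

section FixedEquivalence

namespace Operators

section Generalities

variable {G U : Type*} [Group G] [Fintype G] [AddCommGroup U] [Module ℂ U]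
  {σ : Representation ℂ G U} {b : G → ℂ} {M : Type*} [AddCommGroup M] [Module ℂ M]
  {M' : Type*} [AddCommGroup M'] [Module ℂ M'] {M'' : Type*} [AddCommGroup M''] [Module ℂ M'']
  {A : Operators σ b M} {A' : Operators σ b M'} {A'' : Operators σ b M''}

theorem Intertwines.comp {f : M →ₗ[ℂ] M'} {f' : M' →ₗ[ℂ] M''} (hf' : Intertwines A' A'' f')
    (hf : Intertwines A A' f) : Intertwines A A'' (f' ∘ₗ f) where
  g w m := by rw [LinearMap.comp_apply, hf.g, hf'.g]; rfl
  y u m := by rw [LinearMap.comp_apply, hf.y, hf'.y]; rfl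
  x ξ m := by rw [LinearMap.comp_apply, hf.x, hf'.x]; rfl

theorem Intertwines.symm {e : M ≃ₗ[ℂ] M'} (he : Intertwines A A' e.toLinearMap) :
    Intertwines A' A e.symm.toLinearMap where
  g w m := e.injective (by simpa using (he.g w (e.symm m)).symm)
  y u m := e.injective (by simpa using (he.y u (e.symm m)).symm)
  x ξ m := e.injective (by simpa using (he.x ξ (e.symm m)).symm)

theorem Stable.map {f : M →ₗ[ℂ] M'} (hf : Intertwines A A' f) {K : Submodule ℂ M}
    (hK : A.Stable K) : A'.Stable (K.map f) where
  g w m hm := by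
    obtain ⟨k, hk, rfl⟩ := hm
    exact ⟨_, hK.g w k hk, hf.g w k⟩
  y u m hm := by
    obtain ⟨k, hk, rfl⟩ := hm
    exact ⟨_, hK.y u k hk, hf.y u k⟩
  x ξ m hm := by
    obtain ⟨k, hk, rfl⟩ := hm
    exact ⟨_, hK.x ξ k hk, hf.x ξ k⟩

theorem Stable.comap {f : M →ₗ[ℂ] M'} (hf : Intertwines A A' f) {K : Submodule ℂ M'}
    (hK : A'.Stable K) : A.Stable (K.comap f) where
  g w m hm := by rw [Submodule.mem_comap, hf.g]; exact hK.g w _ hm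
  y u m hm := by rw [Submodule.mem_comap, hf.y]; exact hK.y u _ hm
  x ξ m hm := by rw [Submodule.mem_comap, hf.x]; exact hK.x ξ _ hm

theorem FG.of_surjective {f : M →ₗ[ℂ] M'} (hf : Intertwines A A' f) (h : Function.Surjective f)
    (hA : A.FG) : A'.FG := by
  obtain ⟨F, hF, hgen⟩ := hA
  refine ⟨f '' F, hF.image f, fun K hK hS => ?_⟩
  have := hgen (K.comap f) (fun m hm => hK ⟨m, hm, rfl⟩) (hS.comap hf)
  rw [eq_top_iff]
  intro m _
  obtain ⟨m, rfl⟩ := h m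
  exact (this ▸ Submodule.mem_top : m ∈ K.comap f)

end Generalities

open TensorProduct MvPolynomial

variable {V W : Type u} [AddCommGroup V] [Module ℂ V] [Group W] [FiniteDimensional ℂ V]
  {ρ : Representation ℂ W V} {lam : Dual ℂ V} [Fintype (stab ρ lam)] {b : stab ρ lam → ℂ}
  {N : Type*} [AddCommGroup N] [Module ℂ N]
  {E : Type*} [AddCommGroup E] [Module ℂ E] {E' : Type*} [AddCommGroup E'] [Module ℂ E']
  {B : Operators (parRep ρ lam) b E} {B' : Operators (parRep ρ lam) b E'}

theorem Intertwines.ext_fix (hB : IsNil B.y lam) {f f' : E →ₗ[ℂ] E'} (hf : Intertwines B B' f)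
    (hf' : Intertwines B B' f') (h : ∀ e ∈ B.fix, f e = f' e) : f = f' := by
  ext e
  obtain ⟨m, rfl⟩ := taylor_surjective hB e
  rw [map_taylor hf, map_taylor hf']
  congr 3
  exact LinearMap.ext fun e => Subtype.ext (h e e.2)

theorem exists_extension_fix (hB : IsNil B.y lam) {φ : B.fix →ₗ[ℂ] B'.fix}
    (hφ : Intertwines B.fixOps B'.fixOps φ) :
    ∃ f : E →ₗ[ℂ] E', Intertwines B B' f ∧ ∀ e : B.fix, f e = φ e := by
  let T := LinearEquiv.ofBijective B.taylor ⟨taylor_injective, taylor_surjective hB⟩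
  have hT : Intertwines B.fixOps.weylOps B T.toLinearMap := B.taylor_intertwines
  refine ⟨(B'.taylor ∘ₗ φ.rTensor _) ∘ₗ T.symm.toLinearMap,
    (B'.taylor_intertwines.comp (rTensor_intertwines hφ)).comp hT.symm, fun e => ?_⟩
  have h1 : T (e ⊗ₜ 1) = e := by
    change B.taylor (e ⊗ₜ 1) = e
    rw [taylor_tmul, map_one, End.one_apply]
  have h2 : T.symm (e : E) = e ⊗ₜ 1 := by rw [← h1, T.symm_apply_apply]
  rw [LinearMap.comp_apply, LinearEquiv.coe_coe, h2, LinearMap.comp_apply,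
    LinearMap.rTensor_tmul, taylor_tmul, map_one, End.one_apply]

theorem FG_of_fix (hB : IsNil B.y lam) (h : B.fixOps.FG) : B.FG := by
  obtain ⟨F, hF, hgen⟩ := h
  refine ⟨Subtype.val '' F, hF.image _, fun K hK hS => ?_⟩
  have h1 : K.comap B.fix.subtype = ⊤ := by
    refine hgen _ (fun m hm => hK ⟨m, hm, rfl⟩) ⟨fun u m hm => hS.g u _ hm, ?_,
      fun ξ m hm => hS.x _ _ hm⟩
    intro v m hm
    induction v using Submodule.Quotient.induction_on with | _ v =>
    exact K.sub_mem (hS.y v _ hm) (K.smul_mem _ hm)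
  have h2 : ∀ (p : FixedPoly ρ lam) (e : E), e ∈ K → B.fixedAct p e ∈ K := by
    intro p
    induction p using MvPolynomial.induction_on with
    | C a => intro e he; rw [fixedAct_C]; exact K.smul_mem _ he
    | add p q hp hq => intro e he; rw [map_add]; exact K.add_mem (hp e he) (hq e he)
    | mul_X p i hp => intro e he; rw [fixedAct_mul_X]; exact hp _ (hS.x _ _ he)
  rw [eq_top_iff]
  rintro e -
  obtain ⟨m, rfl⟩ := taylor_surjective hB e
  induction m using TensorProduct.induction_on with
  | zero => rw [map_zero]; exact K.zero_mem
  | add m m' hm hm' => rw [map_add]; exact K.add_mem hm hm'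
  | tmul n p =>
    exact h2 p n (h1 ▸ Submodule.mem_top : n ∈ K.comap B.fix.subtype)

theorem weylOps_stable {C : Operators (quotRep ρ lam) b N} {K : Submodule ℂ N}
    (hK : C.Stable K) :
    C.weylOps.Stable (LinearMap.range (K.subtype.rTensor (FixedPoly ρ lam))) := by
  have h : ∀ (n : N) (p : FixedPoly ρ lam), n ∈ K →
      n ⊗ₜ p ∈ LinearMap.range (K.subtype.rTensor (FixedPoly ρ lam)) :=
    fun n p hn => ⟨⟨n, hn⟩ ⊗ₜ p, rfl⟩
  have key : ∀ f : End ℂ (N ⊗[ℂ] FixedPoly ρ lam),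
      (∀ n p, n ∈ K → f (n ⊗ₜ p) ∈ LinearMap.range (K.subtype.rTensor (FixedPoly ρ lam))) →
      ∀ m ∈ LinearMap.range (K.subtype.rTensor (FixedPoly ρ lam)),
        f m ∈ LinearMap.range (K.subtype.rTensor (FixedPoly ρ lam)) := by
    rintro f hf _ ⟨m, rfl⟩
    induction m using TensorProduct.induction_on with
    | zero => rw [map_zero, map_zero]; exact Submodule.zero_mem _
    | add m m' hm hm' => rw [map_add, map_add]; exact Submodule.add_mem _ hm hm'
    | tmul n p => exact hf n p n.2
  refine ⟨fun u => key _ fun n p hn => ?_, fun v => key _ fun n p hn => ?_,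
    fun ξ => key _ fun n p hn => ?_⟩
  · exact h _ _ (hK.g u n hn)
  · change C.weylY v _ ∈ _
    rw [weylY_tmul]
    exact Submodule.add_mem _ (Submodule.add_mem _ (h _ _ (hK.y _ n hn))
      (Submodule.smul_mem _ _ (h _ _ hn))) (h _ _ hn)
  · change C.weylX ξ _ ∈ _
    rw [weylX_tmul]
    exact Submodule.add_mem _ (h _ _ (hK.x _ n hn)) (h _ _ hn)

theorem exists_finite_mem_range_rTensor {P : Type*} [AddCommGroup P] [Module ℂ P]
    (m : N ⊗[ℂ] P) : ∃ F : Set N, F.Finite ∧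
      ∀ K : Submodule ℂ N, F ⊆ K → m ∈ LinearMap.range (K.subtype.rTensor P) := by
  induction m using TensorProduct.induction_on with
  | zero => exact ⟨∅, Set.finite_empty, fun K _ => Submodule.zero_mem _⟩
  | add m m' hm hm' =>
    obtain ⟨F, hF, h⟩ := hm
    obtain ⟨F', hF', h'⟩ := hm'
    exact ⟨F ∪ F', hF.union hF', fun K hK => Submodule.add_mem _
      (h K (Set.subset_union_left.trans hK)) (h' K (Set.subset_union_right.trans hK))⟩
  | tmul n p =>
    exact ⟨{n}, Set.finite_singleton n, fun K hK => ⟨⟨n, hK rfl⟩ ⊗ₜ p, rfl⟩⟩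

/-- Finitely many fixed vectors occur in the Taylor expansions of the generators. If a stable `K`
contains them, polynomials with values in `K` give a stable subspace that contains the generators,
hence everything; evaluation at zero shows that `K` contains every constant. -/
theorem FG.fix (hB : IsNil B.y lam) (h : B.FG) : B.fixOps.FG := by
  obtain ⟨F, hF, hgen⟩ := h
  have hm : ∀ e : E, ∃ (m : B.fix ⊗[ℂ] FixedPoly ρ lam) (F' : Set B.fix), B.taylor m = e ∧
      F'.Finite ∧ ∀ K : Submodule ℂ B.fix, F' ⊆ K →
        m ∈ LinearMap.range (K.subtype.rTensor (FixedPoly ρ lam)) := by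
    intro e
    obtain ⟨m, rfl⟩ := taylor_surjective hB e
    obtain ⟨F', h1, h2⟩ := exists_finite_mem_range_rTensor m
    exact ⟨m, F', rfl, h1, h2⟩
  choose m F' h1 h2 h3 using hm
  refine ⟨⋃ e ∈ F, F' e, hF.biUnion fun e _ => h2 e, fun K hK hS => ?_⟩
  have htop := hgen (Submodule.map B.taylor
      (LinearMap.range (K.subtype.rTensor (FixedPoly ρ lam)))) (fun e he =>
      ⟨m e, h3 e K ((Set.subset_biUnion_of_mem he).trans hK), h1 e⟩)
    ((weylOps_stable hS).map B.taylor_intertwines)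
  rw [eq_top_iff]
  intro n _
  obtain ⟨z, ⟨z', hz'⟩, hz⟩ : B.taylor (n ⊗ₜ 1) ∈ Submodule.map B.taylor
      (LinearMap.range (K.subtype.rTensor (FixedPoly ρ lam))) := htop ▸ Submodule.mem_top
  have hz1 := taylor_injective hz
  have h4 : evalZero ρ lam B.fix z ∈ K := by
    rw [← hz']
    clear hz' hz hz1
    induction z' using TensorProduct.induction_on with
    | zero => rw [map_zero, map_zero]; exact K.zero_mem
    | add m m' hm hm' => rw [map_add, map_add]; exact K.add_mem hm hm'
    | tmul n p => exact K.smul_mem _ n.2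
  rw [hz1, evalZero_tmul, coeff_zero_one, one_smul] at h4
  exact h4

end Operators

end FixedEquivalence

/-! ### Generalized eigenvalues of the invariants, and weights. -/

section Support

section CommutingOperators

variable {V : Type*} [AddCommGroup V] [Module ℂ V] {M : Type*} [AddCommGroup M] [Module ℂ M]
  (Y : V →ₗ[ℂ] End ℂ M) (hY : ∀ u v, Y u * Y v = Y v * Y u)

/-- The map `p ↦ p m` for a vector `m`. -/
def polyEval (m : M) : SymmetricAlgebra ℂ V →ₗ[ℂ] M :=
  LinearMap.applyₗ m ∘ₗ (symLift Y hY).toLinearMap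

theorem polyEval_apply (m : M) (p : SymmetricAlgebra ℂ V) :
    polyEval Y hY m p = symLift Y hY p m := rfl

theorem symLift_comm (p q : SymmetricAlgebra ℂ V) (m : M) :
    symLift Y hY p (symLift Y hY q m) = symLift Y hY q (symLift Y hY p m) := by
  rw [← End.mul_apply, ← map_mul, mul_comm, map_mul, End.mul_apply]

/-- The annihilator of a vector `m` in the symmetric algebra. -/
def annIdeal (m : M) : Ideal (SymmetricAlgebra ℂ V) where
  carrier := {p | symLift Y hY p m = 0}
  add_mem' {p q} hp hq := by
    change symLift Y hY (p + q) m = 0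
    rw [map_add, LinearMap.add_apply, show symLift Y hY p m = 0 from hp,
      show symLift Y hY q m = 0 from hq, add_zero]
  zero_mem' := by
    change symLift Y hY 0 m = 0
    rw [map_zero, LinearMap.zero_apply]
  smul_mem' p q hq := by
    change symLift Y hY (p * q) m = 0
    rw [map_mul, End.mul_apply, show symLift Y hY q m = 0 from hq, map_zero]

variable {Y hY}

theorem mem_annIdeal {m : M} {p : SymmetricAlgebra ℂ V} :
    p ∈ annIdeal Y hY m ↔ symLift Y hY p m = 0 := Iff.rfl

theorem mem_radical_annIdeal {m : M} {p : SymmetricAlgebra ℂ V} :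
    p ∈ (annIdeal Y hY m).radical ↔ ∃ n : ℕ, (symLift Y hY p ^ n) m = 0 := by
  simp only [Ideal.mem_radical_iff, mem_annIdeal, map_pow]

theorem symLift_sub_algebraMap (p : SymmetricAlgebra ℂ V) (a : ℂ) :
    symLift Y hY (p - algebraMap ℂ _ a) = symLift Y hY p - a • 1 := by
  rw [map_sub, AlgHom.commutes, Algebra.algebraMap_eq_smul_one]

theorem symLift_mem {K : Submodule ℂ M} (hK : ∀ v, ∀ m ∈ K, Y v m ∈ K)
    (p : SymmetricAlgebra ℂ V) {m : M} (hm : m ∈ K) : symLift Y hY p m ∈ K := by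
  induction p using SymmetricAlgebra.induction generalizing m with
  | algebraMap a =>
    rw [AlgHom.commutes, Algebra.algebraMap_eq_smul_one]
    exact K.smul_mem a hm
  | ι v => rw [symLift_ι]; exact hK v m hm
  | mul p q hp hq => rw [map_mul]; exact hp (hq hm)
  | add p q hp hq => rw [map_add]; exact K.add_mem (hp hm) (hq hm)

end CommutingOperators

section Invariants

variable {V W : Type u} [AddCommGroup V] [Module ℂ V] [Group W] {ρ : Representation ℂ W V}
  {M : Type*} [AddCommGroup M] [Module ℂ M]
  {Y : V →ₗ[ℂ] End ℂ M} {hY : ∀ u v, Y u * Y v = Y v * Y u} {lam : Dual ℂ V}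

theorem lift_dual_of_isInvariant {p : SymmetricAlgebra ℂ V} (hp : IsInvariant ρ p) (w : W) :
    SymmetricAlgebra.lift (ρ.dual w lam) p = SymmetricAlgebra.lift lam p := by
  have h : (SymmetricAlgebra.lift lam).comp
      (SymmetricAlgebra.lift (SymmetricAlgebra.ι ℂ V ∘ₗ ρ w⁻¹)) =
      SymmetricAlgebra.lift (ρ.dual w lam) := by
    ext v
    simp
    rfl
  rw [← h, AlgHom.comp_apply, hp]

open Polynomial in
/-- The polynomial whose roots are the translates of a vector. -/
theorem exists_orbit_polynomial [Fintype W] (ρ : Representation ℂ W V) (v : V) :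
    ∃ Q : (SymmetricAlgebra ℂ V)[X], Q = ∏ w, (X - C (SymmetricAlgebra.ι ℂ V (ρ w v))) ∧
      Q.eval (SymmetricAlgebra.ι ℂ V v) = 0 ∧ ∀ i, IsInvariant ρ (Q.coeff i) := by
  refine ⟨_, rfl, ?_, fun i w => ?_⟩
  · rw [eval_prod]
    exact Finset.prod_eq_zero (Finset.mem_univ 1) (by simp)
  · let τ : SymmetricAlgebra ℂ V →+* SymmetricAlgebra ℂ V :=
      (SymmetricAlgebra.lift (SymmetricAlgebra.ι ℂ V ∘ₗ ρ w)).toRingHom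
    have hτ : ∀ u, τ (SymmetricAlgebra.ι ℂ V u) = SymmetricAlgebra.ι ℂ V (ρ w u) :=
      SymmetricAlgebra.lift_ι_apply _
    have h : (∏ w', (X - C (SymmetricAlgebra.ι ℂ V (ρ w' v)))).map τ =
        ∏ w', (X - C (SymmetricAlgebra.ι ℂ V (ρ w' v))) := by
      rw [Polynomial.map_prod]
      refine Fintype.prod_equiv (Equiv.mulLeft w) _ _ fun w' => ?_
      simp [hτ]
    change τ _ = _
    rw [← coeff_map, h]

open Polynomial in
-- Modulo `J` the invariant coefficients of the orbit polynomial of `v` become their values at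
-- `lam`, so its root `v` is also a root of `∏ (X - lam (w v))`.
theorem prod_mem_radical [Fintype W] {J : Ideal (SymmetricAlgebra ℂ V)}
    (hJ : ∀ p, IsInvariant ρ p → p - algebraMap ℂ _ (SymmetricAlgebra.lift lam p) ∈ J) (v : V) :
    ∏ w, (SymmetricAlgebra.ι ℂ V v - algebraMap ℂ _ (lam (ρ w v))) ∈ J := by
  obtain ⟨Q, hQ, h0, hinv⟩ := exists_orbit_polynomial ρ v
  let e : SymmetricAlgebra ℂ V →+* SymmetricAlgebra ℂ V :=
    (algebraMap ℂ (SymmetricAlgebra ℂ V)).comp (SymmetricAlgebra.lift lam).toRingHom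
  have he : ∀ u, e (SymmetricAlgebra.ι ℂ V u) = algebraMap ℂ _ (lam u) := fun u =>
    congrArg (algebraMap ℂ _) (SymmetricAlgebra.lift_ι_apply lam u)
  have h1 : Q.map (Ideal.Quotient.mk J) = (Q.map e).map (Ideal.Quotient.mk J) := by
    ext i
    rw [coeff_map, coeff_map, coeff_map]
    exact Ideal.Quotient.eq.2 (hJ _ (hinv i))
  have h2 := congrArg (Polynomial.eval (Ideal.Quotient.mk J (SymmetricAlgebra.ι ℂ V v))) h1
  rw [eval_map_apply, eval_map_apply, h0, map_zero, eq_comm, Ideal.Quotient.eq_zero_iff_mem,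
    hQ, Polynomial.map_prod, eval_prod] at h2
  simpa [he] using h2

/-- A power of the monic polynomial `∏ (X - lam (w v))` annihilates `v` in the quotient, so this
finitely generated algebra is integral over `ℂ`. -/
theorem finite_quotient_of_prod_mem [Fintype W] [FiniteDimensional ℂ V]
    {I : Ideal (SymmetricAlgebra ℂ V)}
    (hI : ∀ v, ∏ w, (SymmetricAlgebra.ι ℂ V v - algebraMap ℂ _ (lam (ρ w v))) ∈ I.radical) :
    Module.Finite ℂ (SymmetricAlgebra ℂ V ⧸ I) := by
  have hft : Algebra.FiniteType ℂ (SymmetricAlgebra ℂ V) :=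
    Algebra.FiniteType.equiv inferInstance
      (SymmetricAlgebra.equivMvPolynomial (finBasis ℂ V)).symm
  have hft' : Algebra.FiniteType ℂ (SymmetricAlgebra ℂ V ⧸ I) :=
    hft.of_surjective (Ideal.Quotient.mkₐ ℂ I) (Ideal.Quotient.mkₐ_surjective ℂ I)
  have h_int : ∀ v, IsIntegral ℂ (Ideal.Quotient.mkₐ ℂ I (SymmetricAlgebra.ι ℂ V v)) := by
    intro v
    obtain ⟨n, hn⟩ := hI v
    refine ⟨(∏ w, (Polynomial.X - Polynomial.C (lam (ρ w v)))) ^ n,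
      (Polynomial.monic_prod_of_monic _ _ fun w _ => Polynomial.monic_X_sub_C _).pow n, ?_⟩
    rw [← Polynomial.aeval_def, Polynomial.aeval_algHom_apply]
    refine Ideal.Quotient.eq_zero_iff_mem.2 ?_
    simpa [map_prod] using hn
  have : Algebra.IsIntegral ℂ (SymmetricAlgebra ℂ V ⧸ I) := by
    refine ⟨fun q => ?_⟩
    obtain ⟨p, rfl⟩ := Ideal.Quotient.mkₐ_surjective ℂ I q
    induction p using SymmetricAlgebra.induction with
    | algebraMap a => rw [AlgHom.commutes]; exact isIntegral_algebraMap
    | ι v => exact h_int v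
    | mul p q hp hq => rw [map_mul]; exact hp.mul hq
    | add p q hp hq => rw [map_add]; exact hp.add hq
  exact Algebra.IsIntegral.finite

theorem finite_range_polyEval {m : M}
    (h : Module.Finite ℂ (SymmetricAlgebra ℂ V ⧸ annIdeal Y hY m)) :
    FiniteDimensional ℂ (LinearMap.range (polyEval Y hY m)) := by
  let f : (SymmetricAlgebra ℂ V ⧸ annIdeal Y hY m) →ₗ[ℂ] M :=
    ((annIdeal Y hY m).restrictScalars ℂ).liftQ (polyEval Y hY m) (fun p hp => hp) ∘ₗ
      (Submodule.Quotient.restrictScalarsEquiv ℂ (annIdeal Y hY m)).symm.toLinearMap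
  have : LinearMap.range (polyEval Y hY m) ≤ LinearMap.range f := by
    rintro _ ⟨p, rfl⟩
    exact ⟨Ideal.Quotient.mk _ p, rfl⟩
  exact Submodule.finiteDimensional_of_le this

theorem mem_range_polyEval (m : M) : m ∈ LinearMap.range (polyEval Y hY m) :=
  ⟨1, by rw [polyEval_apply, map_one, End.one_apply]⟩

theorem y_mem_range_polyEval (m : M) (v : V) :
    ∀ n ∈ LinearMap.range (polyEval Y hY m), Y v n ∈ LinearMap.range (polyEval Y hY m) := by
  rintro _ ⟨p, rfl⟩
  refine ⟨SymmetricAlgebra.ι ℂ V v * p, ?_⟩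
  rw [polyEval_apply, map_mul, symLift_ι, End.mul_apply, polyEval_apply]

theorem range_polyEval_le {K : Submodule ℂ M} (hK : ∀ v, ∀ m ∈ K, Y v m ∈ K) {m : M}
    (hm : m ∈ K) : LinearMap.range (polyEval Y hY m) ≤ K := by
  rintro _ ⟨p, rfl⟩
  exact symLift_mem hK p hm

/-- Every invariant `p` acts with generalized eigenvalue `p(lam)`. -/
def ActsThrough (ρ : Representation ℂ W V) (Y : V →ₗ[ℂ] End ℂ M)
    (hY : ∀ u v, Y u * Y v = Y v * Y u) (lam : Dual ℂ V) : Prop :=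
  ∀ p, IsInvariant ρ p → ∀ m, ∃ n : ℕ,
    ((symLift Y hY p - SymmetricAlgebra.lift lam p • 1) ^ n) m = 0

theorem ActsThrough.prod_mem [Fintype W] (h : ActsThrough ρ Y hY lam) (m : M) (v : V) :
    ∏ w, (SymmetricAlgebra.ι ℂ V v - algebraMap ℂ _ (lam (ρ w v))) ∈
      (annIdeal Y hY m).radical :=
  prod_mem_radical (fun p hp => mem_radical_annIdeal.2 (by
    rw [symLift_sub_algebraMap]
    exact h p hp m)) v

theorem ActsThrough.finite [Finite W] [FiniteDimensional ℂ V] (h : ActsThrough ρ Y hY lam)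
    (m : M) : FiniteDimensional ℂ (LinearMap.range (polyEval Y hY m)) := by
  have := Fintype.ofFinite W
  exact finite_range_polyEval (finite_quotient_of_prod_mem (ρ := ρ) (h.prod_mem m))

/-- Otherwise every factor `v - lam (w v)` would be injective on the vectors killed by a power of `v
- χ v`, although the product of the factors is nilpotent on `m`. -/
theorem ActsThrough.exists_apply_eq [Finite W] (h : ActsThrough ρ Y hY lam) {χ : V → ℂ} {m : M}
    (hm : m ∈ ⨅ v, (Y v).maxGenEigenspace (χ v)) (hm0 : m ≠ 0) (v : V) :
    ∃ w, χ v = lam (ρ w v) := by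
  have := Fintype.ofFinite W
  by_contra! hne
  obtain ⟨n, hn⟩ := mem_radical_annIdeal.1 (h.prod_mem m v)
  obtain ⟨k, hk⟩ := (End.mem_iInf_maxGenEigenspace_iff _ _ _).1 hm v
  let T := symLift Y hY (∏ w, (SymmetricAlgebra.ι ℂ V v - algebraMap ℂ _ (lam (ρ w v))))
  have hinj : ∀ (a : ℂ), χ v ≠ a → ∀ e : M, ((Y v - χ v • 1) ^ k) e = 0 →
      symLift Y hY (SymmetricAlgebra.ι ℂ V v - algebraMap ℂ _ a) e = 0 → e = 0 := by
    intro a ha e he h0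
    rw [symLift_sub_algebraMap, symLift_ι] at h0
    refine eq_zero_of_apply_eq_zero (c := χ v - a) (sub_ne_zero.2 ha) ⟨k, ?_⟩ h0
    rw [← he, sub_smul]
    congr 2
    abel
  have hpres : ∀ (p : SymmetricAlgebra ℂ V) (e : M), ((Y v - χ v • 1) ^ k) e = 0 →
      ((Y v - χ v • 1) ^ k) (symLift Y hY p e) = 0 := by
    intro p e he
    have h1 : (Y v - χ v • 1) ^ k =
        symLift Y hY ((SymmetricAlgebra.ι ℂ V v - algebraMap ℂ _ (χ v)) ^ k) := by
      rw [map_pow, symLift_sub_algebraMap, symLift_ι]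
    rw [h1] at he ⊢
    rw [symLift_comm, he, map_zero]
  have hprod : ∀ (S : Finset W) (e : M), ((Y v - χ v • 1) ^ k) e = 0 →
      symLift Y hY (∏ w ∈ S, (SymmetricAlgebra.ι ℂ V v - algebraMap ℂ _ (lam (ρ w v)))) e = 0 →
      e = 0 := by
    classical
    intro S
    induction S using Finset.induction_on with
    | empty => intro e _ h0; simpa using h0
    | insert w S hw ih =>
      intro e he h0
      rw [Finset.prod_insert hw, map_mul, End.mul_apply] at h0
      exact ih e he (hinj _ (hne w) _ (hpres _ e he) h0)
  have hpow : ∀ (n : ℕ) (e : M), ((Y v - χ v • 1) ^ k) e = 0 → (T ^ n) e = 0 → e = 0 := by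
    intro n
    induction n with
    | zero => intro e _ h0; simpa using h0
    | succ n ih =>
      intro e he h0
      rw [pow_succ, End.mul_apply] at h0
      exact hprod _ e he (ih _ (hpres _ e he) h0)
  exact hm0 (hpow n m hk hn)

/-- The element `w` above may depend on `v`. The kernels of `χ - w lam` thus cover `V`; being
finitely many subspaces over an infinite field, one of them is all of `V`. No separation of orbits
by invariants is needed. -/
theorem ActsThrough.exists_eq_dual [Finite W] (h : ActsThrough ρ Y hY lam) {χ : V → ℂ}
    (hχ : ⨅ v, (Y v).maxGenEigenspace (χ v) ≠ ⊥) : ∃ w, ∀ v, χ v = ρ.dual w lam v := by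
  obtain ⟨m, hm, hm0⟩ := Submodule.exists_mem_ne_zero_of_ne_bot hχ
  let χ' : Dual ℂ V :=
    { toFun := χ
      map_add' := End.map_add_of_iInf_genEigenspace_ne_bot_of_commute Y χ ⊤ hχ hY
      map_smul' := End.map_smul_of_iInf_genEigenspace_ne_bot Y χ ⊤ hχ }
  obtain ⟨w, hw⟩ := Subspace.exists_eq_top_of_iUnion_eq_univ
    (p := fun w : W => LinearMap.ker (χ' - ρ.dual w lam)) (by
      rw [Set.eq_univ_iff_forall]
      intro v
      obtain ⟨w, hw⟩ := h.exists_apply_eq hm hm0 v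
      refine Set.mem_iUnion.2 ⟨w⁻¹, ?_⟩
      rw [SetLike.mem_coe, LinearMap.mem_ker, LinearMap.sub_apply, dual_apply_apply, inv_inv,
        sub_eq_zero]
      exact hw)
  refine ⟨w, fun v => sub_eq_zero.1 ?_⟩
  have : v ∈ LinearMap.ker (χ' - ρ.dual w lam) := hw ▸ Submodule.mem_top
  exact this

/-- Each vector of `K` lies in a finite-dimensional cyclic subspace of `K`, where commuting complex
operators have a joint generalized eigenspace decomposition. -/
theorem ActsThrough.le_iSup [Finite W] [FiniteDimensional ℂ V] (h : ActsThrough ρ Y hY lam)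
    {K : Submodule ℂ M} (hK : ∀ v, ∀ m ∈ K, Y v m ∈ K) :
    K ≤ ⨆ w : W, K ⊓ ⨅ v, (Y v).maxGenEigenspace (ρ.dual w lam v) := by
  intro m hm
  set N := LinearMap.range (polyEval Y hY m) with hN
  have := h.finite m
  have hst : ∀ v, Set.MapsTo (Y v) N N := y_mem_range_polyEval m
  have htop := End.iSup_iInf_maxGenEigenspace_eq_top_of_iSup_maxGenEigenspace_eq_top_of_commute
    (fun v => (Y v).restrict (hst v))
    (fun u v _ => LinearMap.ext fun e => Subtype.ext (LinearMap.congr_fun (hY u v) e))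
    (fun v => End.iSup_maxGenEigenspace_eq_top _)
  have hmem : m ∈ (⊤ : Submodule ℂ N).map N.subtype := ⟨⟨m, mem_range_polyEval m⟩, trivial, rfl⟩
  rw [← htop, Submodule.map_iSup] at hmem
  refine SetLike.le_def.1 (iSup_le fun χ => ?_) hmem
  rw [← Submodule.inf_iInf_maxGenEigenspace_of_forall_mapsTo Y N hst]
  by_cases hχ : ⨅ v, (Y v).maxGenEigenspace (χ v) = ⊥
  · rw [hχ, inf_bot_eq]; exact bot_le
  · obtain ⟨w, hw⟩ := h.exists_eq_dual hχ
    simp only [hw]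
    exact le_iSup_of_le w (inf_le_inf_right _ (range_polyEval_le hK hm))

/-- On a vector of weight `w lam`, every `v` equals the scalar `w lam v` modulo the radical of the
annihilator, hence `p` equals `p(w lam)`, which is `p(lam)` for invariant `p`. -/
theorem actsThrough_of_iSup_eq_top
    (h : ⨆ w : W, ⨅ v, (Y v).maxGenEigenspace (ρ.dual w lam v) = ⊤) :
    ActsThrough ρ Y hY lam := by
  intro p hp m
  have key : ⨆ w : W, ⨅ v, (Y v).maxGenEigenspace (ρ.dual w lam v) ≤
      (symLift Y hY p).maxGenEigenspace (SymmetricAlgebra.lift lam p) := by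
    refine iSup_le fun w m hm => ?_
    rw [End.mem_iInf_maxGenEigenspace_iff] at hm
    have h1 : (Ideal.Quotient.mkₐ ℂ (annIdeal Y hY m).radical) =
        (Algebra.ofId ℂ _).comp (SymmetricAlgebra.lift (ρ.dual w lam)) := by
      ext v
      change Ideal.Quotient.mk _ (SymmetricAlgebra.ι ℂ V v) =
        Ideal.Quotient.mk _ (algebraMap ℂ _ (SymmetricAlgebra.lift (ρ.dual w lam) _))
      rw [SymmetricAlgebra.lift_ι_apply]
      refine Ideal.Quotient.eq.2 (mem_radical_annIdeal.2 ?_)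
      rw [symLift_sub_algebraMap, symLift_ι]
      exact hm v
    have h2 : p - algebraMap ℂ _ (SymmetricAlgebra.lift (ρ.dual w lam) p) ∈
      (annIdeal Y hY m).radical := Ideal.Quotient.eq.1 (DFunLike.congr_fun h1 p)
    rw [lift_dual_of_isInvariant hp, mem_radical_annIdeal, symLift_sub_algebraMap] at h2
    exact (End.mem_maxGenEigenspace _ _ _).2 h2
  rw [h] at key
  exact (End.mem_maxGenEigenspace _ _ _).1 (key trivial)

end Invariants

end Support

/-! ### Reflections and parameters without roots. -/

section Reflections

variable {V W : Type u} [AddCommGroup V] [Module ℂ V] [Group W] {ρ : Representation ℂ W V}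

theorem exists_rank_one {s : W} (hs : IsReflection ρ s) :
    ∃ (a : Dual ℂ V) (α : V), α ≠ 0 ∧ ∀ v, ρ s v = v + a v • α := by
  obtain ⟨⟨u, hu⟩, hu0, hall⟩ := finrank_eq_one_iff'.1 hs.2
  have hu0' : u ≠ 0 := fun h => hu0 (Subtype.ext h)
  have hspan : ∀ v, (ρ s - 1) v ∈ Submodule.span ℂ {u} := fun v => by
    obtain ⟨k, hk⟩ := hall ⟨_, v, rfl⟩
    exact Submodule.mem_span_singleton.2 ⟨k, congrArg Subtype.val hk⟩
  refine ⟨(LinearEquiv.toSpanNonzeroSingleton ℂ V u hu0').symm.toLinearMap ∘ₗ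
    (ρ s - 1).codRestrict (Submodule.span ℂ {u}) hspan, u, hu0', fun v => ?_⟩
  have h := congrArg Subtype.val ((LinearEquiv.toSpanNonzeroSingleton ℂ V u hu0').apply_symm_apply
    ((ρ s - 1).codRestrict (Submodule.span ℂ {u}) hspan v))
  rw [LinearEquiv.toSpanNonzeroSingleton_apply] at h
  rw [eq_comm, ← eq_sub_iff_add_eq']
  exact h

theorem trace_of_rank_one [FiniteDimensional ℂ V] {f : End ℂ V} {a : Dual ℂ V} {α : V}
    (h : ∀ v, f v = v + a v • α) : LinearMap.trace ℂ V (f - 1) = a α := by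
  have : f - 1 = a.smulRight α := by
    ext v
    simp [h]
  rw [this, LinearMap.trace_smulRight]

/-- The products `⟨y, α_s⟩ ⟨x, α_s^∨⟩` in terms of the reflection `s`. -/
theorem IsRootFamily.apply_mul_apply [FiniteDimensional ℂ V] {α : W → Dual ℂ V} {αv : W → V}
    (hα : IsRootFamily ρ α αv) {s : W} (hs : IsReflection ρ s) (y : V) (x : Dual ℂ V) :
    α s y * x (αv s) = 2 / LinearMap.trace ℂ V (ρ s - 1) * x (ρ s y - y) := by
  obtain ⟨h1, h2, h3⟩ := hα s hs
  -- This is the form with `s - 1 = f ⊗ αv s`; the factor `1/2` undoes `⟨α s, αv s⟩ = 2`. The root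
  -- is proportional to `f`, and `f (αv s)` is the trace of `s - 1`.
  let f : Dual ℂ V := (2⁻¹ : ℂ) • (α s ∘ₗ (ρ s - 1))
  have hf : ∀ v, ρ s v = v + f v • αv s := by
    intro v
    obtain ⟨k, hk⟩ := Submodule.mem_span_singleton.1 (h2 ▸ ⟨v, rfl⟩ :
      (ρ s - 1) v ∈ Submodule.span ℂ {αv s})
    have : f v = k := by
      change (2⁻¹ : ℂ) * α s ((ρ s - 1) v) = k
      rw [← hk, map_smul, h3, smul_eq_mul]
      ring
    rw [this, hk]
    simp
  have hker : ∀ v, f v = 0 → α s v = 0 := by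
    intro v hv
    have hv' : ρ s v = v := by rw [hf, hv, zero_smul, add_zero]
    have hv'' : ρ s⁻¹ v = v := by
      nth_rewrite 1 [← hv']
      exact ρ.inv_self_apply s v
    obtain ⟨ξ, hξ⟩ : α s ∈ LinearMap.range (ρ.dual s - 1) :=
      h1 ▸ Submodule.mem_span_singleton_self _
    rw [← hξ]
    change ξ (ρ s⁻¹ v) - ξ v = 0
    rw [hv'', sub_self]
  obtain ⟨y₀, hy₀⟩ : αv s ∈ LinearMap.range (ρ s - 1) := h2 ▸ Submodule.mem_span_singleton_self _
  have hfy₀ : f y₀ = 1 := by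
    change (2⁻¹ : ℂ) * α s ((ρ s - 1) y₀) = 1
    rw [hy₀, h3]
    norm_num
  have hα' : ∀ v, α s v = f v * α s y₀ := by
    intro v
    have := hker (v - f v • y₀) (by rw [map_sub, map_smul, hfy₀]; simp)
    rwa [map_sub, map_smul, smul_eq_mul, sub_eq_zero] at this
  have ht := hα' (αv s)
  rw [h3] at ht
  have ht0 : f (αv s) ≠ 0 := fun h => by simp [h] at ht
  rw [trace_of_rank_one hf, hf, add_sub_cancel_left, map_smul, smul_eq_mul, hα' y, ht]
  field_simp

open Classical in
/-- The parameter of the root-free form of the relations. -/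
def coef (ρ : Representation ℂ W V) (c : W → ℂ) (s : W) : ℂ :=
  if IsReflection ρ s then c s * (2 / LinearMap.trace ℂ V (ρ s - 1)) else 0

theorem finsum_reflections [Fintype W] [FiniteDimensional ℂ V] {c : W → ℂ} {α : W → Dual ℂ V}
    {αv : W → V} (hα : IsRootFamily ρ α αv) (y : V) (x : Dual ℂ V) {R : Type*}
    [AddCommGroup R] [Module ℂ R] (g : W → R) :
    ∑ᶠ (s : W) (_ : IsReflection ρ s), (c s * α s y * x (αv s)) • g s =
      ∑ s, (coef ρ c s * x (ρ s y - y)) • g s := by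
  classical
  rw [finsum_eq_sum_of_fintype]
  refine Finset.sum_congr rfl fun s _ => ?_
  rw [finsum_eq_if, coef]
  split_ifs with hs
  · rw [mul_assoc, hα.apply_mul_apply hs, mul_assoc]
  · rw [zero_mul, zero_smul]

theorem IsReflection.conj {s : W} (hs : IsReflection ρ s) (w : W) :
    IsReflection ρ (w * s * w⁻¹) := by
  refine ⟨fun h => hs.1 ?_, ?_⟩
  · rwa [mul_inv_eq_one, mul_eq_left] at h
  · have hinj : Function.Injective (ρ w) :=
      Function.LeftInverse.injective (g := ρ w⁻¹) (ρ.inv_self_apply w)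
    have : LinearMap.range (ρ (w * s * w⁻¹) - 1) = (LinearMap.range (ρ s - 1)).map (ρ w) := by
      ext v
      constructor
      · rintro ⟨u, rfl⟩
        refine ⟨_, ⟨ρ w⁻¹ u, rfl⟩, ?_⟩
        simp
      · rintro ⟨_, ⟨u, rfl⟩, rfl⟩
        exact ⟨ρ w u, by simp⟩
    rw [this, ← (Submodule.equivMapOfInjective (ρ w) hinj _).finrank_eq, hs.2]

theorem isReflection_conj_iff {s w : W} : IsReflection ρ (w * s * w⁻¹) ↔ IsReflection ρ s := by
  refine ⟨fun h => ?_, fun h => h.conj w⟩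
  have := h.conj w⁻¹
  simpa [mul_assoc] using this

theorem trace_conj (s w : W) : LinearMap.trace ℂ V (ρ (w * s * w⁻¹) - 1) =
    LinearMap.trace ℂ V (ρ s - 1) := by
  have : ρ (w * s * w⁻¹) - 1 = ρ w * (ρ s - 1) * ρ w⁻¹ := by
    rw [mul_sub, sub_mul, mul_one, ← map_mul, ← map_mul, ← map_mul, mul_inv_cancel, map_one]
  rw [this, LinearMap.trace_mul_comm, ← mul_assoc, ← map_mul, inv_mul_cancel, map_one, one_mul]

theorem isParam_coef {c : W → ℂ} (hc : ∀ s, IsReflection ρ s → ∀ w, c (w * s * w⁻¹) = c s) :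
    IsParam ρ (coef ρ c) where
  conj s w := by
    by_cases hs : IsReflection ρ s
    · rw [coef, coef, if_pos hs, if_pos (hs.conj w), hc s hs, trace_conj]
    · rw [coef, coef, if_neg hs, if_neg (isReflection_conj_iff.not.2 hs)]
  rank_one s hs := by
    have hs' : IsReflection ρ s := by
      by_contra h
      exact hs (if_neg h)
    obtain ⟨a, α, -, h⟩ := exists_rank_one hs'
    exact ⟨a, α, h⟩

section Parabolic

variable {lam : Dual ℂ V}

/-- If `s` fixes `(s - 1) u`, then `sⁿ u = u + n (s - 1) u`; taking `n` to be the order of `s` gives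
`(s - 1) u = 0`. -/
theorem disjoint_range_fixedSpace [Finite W] (s : stab ρ lam) :
    Disjoint (LinearMap.range (ρ (s : W) - 1)) (fixedSpace ρ lam) := by
  rw [Submodule.disjoint_def]
  rintro _ ⟨u, rfl⟩ h
  have hfix : ρ (s : W) ((ρ (s : W) - 1) u) = (ρ (s : W) - 1) u := h s
  have hn : ∀ n : ℕ, ρ ((s : W) ^ n) u = u + (n : ℂ) • (ρ (s : W) - 1) u := by
    intro n
    induction n with
    | zero => simp
    | succ n ih =>
      rw [pow_succ', map_mul, End.mul_apply, ih, map_add, map_smul, hfix, Nat.cast_succ, add_smul,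
        one_smul]
      simp only [LinearMap.sub_apply, End.one_apply]
      abel
  have h1 := hn (orderOf (s : W))
  rw [pow_orderOf_eq_one, map_one, End.one_apply, left_eq_add] at h1
  exact (smul_eq_zero.1 h1).resolve_left (by exact_mod_cast (orderOf_pos (s : W)).ne')

theorem isReflection_quotRep [Finite W] (s : stab ρ lam) :
    IsReflection (quotRep ρ lam) s ↔ IsReflection ρ (s : W) := by
  have h1 : LinearMap.range (quotRep ρ lam s - 1) = LinearMap.range
      ((fixedSpace ρ lam).mkQ.domRestrict (LinearMap.range (ρ (s : W) - 1))) := by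
    ext v
    constructor
    · rintro ⟨u, rfl⟩
      induction u using Submodule.Quotient.induction_on with | _ u =>
      exact ⟨⟨_, u, rfl⟩, rfl⟩
    · rintro ⟨⟨_, u, rfl⟩, rfl⟩
      exact ⟨Submodule.Quotient.mk u, rfl⟩
  have h2 : Function.Injective
      ((fixedSpace ρ lam).mkQ.domRestrict (LinearMap.range (ρ (s : W) - 1))) := by
    rw [injective_iff_map_eq_zero]
    rintro ⟨v, hv⟩ h
    exact Subtype.ext (Submodule.disjoint_def.1 (disjoint_range_fixedSpace s) v hv
      ((Submodule.Quotient.mk_eq_zero _).1 h))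
  rw [IsReflection, IsReflection, h1, LinearMap.finrank_range_of_inj h2, Ne, Ne,
    OneMemClass.coe_eq_one]

/-- The form `a` in `s - 1 = a ⊗ α` vanishes on the fixed space, so it descends to the quotient and
the trace `a α` is unchanged. -/
theorem coef_quotRep [Finite W] [FiniteDimensional ℂ V] (c : W → ℂ) :
    coef (quotRep ρ lam) (resParam ρ lam c) = resParam ρ lam (coef ρ c) := by
  funext s
  change _ = coef ρ c s
  by_cases hs : IsReflection ρ (s : W)
  · rw [coef, coef, if_pos hs, if_pos ((isReflection_quotRep s).2 hs)]
    obtain ⟨a, α, hα, h⟩ := exists_rank_one hs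
    have ha : fixedSpace ρ lam ≤ LinearMap.ker a := by
      intro z hz
      have h1 : ρ (s : W) z = z := hz s
      rw [h, add_eq_left] at h1
      exact (smul_eq_zero.1 h1).resolve_right hα
    have h' : ∀ v, quotRep ρ lam s v =
        v + (fixedSpace ρ lam).liftQ a ha v • Submodule.Quotient.mk α := by
      intro v
      induction v using Submodule.Quotient.induction_on with | _ v =>
      exact congrArg Submodule.Quotient.mk (h v)
    rw [trace_of_rank_one h, trace_of_rank_one h']
    rfl
  · rw [coef, coef, if_neg hs, if_neg ((isReflection_quotRep s).not.2 hs)]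

end Parabolic

end Reflections

/-! ### Modules over the algebra as families of operators. -/

section AlgebraModules

variable {V W : Type u} [AddCommGroup V] [Module ℂ V] [Group W] (ρ : Representation ℂ W V)
  (c : W → ℂ)

theorem gGen_one : gGen ρ c 1 = 1 := by rw [gGen, mk_rel ρ c Rel.g_one, map_one]

theorem gGen_mul (w w' : W) : gGen ρ c (w * w') = gGen ρ c w * gGen ρ c w' := by
  rw [gGen, mk_rel ρ c (Rel.g_mul w w'), map_mul]
  rfl

theorem gGen_mul_yGen (w : W) (y : V) :
    gGen ρ c w * yGen ρ c y = yGen ρ c (ρ w y) * gGen ρ c w := by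
  change mk ρ c _ * mk ρ c _ = mk ρ c _ * mk ρ c _
  rw [← map_mul, mk_rel ρ c (Rel.g_y w y), map_mul]

theorem gGen_mul_xGen (w : W) (x : Dual ℂ V) :
    gGen ρ c w * xGen ρ c x = xGen ρ c (ρ.dual w x) * gGen ρ c w := by
  change mk ρ c _ * mk ρ c _ = mk ρ c _ * mk ρ c _
  rw [← map_mul, mk_rel ρ c (Rel.g_x w x), map_mul]

theorem xGen_comm (x x' : Dual ℂ V) : xGen ρ c x * xGen ρ c x' = xGen ρ c x' * xGen ρ c x := by
  change mk ρ c _ * mk ρ c _ = mk ρ c _ * mk ρ c _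
  rw [← map_mul, mk_rel ρ c (Rel.xx x x'), map_mul]

theorem yGen_comm (y y' : V) : yGen ρ c y * yGen ρ c y' = yGen ρ c y' * yGen ρ c y := by
  change mk ρ c _ * mk ρ c _ = mk ρ c _ * mk ρ c _
  rw [← map_mul, mk_rel ρ c (Rel.yy y y'), map_mul]

theorem yGen_mul_xGen [Fintype W] [FiniteDimensional ℂ V] (y : V) (x : Dual ℂ V) :
    yGen ρ c y * xGen ρ c x = xGen ρ c x * yGen ρ c y + algebraMap ℂ _ (x y) -
      ∑ s, (coef ρ c s * x (ρ s y - y)) • gGen ρ c s := by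
  obtain ⟨α, αv, hα⟩ := exists_isRootFamily ρ
  have h := mk_rel ρ c (Rel.yx α αv hα y x)
  rw [finsum_reflections hα, map_sub, map_sub, map_mul, map_mul, AlgHom.commutes, map_sum] at h
  simp only [map_smul] at h
  rw [add_sub_assoc, ← sub_eq_iff_eq_add']
  exact h

theorem mk_surjective : Function.Surjective (mk ρ c) := RingQuot.mkAlgHom_surjective ℂ (Rel ρ c)

theorem RCA.induction {p : RCA ρ c → Prop} (scalar : ∀ a : ℂ, p (algebraMap ℂ _ a))
    (g : ∀ w, p (gGen ρ c w)) (y : ∀ v, p (yGen ρ c v)) (x : ∀ ξ, p (xGen ρ c ξ))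
    (mul : ∀ a b, p a → p b → p (a * b)) (h_add : ∀ a b, p a → p b → p (a + b)) (a : RCA ρ c) :
    p a := by
  obtain ⟨a, rfl⟩ := mk_surjective ρ c a
  induction a using FreeAlgebra.induction with
  | grade0 a => rw [AlgHom.commutes]; exact scalar a
  | grade1 i =>
    rcases i with w | v | ξ
    · exact g w
    · exact y v
    · exact x ξ
  | mul a b ha hb => rw [map_mul]; exact mul _ _ ha hb
  | add a b ha hb => rw [map_add]; exact h_add _ _ ha hb

section Modules

variable [Fintype W] [FiniteDimensional ℂ V]

/-- The operators on a module over a rational Cherednik algebra. -/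
def moduleOps (M : Type*) [AddCommGroup M] [Module ℂ M] [Module (RCA ρ c) M]
    [IsScalarTower ℂ (RCA ρ c) M] : Operators ρ (coef ρ c) M where
  g :=
    { toFun w := Algebra.lsmul ℂ ℂ M (gGen ρ c w)
      map_one' := by rw [gGen_one, map_one]
      map_mul' w w' := by rw [gGen_mul, map_mul] }
  y := (Algebra.lsmul ℂ ℂ M).toLinearMap ∘ₗ yGen ρ c
  x := (Algebra.lsmul ℂ ℂ M).toLinearMap ∘ₗ xGen ρ c
  g_y w v m := by
    change gGen ρ c w • yGen ρ c v • m = yGen ρ c (ρ w v) • gGen ρ c w • m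
    rw [← mul_smul, gGen_mul_yGen, mul_smul]
  g_x w ξ m := by
    change gGen ρ c w • xGen ρ c ξ • m = xGen ρ c (ρ.dual w ξ) • gGen ρ c w • m
    rw [← mul_smul, gGen_mul_xGen, mul_smul]
  x_x ξ ξ' m := by
    change xGen ρ c ξ • xGen ρ c ξ' • m = xGen ρ c ξ' • xGen ρ c ξ • m
    rw [← mul_smul, xGen_comm, mul_smul]
  y_y v v' m := by
    change yGen ρ c v • yGen ρ c v' • m = yGen ρ c v' • yGen ρ c v • m
    rw [← mul_smul, yGen_comm, mul_smul]
  y_x v ξ m := by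
    change yGen ρ c v • xGen ρ c ξ • m = xGen ρ c ξ • yGen ρ c v • m + ξ v • m -
      ∑ s, (coef ρ c s * ξ (ρ s v - v)) • gGen ρ c s • m
    rw [← mul_smul, yGen_mul_xGen, sub_smul, add_smul, mul_smul, Finset.sum_smul,
      algebraMap_smul]
    simp only [smul_assoc]

variable {ρ c} {M : Type*} [AddCommGroup M] [Module ℂ M]

/-- The algebra homomorphism defined by operators that satisfy the relations. -/
def Operators.toAlgHom (A : Operators ρ (coef ρ c) M) : RCA ρ c →ₐ[ℂ] End ℂ M :=
  RingQuot.liftAlgHom ℂ ⟨FreeAlgebra.lift ℂ (Sum.elim A.g (Sum.elim A.y A.x)), by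
    have hg : ∀ w, FreeAlgebra.lift ℂ (Sum.elim A.g (Sum.elim A.y A.x)) (fg V w) = A.g w :=
      fun w => FreeAlgebra.lift_ι_apply _ _
    have hy : ∀ v, FreeAlgebra.lift ℂ (Sum.elim A.g (Sum.elim A.y A.x)) (fy W v) = A.y v :=
      fun v => FreeAlgebra.lift_ι_apply _ _
    have hx : ∀ ξ, FreeAlgebra.lift ℂ (Sum.elim A.g (Sum.elim A.y A.x)) (fx W ξ) = A.x ξ :=
      fun ξ => FreeAlgebra.lift_ι_apply _ _
    intro a b h
    induction h with
    | g_one => rw [hg, map_one, map_one]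
    | g_mul w w' => rw [map_mul, hg, hg, hg, map_mul]
    | y_add v v' => rw [map_add, hy, hy, hy, map_add]
    | y_smul a v => rw [map_smul, hy, hy, map_smul]
    | x_add v v' => rw [map_add, hx, hx, hx, map_add]
    | x_smul a v => rw [map_smul, hx, hx, map_smul]
    | g_y w v => rw [map_mul, map_mul, hg, hy, hy]; exact LinearMap.ext (A.g_y w v)
    | g_x w ξ => rw [map_mul, map_mul, hg, hx, hx]; exact LinearMap.ext (A.g_x w ξ)
    | xx ξ ξ' => rw [map_mul, map_mul, hx, hx]; exact LinearMap.ext (A.x_x ξ ξ')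
    | yy v v' => rw [map_mul, map_mul, hy, hy]; exact LinearMap.ext (A.y_y v v')
    | yx α αv hα v ξ =>
      rw [finsum_reflections hα, map_sub, map_sub, map_mul, map_mul, AlgHom.commutes, map_sum]
      simp only [map_smul, hg, hy, hx]
      refine LinearMap.ext fun m => ?_
      simp only [LinearMap.sub_apply, End.mul_apply, A.y_x, LinearMap.sum_apply,
        LinearMap.smul_apply, Algebra.algebraMap_eq_smul_one, End.one_apply]
      abel⟩

theorem Operators.toAlgHom_mk (A : Operators ρ (coef ρ c) M) (a : FreeAlg V W) :
    A.toAlgHom (Cherednik.mk ρ c a) = FreeAlgebra.lift ℂ (Sum.elim A.g (Sum.elim A.y A.x)) a :=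
  RingQuot.liftAlgHom_mkAlgHom_apply _ _ _ _

theorem Operators.toAlgHom_gGen (A : Operators ρ (coef ρ c) M) (w : W) :
    A.toAlgHom (gGen ρ c w) = A.g w :=
  (A.toAlgHom_mk _).trans (FreeAlgebra.lift_ι_apply _ _)

theorem Operators.toAlgHom_yGen (A : Operators ρ (coef ρ c) M) (v : V) :
    A.toAlgHom (yGen ρ c v) = A.y v :=
  (A.toAlgHom_mk _).trans (FreeAlgebra.lift_ι_apply _ _)

theorem Operators.toAlgHom_xGen (A : Operators ρ (coef ρ c) M) (ξ : Dual ℂ V) :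
    A.toAlgHom (xGen ρ c ξ) = A.x ξ :=
  (A.toAlgHom_mk _).trans (FreeAlgebra.lift_ι_apply _ _)

/-- The module over a rational Cherednik algebra defined by operators that satisfy its
relations. -/
def Operators.toModuleCat {M : Type u} [AddCommGroup M] [Module ℂ M]
    (A : Operators ρ (coef ρ c) M) : ModuleCat.{u} (RCA ρ c) :=
  letI : Module (RCA ρ c) M := Module.compHom M A.toAlgHom.toRingHom
  ModuleCat.of (RCA ρ c) M

/-- The vector space underlying the module defined by operators. -/
def Operators.toModuleCatEquiv {M : Type u} [AddCommGroup M] [Module ℂ M]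
    (A : Operators ρ (coef ρ c) M) : M ≃ₗ[ℂ] A.toModuleCat where
  toFun m := m
  invFun m := m
  map_add' _ _ := rfl
  map_smul' a m := by
    change a • m = A.toAlgHom (algebraMap ℂ (RCA ρ c) a) m
    rw [AlgHom.commutes]
    rfl
  left_inv _ := rfl
  right_inv _ := rfl

theorem Operators.toModuleCatEquiv_intertwines {M : Type u} [AddCommGroup M] [Module ℂ M]
    (A : Operators ρ (coef ρ c) M) :
    Operators.Intertwines A (moduleOps ρ c A.toModuleCat) A.toModuleCatEquiv.toLinearMap where
  g w m := by
    change A.g w m = A.toAlgHom (gGen ρ c w) m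
    rw [toAlgHom_gGen]
  y v m := by
    change A.y v m = A.toAlgHom (yGen ρ c v) m
    rw [toAlgHom_yGen]
  x ξ m := by
    change A.x ξ m = A.toAlgHom (xGen ρ c ξ) m
    rw [toAlgHom_xGen]

/-- A linear map that intertwines the operators is linear over the rational Cherednik algebra. -/
def Operators.Intertwines.toLinearMap {M M' : Type*} [AddCommGroup M] [Module ℂ M]
    [Module (RCA ρ c) M] [IsScalarTower ℂ (RCA ρ c) M] [AddCommGroup M'] [Module ℂ M']
    [Module (RCA ρ c) M'] [IsScalarTower ℂ (RCA ρ c) M'] {f : M →ₗ[ℂ] M'}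
    (hf : Operators.Intertwines (moduleOps ρ c M) (moduleOps ρ c M') f) :
    M →ₗ[RCA ρ c] M' where
  toFun := f
  map_add' := map_add f
  map_smul' a m := by
    rw [RingHom.id_apply]
    induction a using RCA.induction ρ c generalizing m with
    | scalar a => rw [algebraMap_smul, algebraMap_smul, map_smul]
    | g w => exact hf.g w m
    | y v => exact hf.y v m
    | x ξ => exact hf.x ξ m
    | mul a b ha hb => rw [mul_smul, mul_smul, ha, hb]
    | h_add a b ha hb => rw [add_smul, add_smul, map_add, ha, hb]

/-- A map that is linear over the rational Cherednik algebra intertwines the operators. -/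
theorem intertwines_of_linear {M M' : Type*} [AddCommGroup M] [Module ℂ M]
    [Module (RCA ρ c) M] [IsScalarTower ℂ (RCA ρ c) M] [AddCommGroup M'] [Module ℂ M']
    [Module (RCA ρ c) M'] [IsScalarTower ℂ (RCA ρ c) M'] (f : M →ₗ[RCA ρ c] M') :
    Operators.Intertwines (moduleOps ρ c M) (moduleOps ρ c M') (f.restrictScalars ℂ) where
  g _ m := f.map_smul _ m
  y _ m := f.map_smul _ m
  x _ m := f.map_smul _ m

end Modules

end AlgebraModules

/-! ### Finite generation over `ℂ[V]` and local finiteness. -/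

section FiniteGeneration

namespace Operators

variable {G U : Type*} [Group G] [Fintype G] [AddCommGroup U] [Module ℂ U]
  {σ : Representation ℂ G U} {b : G → ℂ} {M : Type*} [AddCommGroup M] [Module ℂ M]
  {A : Operators σ b M}

/-- A finite set generates `M` over the dual of `U`. -/
def XFG (A : Operators σ b M) : Prop :=
  ∃ F : Set M, F.Finite ∧
    ∀ K : Submodule ℂ M, F ⊆ K → (∀ ξ, ∀ m ∈ K, A.x ξ m ∈ K) → K = ⊤

theorem XFG.fg (h : A.XFG) : A.FG := by
  obtain ⟨F, hF, hgen⟩ := h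
  exact ⟨F, hF, fun K hK hS => hgen K hK hS.x⟩

/-- The smallest subspace that contains `D` and is stable under the dual of `U`. -/
def xSpan (A : Operators σ b M) (D : Submodule ℂ M) : Submodule ℂ M :=
  sInf {K | D ≤ K ∧ ∀ ξ, ∀ m ∈ K, A.x ξ m ∈ K}

theorem le_xSpan (D : Submodule ℂ M) : D ≤ A.xSpan D := le_sInf fun _ hK => hK.1

theorem xSpan_le {D K : Submodule ℂ M} (h : D ≤ K) (hK : ∀ ξ, ∀ m ∈ K, A.x ξ m ∈ K) :
    A.xSpan D ≤ K := sInf_le ⟨h, hK⟩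

theorem x_mem_xSpan {D : Submodule ℂ M} (ξ : Dual ℂ U) {m : M} (hm : m ∈ A.xSpan D) :
    A.x ξ m ∈ A.xSpan D :=
  (Submodule.mem_sInf).2 fun K hK => hK.2 ξ m ((Submodule.mem_sInf).1 hm K hK)

/-- The relations move group elements and `y` to the right past every `x`, at the cost of terms that
are already in the span. -/
theorem stable_xSpan {D : Submodule ℂ M} (hg : ∀ w, ∀ m ∈ D, A.g w m ∈ D)
    (hy : ∀ u, ∀ m ∈ D, A.y u m ∈ D) : A.Stable (A.xSpan D) := by
  let L : Submodule ℂ M := A.xSpan D ⊓ ((⨅ w, (A.xSpan D).comap (A.g w)) ⊓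
    ⨅ u, (A.xSpan D).comap (A.y u))
  have hL : ∀ m, m ∈ L ↔ m ∈ A.xSpan D ∧ (∀ w, A.g w m ∈ A.xSpan D) ∧
      ∀ u, A.y u m ∈ A.xSpan D := by
    intro m
    simp [L, Submodule.mem_inf, Submodule.mem_iInf]
  have hle : A.xSpan D ≤ L := by
    refine xSpan_le (fun m hm => (hL m).2 ⟨le_xSpan D hm, fun w => le_xSpan D (hg w m hm),
      fun u => le_xSpan D (hy u m hm)⟩) fun ξ m hm => ?_
    obtain ⟨h1, h2, h3⟩ := (hL m).1 hm
    refine (hL _).2 ⟨x_mem_xSpan ξ h1, fun w => ?_, fun u => ?_⟩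
    · rw [A.g_x]; exact x_mem_xSpan _ (h2 w)
    · rw [A.y_x]
      exact Submodule.sub_mem _ (Submodule.add_mem _ (x_mem_xSpan ξ (h3 u))
        (Submodule.smul_mem _ _ h1)) (Submodule.sum_mem _ fun s _ => Submodule.smul_mem _ _ (h2 s))
  exact ⟨fun w m hm => ((hL m).1 (hle hm)).2.1 w, fun u m hm => ((hL m).1 (hle hm)).2.2 u,
    fun ξ m hm => x_mem_xSpan ξ hm⟩

/-- The generators lie in a finite-dimensional space stable under `V`; its translates by the finite
group span a finite-dimensional `D` stable under both. By `stable_xSpan`, `D` generates everything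
under `x` alone. -/
theorem FG.xfg (h : A.FG) (hlf : ∀ m : M, ∃ N : Submodule ℂ M, FiniteDimensional ℂ N ∧ m ∈ N ∧
    ∀ u, ∀ n ∈ N, A.y u n ∈ N) : A.XFG := by
  obtain ⟨F, hF, hgen⟩ := h
  choose N hfin hmem hst using hlf
  have := hF.to_subtype
  let N' : Submodule ℂ M := ⨆ m : F, N m
  let D : Submodule ℂ M := ⨆ w : G, N'.map (A.g w)
  have hN' : ∀ u, N' ≤ N'.comap (A.y u) := fun u =>
    iSup_le fun m => fun n hn => (le_iSup (fun m : F => N m) m) (hst m u n hn)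
  have hD : FiniteDimensional ℂ D := inferInstance
  obtain ⟨T, hT⟩ := (Module.Finite.iff_fg.1 hD)
  have hg : ∀ w, ∀ m ∈ D, A.g w m ∈ D := by
    intro w
    change D ≤ D.comap (A.g w)
    refine iSup_le fun w' => ?_
    rintro _ ⟨n, hn, rfl⟩
    rw [Submodule.mem_comap, ← A.g_mul]
    exact Submodule.mem_iSup_of_mem (w * w') ⟨n, hn, rfl⟩
  have hy : ∀ u, ∀ m ∈ D, A.y u m ∈ D := by
    intro u
    change D ≤ D.comap (A.y u)
    refine iSup_le fun w => ?_
    rintro _ ⟨n, hn, rfl⟩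
    refine Submodule.mem_iSup_of_mem w ⟨A.y (σ w⁻¹ u) n, hN' _ hn, ?_⟩
    rw [A.g_y, σ.self_inv_apply]
  have htop := hgen (A.xSpan D) (fun m hm => le_xSpan D (Submodule.mem_iSup_of_mem 1
    ⟨m, Submodule.mem_iSup_of_mem ⟨m, hm⟩ (hmem m), by simp⟩)) (stable_xSpan hg hy)
  refine ⟨T, T.finite_toSet, fun K hK hx => ?_⟩
  rw [eq_top_iff, ← htop]
  exact xSpan_le (hT ▸ Submodule.span_le.2 hK) hx

end Operators

theorem map_symLift {U A B : Type*} [AddCommGroup U] [Module ℂ U] [Ring A] [Algebra ℂ A] [Ring B]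
    [Algebra ℂ B] (φ : A →ₐ[ℂ] B) {f : U →ₗ[ℂ] A} {hf : ∀ u v, f u * f v = f v * f u}
    {f' : U →ₗ[ℂ] B} {hf' : ∀ u v, f' u * f' v = f' v * f' u} (h : ∀ u, φ (f u) = f' u)
    (p : SymmetricAlgebra ℂ U) : φ (symLift f hf p) = symLift f' hf' p := by
  induction p using SymmetricAlgebra.induction with
  | algebraMap a => rw [AlgHom.commutes, AlgHom.commutes, AlgHom.commutes]
  | ι v => rw [symLift_ι, symLift_ι, h]
  | mul p q hp hq => rw [map_mul, map_mul, map_mul, hp, hq]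
  | add p q hp hq => rw [map_add, map_add, map_add, hp, hq]

section Modules

variable {V W : Type u} [AddCommGroup V] [Module ℂ V] [Group W] {ρ : Representation ℂ W V}
  {c : W → ℂ} [Fintype W] [FiniteDimensional ℂ V]
  {M : Type u} [AddCommGroup M] [Module ℂ M] [Module (RCA ρ c) M] [IsScalarTower ℂ (RCA ρ c) M]

theorem polyX_smul_mem {K : Submodule ℂ M}
    (hK : ∀ ξ, ∀ m ∈ K, (moduleOps ρ c M).x ξ m ∈ K) (p : SymmetricAlgebra ℂ (Dual ℂ V)) {m : M}
    (hm : m ∈ K) : polyX ρ c p • m ∈ K := by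
  have h : Algebra.lsmul ℂ ℂ M (polyX ρ c p) = symLift (moduleOps ρ c M).x
      (fun ξ ξ' => LinearMap.ext ((moduleOps ρ c M).x_x ξ ξ')) p :=
    map_symLift _ (fun _ => rfl) p
  have h2 := symLift_mem (hY := fun ξ ξ' => LinearMap.ext ((moduleOps ρ c M).x_x ξ ξ')) hK p hm
  rw [← h] at h2
  exact h2

theorem isFGOverPoly_iff : IsFGOverPoly ρ c M ↔ (moduleOps ρ c M).XFG := by
  constructor
  · intro h
    obtain ⟨T, hT⟩ := Module.Finite.fg_top (self := h)
    refine ⟨T, T.finite_toSet, fun K hK hx => ?_⟩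
    let K' : Submodule (polyX ρ c).range M :=
      { carrier := K
        add_mem' := K.add_mem
        zero_mem' := K.zero_mem
        smul_mem' := by
          rintro ⟨_, p, rfl⟩ m hm
          exact polyX_smul_mem hx p hm }
    have hle : Submodule.span (polyX ρ c).range (T : Set M) ≤ K' := Submodule.span_le.2 hK
    rw [hT] at hle
    exact eq_top_iff.2 fun m _ => hle trivial
  · rintro ⟨F, hF, hgen⟩
    refine ⟨⟨hF.toFinset, ?_⟩⟩
    rw [hF.coe_toFinset]
    have hst : ∀ ξ, ∀ m ∈ (Submodule.span (polyX ρ c).range F),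
        xGen ρ c ξ • m ∈ Submodule.span (polyX ρ c).range F := by
      intro ξ m hm
      have hr : xGen ρ c ξ ∈ (polyX ρ c).range := ⟨SymmetricAlgebra.ι ℂ _ ξ, symLift_ι _ _ _⟩
      exact Submodule.smul_mem _ (⟨_, hr⟩ : (polyX ρ c).range) hm
    have := hgen ((Submodule.span (polyX ρ c).range F).restrictScalars ℂ)
      Submodule.subset_span hst
    exact (Submodule.restrictScalars_eq_top_iff ℂ _ _).1 this

theorem hasGenEigenvalue_iff {lam : Dual ℂ V} : HasGenEigenvalue ρ c M lam ↔
    ActsThrough ρ (moduleOps ρ c M).y (moduleOps ρ c M).comm lam := by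
  have h : ∀ (p : SymmetricAlgebra ℂ V) (a : ℂ) (n : ℕ) (m : M),
      (polyY ρ c p - algebraMap ℂ (RCA ρ c) a) ^ n • m =
        ((symLift (moduleOps ρ c M).y (moduleOps ρ c M).comm p - a • 1) ^ n) m := by
    intro p a n m
    have h1 : Algebra.lsmul ℂ ℂ M (polyY ρ c p) =
        symLift (moduleOps ρ c M).y (moduleOps ρ c M).comm p := map_symLift _ (fun _ => rfl) p
    rw [← h1, ← Algebra.algebraMap_eq_smul_one, ← AlgHom.commutes (Algebra.lsmul (A := RCA ρ c) ℂ ℂ M),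
      ← map_sub, ← map_pow]
    rfl
  simp only [HasGenEigenvalue, ActsThrough, h]

theorem ActsThrough.isLocallyFinite {lam : Dual ℂ V}
    (h : ActsThrough ρ (moduleOps ρ c M).y (moduleOps ρ c M).comm lam) :
    IsLocallyFinite ρ c M :=
  fun m => ⟨_, h.finite m, mem_range_polyEval m, y_mem_range_polyEval m⟩

end Modules

end FiniteGeneration

/-! ### The composite of both reductions. -/

section ReductionFunctor

namespace Operators

section Support

variable {V W : Type u} [AddCommGroup V] [Module ℂ V] [FiniteDimensional ℂ V] [Group W]
  [Fintype W] {ρ : Representation ℂ W V} {lam : Dual ℂ V} {b : W → ℂ}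
  {M : Type*} [AddCommGroup M] [Module ℂ M] {M' : Type*} [AddCommGroup M'] [Module ℂ M']
  {A' : Operators ρ b M'} {A : Operators ρ b M}

/-- The operators satisfy the relations for any parameter equal to `b`. -/
def changeParam {b' : W → ℂ} (h : b = b') (A : Operators ρ b M) : Operators ρ b' M where
  __ := A
  y_x := h ▸ A.y_x

theorem Intertwines.changeParam {f : M →ₗ[ℂ] M'} (hf : Intertwines A A' f) {b' : W → ℂ}
    (h : b = b') : Intertwines (A.changeParam h) (A'.changeParam h) f := ⟨hf.g, hf.y, hf.x⟩

theorem FG.changeParam (hA : A.FG) {b' : W → ℂ} (h : b = b') : (A.changeParam h).FG := by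
  obtain ⟨F, hF, hgen⟩ := hA
  exact ⟨F, hF, fun K hK hS => hgen K hK ⟨hS.g, hS.y, hS.x⟩⟩

/-- The generalized eigenvalues of the invariants are inherited by stable subspaces, so decomposing
the whole space already decomposes each of them. -/
theorem supp_iff_iSup_eq_top : A.Supp lam ↔ ⨆ w, A.wt (ρ.dual w lam) = ⊤ := by
  refine ⟨Supp.iSup_eq_top, fun h K hK => ?_⟩
  exact (actsThrough_of_iSup_eq_top (hY := A.comm) h).le_iSup hK

theorem actsThrough_iff_supp : ActsThrough ρ A.y A.comm lam ↔ A.Supp lam :=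
  ⟨fun h _ hK => h.le_iSup hK, fun h => actsThrough_of_iSup_eq_top h.iSup_eq_top⟩

theorem Supp.of_surjective (h : A.Supp lam) {f : M →ₗ[ℂ] M'} (hf : Intertwines A A' f)
    (hs : Function.Surjective f) : A'.Supp lam := by
  rw [supp_iff_iSup_eq_top, eq_top_iff, ← LinearMap.range_eq_top.2 hs, LinearMap.range_eq_map,
    ← h.iSup_eq_top, Submodule.map_iSup]
  refine iSup_mono fun w => ?_
  rintro _ ⟨m, hm, rfl⟩
  exact map_mem_wt hf.y hm

theorem supp_zero_iff : A.Supp 0 ↔ IsNil A.y 0 := by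
  rw [supp_iff_iSup_eq_top]
  simp only [map_zero, iSup_const]
  refine ⟨fun h v m => mem_wt.1 (h ▸ Submodule.mem_top) v, fun h => ?_⟩
  exact eq_top_iff.2 fun m _ => mem_wt.2 fun v => h v m

theorem wtMap_bijective {f : M →ₗ[ℂ] M'} (hf : Intertwines A A' f) (h : Function.Bijective f) :
    Function.Bijective (wtMap lam hf) := by
  refine ⟨fun e e' he => Subtype.ext (h.1 (congrArg Subtype.val he)), fun e' => ?_⟩
  let T := LinearEquiv.ofBijective f h
  have hT : Intertwines A A' T.toLinearMap := hf
  exact ⟨⟨T.symm e', map_mem_wt hT.symm.y e'.2⟩, Subtype.ext (T.apply_symm_apply _)⟩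

end Support

section Fixed

variable {V W : Type u} [AddCommGroup V] [Module ℂ V] [Group W]
  {ρ : Representation ℂ W V} {lam : Dual ℂ V} [Fintype (stab ρ lam)] {b : stab ρ lam → ℂ}
  {E : Type*} [AddCommGroup E] [Module ℂ E] {E' : Type*} [AddCommGroup E'] [Module ℂ E']
  {B : Operators (parRep ρ lam) b E} {B' : Operators (parRep ρ lam) b E'}

theorem fixMap_bijective {f : E →ₗ[ℂ] E'} (hf : Intertwines B B' f) (h : Function.Bijective f) :
    Function.Bijective (fixMap hf) := by
  refine ⟨fun e e' he => Subtype.ext (h.1 (congrArg Subtype.val he)), fun e' => ?_⟩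
  let T := LinearEquiv.ofBijective f h
  have hT : Intertwines B B' T.toLinearMap := hf
  exact ⟨fixMap hT.symm e', Subtype.ext (T.apply_symm_apply _)⟩

end Fixed

section Reduction

variable {V W : Type u} [AddCommGroup V] [Module ℂ V] [FiniteDimensional ℂ V] [Group W]
  [Fintype W] {ρ : Representation ℂ W V} {lam : Dual ℂ V} [Fintype (stab ρ lam)] {b : W → ℂ}
  (hρ : Function.Injective ρ) (hb : IsParam ρ b)
  {M : Type*} [AddCommGroup M] [Module ℂ M] {M' : Type*} [AddCommGroup M'] [Module ℂ M']
  {N : Type*} [AddCommGroup N] [Module ℂ N]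
  {A' : Operators ρ b M'} {A : Operators ρ b M}

/-- The vectors of generalized weight `lam` on which the invariants of the stabilizer of `lam` act
through `lam`. -/
abbrev Red (h : A.Supp lam) : Submodule ℂ (A.wt lam) := (A.res hρ hb h).fix

/-- The operators of the parabolic subalgebra on `Red`. -/
abbrev redOps (h : A.Supp lam) : Operators (quotRep ρ lam) (resParam ρ lam b) (Red hρ hb h) :=
  (A.res hρ hb h).fixOps

/-- The inclusion of `Red` into the whole space. -/
def redIncl (h : A.Supp lam) : Red hρ hb h →ₗ[ℂ] M := (A.wt lam).subtype ∘ₗ (Red hρ hb h).subtype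

theorem redIncl_injective (h : A.Supp lam) : Function.Injective (redIncl hρ hb h) :=
  Subtype.val_injective.comp Subtype.val_injective

theorem mem_range_redIncl (h : A.Supp lam) {m : M} : m ∈ LinearMap.range (redIncl hρ hb h) ↔
    m ∈ A.wt lam ∧ ∀ z ∈ fixedSpace ρ lam, A.y z m = lam z • m := by
  constructor
  · rintro ⟨e, rfl⟩
    exact ⟨e.1.2, fun z hz => congrArg Subtype.val (e.2 z hz)⟩
  · rintro ⟨hm, h'⟩
    exact ⟨⟨⟨m, hm⟩, fun z hz => Subtype.ext (h' z hz)⟩, rfl⟩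

theorem redIncl_x (h : A.Supp lam) (ξ : Dual ℂ (V ⧸ fixedSpace ρ lam)) (n : Red hρ hb h) :
    A.x (ξ ∘ₗ (fixedSpace ρ lam).mkQ) (redIncl hρ hb h n) -
      redIncl hρ hb h ((redOps hρ hb h).x ξ n) ∈ A.cowt lam :=
  sub_pr_mem h _

/-- The restriction of an intertwining map to `Red`. -/
def redMap (h : A.Supp lam) (h' : A'.Supp lam) {f : M →ₗ[ℂ] M'} (hf : Intertwines A A' f) :
    Red hρ hb h →ₗ[ℂ] Red hρ hb h' :=
  fixMap (wtMap_intertwines hρ hb h h' hf)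

theorem redMap_intertwines (h : A.Supp lam) (h' : A'.Supp lam) {f : M →ₗ[ℂ] M'}
    (hf : Intertwines A A' f) :
    Intertwines (redOps hρ hb h) (redOps hρ hb h') (redMap hρ hb h h' hf) :=
  fixMap_intertwines _

theorem redMap_bijective (h : A.Supp lam) (h' : A'.Supp lam) {f : M →ₗ[ℂ] M'}
    (hf : Intertwines A A' f) (hbij : Function.Bijective f) :
    Function.Bijective (redMap hρ hb h h' hf) :=
  fixMap_bijective _ (wtMap_bijective hf hbij)

theorem Intertwines.ext_red (h : A.Supp lam) (h' : A'.Supp lam) {f f' : M →ₗ[ℂ] M'}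
    (hf : Intertwines A A' f) (hf' : Intertwines A A' f')
    (heq : ∀ n : Red hρ hb h, f (redIncl hρ hb h n) = f' (redIncl hρ hb h n)) : f = f' := by
  have hw : wtMap lam hf = wtMap lam hf' :=
    Intertwines.ext_fix (res_isNil hρ hb h) (wtMap_intertwines hρ hb h h' hf)
      (wtMap_intertwines hρ hb h h' hf') fun e he => Subtype.ext (heq ⟨e, he⟩)
  exact Intertwines.ext_wt h hf hf' fun m hm =>
    congrArg Subtype.val (LinearMap.congr_fun hw ⟨m, hm⟩)

theorem exists_extension_red (h : A.Supp lam) (h' : A'.Supp lam)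
    {φ : Red hρ hb h →ₗ[ℂ] Red hρ hb h'}
    (hφ : Intertwines (redOps hρ hb h) (redOps hρ hb h') φ) :
    ∃ f : M →ₗ[ℂ] M', Intertwines A A' f ∧
      ∀ n, f (redIncl hρ hb h n) = redIncl hρ hb h' (φ n) := by
  obtain ⟨f₁, hf₁, h₁⟩ := exists_extension_fix (res_isNil hρ hb h) hφ
  obtain ⟨f, hf, h₂⟩ := exists_extension_wt hρ hb h h' hf₁
  refine ⟨f, hf, fun n => ?_⟩
  change f ((n : A.wt lam) : M) = ((φ n : A'.wt lam) : M')
  rw [h₂, h₁]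

theorem redOps_fg (h : A.Supp lam) (hA : A.FG) : (redOps hρ hb h).FG :=
  (hA.res hρ hb h).fix (res_isNil hρ hb h)

theorem redOps_isNil (h : A.Supp lam) : IsNil (redOps hρ hb h).y 0 :=
  fixOps_isNil _ (res_isNil hρ hb h)

/-- If the weight space is the polynomials with values in `N`, its fixed vectors are the constants,
a copy of `N`; generators of `N` generate first the polynomials and then the whole space. -/
theorem exists_redOps_equiv_of_res_equiv
    (C : Operators (quotRep ρ lam) (resParam ρ lam b) N) (hC : IsNil C.y 0) (hfg : C.FG)
    (h : A.Supp lam) {e : A.wt lam ≃ₗ[ℂ] TensorProduct ℂ N (FixedPoly ρ lam)}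
    (he : Intertwines (A.res hρ hb h) C.weylOps e.toLinearMap) :
    A.FG ∧ ∃ e' : N ≃ₗ[ℂ] Red hρ hb h, Intertwines C (redOps hρ hb h) e'.toLinearMap := by
  let e₂ := LinearEquiv.ofBijective _ (fixMap_bijective he e.bijective)
  have he₂ : Intertwines (redOps hρ hb h) C.weylOps.fixOps e₂.toLinearMap :=
    fixMap_intertwines he
  let e₃ := LinearEquiv.ofBijective _ C.weylConst_bijective
  have he₃ : Intertwines C C.weylOps.fixOps e₃.toLinearMap := C.weylConst_intertwines
  have h₁ : C.weylOps.FG :=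
    FG_of_fix (C.weylOps_isNil hC) (hfg.of_surjective he₃ e₃.surjective)
  exact ⟨FG_of_res hρ hb h (h₁.of_surjective he.symm e.symm.surjective), e₃.trans e₂.symm,
    he₂.symm.comp he₃⟩

/-- Every representation of the parabolic subalgebra comes from induction. -/
theorem exists_redOps_equiv {N : Type u} [AddCommGroup N] [Module ℂ N]
    (C : Operators (quotRep ρ lam) (resParam ρ lam b) N) (hC : IsNil C.y 0) (hfg : C.FG) :
    ∃ (M : Type u) (_ : AddCommGroup M) (_ : Module ℂ M) (A : Operators ρ b M)
      (h : A.Supp lam), A.FG ∧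
        ∃ e : N ≃ₗ[ℂ] Red hρ hb h, Intertwines C (redOps hρ hb h) e.toLinearMap := by
  have hB := C.weylOps_isNil hC
  have hA : (indOps hB hb hρ).Supp lam := supp_iff_iSup_eq_top.2 (indOps_iSup hB hb hρ)
  exact ⟨C.weylOps.ind, inferInstance, inferInstance, indOps hB hb hρ, hA,
    exists_redOps_equiv_of_res_equiv hρ hb C hC hfg hA
      (e := LinearEquiv.ofBijective _ (indWtEval_bijective hB hb hρ))
      (indWtEval_intertwines hB hb hρ hA)⟩

end Reduction

end Operators

end ReductionFunctor

/-! ### The equivalence of categories. -/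

section CategoryEquivalence

open Operators

section Membership

variable {V W : Type u} [AddCommGroup V] [Module ℂ V] [FiniteDimensional ℂ V] [Group W]
  [Fintype W] {ρ : Representation ℂ W V} {c : W → ℂ} {lam : Dual ℂ V}

/-- This form of membership passes through both reductions. Local finiteness follows from the
support condition and upgrades generation under all operators to generation over `ℂ[V]`. -/
theorem catO_iff {M : ModuleCat.{u} (RCA ρ c)} :
    catO ρ c lam M ↔ (moduleOps ρ c M).FG ∧ (moduleOps ρ c M).Supp lam := by
  rw [catO, isFGOverPoly_iff, hasGenEigenvalue_iff, ← actsThrough_iff_supp]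
  refine ⟨fun h => ⟨h.1.fg, h.2.2⟩, fun h => ?_⟩
  have hlf := h.2.isLocallyFinite
  exact ⟨h.1.xfg hlf, hlf, h.2⟩

/-- The morphism of modules defined by an intertwining map. -/
def homOfIntertwines {M N : ModuleCat.{u} (RCA ρ c)} {f : M →ₗ[ℂ] N}
    (hf : Intertwines (moduleOps ρ c M) (moduleOps ρ c N) f) : M ⟶ N :=
  ModuleCat.ofHom hf.toLinearMap

theorem isLocallyFinite_of_hasGenEigenvalue {M : ModuleCat.{u} (RCA ρ c)}
    (h : HasGenEigenvalue ρ c M lam) : IsLocallyFinite ρ c M :=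
  (hasGenEigenvalue_iff.1 h).isLocallyFinite

theorem catO_toModuleCat {M : Type u} [AddCommGroup M] [Module ℂ M]
    {A : Operators ρ (coef ρ c) M} (hfg : A.FG) (h : A.Supp lam) :
    catO ρ c lam A.toModuleCat :=
  catO_iff.2 ⟨hfg.of_surjective A.toModuleCatEquiv_intertwines A.toModuleCatEquiv.surjective,
    h.of_surjective A.toModuleCatEquiv_intertwines A.toModuleCatEquiv.surjective⟩

end Membership

section Functor

variable {V W : Type u} [AddCommGroup V] [Module ℂ V] [FiniteDimensional ℂ V] [Group W]
  [Fintype W] {ρ : Representation ℂ W V} {lam : Dual ℂ V} [Fintype (stab ρ lam)] {c : W → ℂ}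
  (hρ : Function.Injective ρ) (hb : IsParam ρ (coef ρ c))

theorem supp_of_catO (M : CatO ρ c lam) : (moduleOps ρ c M.obj).Supp lam :=
  (catO_iff.1 M.property).2

/-- The operators of the parabolic subalgebra attached to an object of the category. -/
def psiOps (M : CatO ρ c lam) :
    Operators (quotRep ρ lam) (coef (quotRep ρ lam) (resParam ρ lam c))
      (Red hρ hb (supp_of_catO M)) :=
  (redOps hρ hb (supp_of_catO M)).changeParam (coef_quotRep c).symm

/-- The object of the parabolic category attached to an object of the category. -/
def psiObj (M : CatO ρ c lam) : CatO (quotRep ρ lam) (resParam ρ lam c) 0 :=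
  ⟨(psiOps hρ hb M).toModuleCat, catO_toModuleCat
    ((redOps_fg hρ hb _ (catO_iff.1 M.property).1).changeParam _)
    (supp_zero_iff.2 (redOps_isNil hρ hb (supp_of_catO M)))⟩

/-- The inclusion of vector spaces. -/
def psiIncl (M : CatO ρ c lam) : (psiObj hρ hb M).obj →ₗ[ℂ] M.obj :=
  redIncl hρ hb (supp_of_catO M) ∘ₗ (psiOps hρ hb M).toModuleCatEquiv.symm.toLinearMap

theorem psiIncl_injective (M : CatO ρ c lam) : Function.Injective (psiIncl hρ hb M) :=
  (redIncl_injective hρ hb _).comp (psiOps hρ hb M).toModuleCatEquiv.symm.injective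

theorem mem_range_psiIncl {M : CatO ρ c lam} {m : M.obj} :
    m ∈ LinearMap.range (psiIncl hρ hb M) ↔ m ∈ genWeightSpace ρ c M.obj lam ∧
      ∀ y ∈ fixedSpace ρ lam, yGen ρ c y • m = lam y • m :=
  Iff.trans ⟨fun ⟨n, h⟩ => ⟨(psiOps hρ hb M).toModuleCatEquiv.symm n, h⟩,
    fun ⟨n, h⟩ => ⟨(psiOps hρ hb M).toModuleCatEquiv n, h⟩⟩
    (mem_range_redIncl hρ hb (supp_of_catO M))

theorem psiIncl_g (M : CatO ρ c lam) (w : stab ρ lam) (n : (psiObj hρ hb M).obj) :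
    psiIncl hρ hb M (gGen (quotRep ρ lam) (resParam ρ lam c) w • n) =
      gGen ρ c (w : W) • psiIncl hρ hb M n := by
  have h := (psiOps hρ hb M).toModuleCatEquiv_intertwines.symm.g w n
  exact congrArg (redIncl hρ hb (supp_of_catO M)) h

theorem psiIncl_y (M : CatO ρ c lam) (y : V) (n : (psiObj hρ hb M).obj) :
    psiIncl hρ hb M (yGen (quotRep ρ lam) (resParam ρ lam c) (Submodule.Quotient.mk y) • n) =
      yGen ρ c y • psiIncl hρ hb M n - lam y • psiIncl hρ hb M n := by
  have h := (psiOps hρ hb M).toModuleCatEquiv_intertwines.symm.y (Submodule.Quotient.mk y) n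
  exact congrArg (redIncl hρ hb (supp_of_catO M)) h

theorem psiIncl_x (M : CatO ρ c lam) (x : Dual ℂ (V ⧸ fixedSpace ρ lam))
    (n : (psiObj hρ hb M).obj) :
    xGen ρ c (x ∘ₗ (fixedSpace ρ lam).mkQ) • psiIncl hρ hb M n -
      psiIncl hρ hb M (xGen (quotRep ρ lam) (resParam ρ lam c) x • n) ∈
        ⨆ (μ : Dual ℂ V) (_ : μ ≠ lam), genWeightSpace ρ c M.obj μ := by
  have h := (psiOps hρ hb M).toModuleCatEquiv_intertwines.symm.x x n
  have h' : psiIncl hρ hb M (xGen (quotRep ρ lam) (resParam ρ lam c) x • n) =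
      redIncl hρ hb (supp_of_catO M) ((redOps hρ hb (supp_of_catO M)).x x
        ((psiOps hρ hb M).toModuleCatEquiv.symm n)) :=
    congrArg (redIncl hρ hb (supp_of_catO M)) h
  rw [h']
  exact redIncl_x hρ hb (supp_of_catO M) x _

/-- The action of the functor on morphisms, as a linear map. -/
def psiLin {M N : CatO ρ c lam} (f : M ⟶ N) :
    (psiObj hρ hb M).obj →ₗ[ℂ] (psiObj hρ hb N).obj :=
  ((psiOps hρ hb N).toModuleCatEquiv.toLinearMap ∘ₗ
    redMap hρ hb (supp_of_catO M) (supp_of_catO N) (intertwines_of_linear f.hom.hom)) ∘ₗ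
    (psiOps hρ hb M).toModuleCatEquiv.symm.toLinearMap

theorem psiLin_intertwines {M N : CatO ρ c lam} (f : M ⟶ N) :
    Intertwines (moduleOps (quotRep ρ lam) (resParam ρ lam c) (psiObj hρ hb M).obj)
      (moduleOps (quotRep ρ lam) (resParam ρ lam c) (psiObj hρ hb N).obj) (psiLin hρ hb f) :=
  ((psiOps hρ hb N).toModuleCatEquiv_intertwines.comp
    ((redMap_intertwines hρ hb (supp_of_catO M) (supp_of_catO N)
      (intertwines_of_linear f.hom.hom)).changeParam (coef_quotRep c).symm)).comp
    (psiOps hρ hb M).toModuleCatEquiv_intertwines.symm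

/-- The action of the functor on morphisms. -/
def psiMap {M N : CatO ρ c lam} (f : M ⟶ N) : psiObj hρ hb M ⟶ psiObj hρ hb N :=
  ObjectProperty.homMk (homOfIntertwines (psiLin_intertwines hρ hb f))

/-- The functor restricts maps to subspaces, so identities between its morphisms can be checked
after the injective inclusion. -/
theorem psiIncl_psiMap {M N : CatO ρ c lam} (f : M ⟶ N) (n : (psiObj hρ hb M).obj) :
    psiIncl hρ hb N ((psiMap hρ hb f).hom n) = f.hom (psiIncl hρ hb M n) := rfl

/-- The functor to the category of the parabolic subgroup. -/
def psi : CatO ρ c lam ⥤ CatO (quotRep ρ lam) (resParam ρ lam c) 0 where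
  obj := psiObj hρ hb
  map := psiMap hρ hb
  map_id M := by
    ext n
    exact psiIncl_injective hρ hb M rfl
  map_comp {M N P} f g := by
    ext n
    exact psiIncl_injective hρ hb P rfl

instance psi_faithful : (psi (lam := lam) hρ hb).Faithful where
  map_injective {M N} f f' h := by
    have key : f.hom.hom.restrictScalars ℂ = f'.hom.hom.restrictScalars ℂ := by
      refine Intertwines.ext_red hρ hb (supp_of_catO M) (supp_of_catO N)
        (intertwines_of_linear f.hom.hom) (intertwines_of_linear f'.hom.hom) fun n => ?_
      have h1 := psiIncl_psiMap hρ hb f ((psiOps hρ hb M).toModuleCatEquiv n)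
      have h2 := psiIncl_psiMap hρ hb f' ((psiOps hρ hb M).toModuleCatEquiv n)
      have h3 : psiMap hρ hb f = psiMap hρ hb f' := h
      rw [h3] at h1
      exact h1.symm.trans h2
    ext m
    exact LinearMap.congr_fun key m

instance psi_full : (psi (lam := lam) hρ hb).Full where
  map_surjective {M N} φ := by
    let φ' : Red hρ hb (supp_of_catO M) →ₗ[ℂ] Red hρ hb (supp_of_catO N) :=
      ((psiOps hρ hb N).toModuleCatEquiv.symm.toLinearMap ∘ₗ φ.hom.hom.restrictScalars ℂ) ∘ₗ
        (psiOps hρ hb M).toModuleCatEquiv.toLinearMap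
    have hφ : Intertwines (psiOps hρ hb M) (psiOps hρ hb N) φ' :=
      ((psiOps hρ hb N).toModuleCatEquiv_intertwines.symm.comp
        (intertwines_of_linear φ.hom.hom)).comp (psiOps hρ hb M).toModuleCatEquiv_intertwines
    obtain ⟨f, hf, h⟩ := exists_extension_red hρ hb (supp_of_catO M) (supp_of_catO N)
      (φ := φ') ⟨hφ.g, hφ.y, hφ.x⟩
    refine ⟨ObjectProperty.homMk (homOfIntertwines hf), ?_⟩
    ext n
    exact psiIncl_injective hρ hb N (h ((psiOps hρ hb M).toModuleCatEquiv.symm n))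

instance psi_essSurj : (psi (lam := lam) hρ hb).EssSurj where
  mem_essImage N := by
    obtain ⟨hfg, hs⟩ := catO_iff.1 N.property
    let C := (moduleOps (quotRep ρ lam) (resParam ρ lam c) N.obj).changeParam (coef_quotRep c)
    obtain ⟨M, _, _, A, h, hA, e, he⟩ := exists_redOps_equiv hρ hb C (supp_zero_iff.1 hs)
      (hfg.changeParam _)
    let M' : CatO ρ c lam := ⟨A.toModuleCat, catO_toModuleCat hA h⟩
    -- The reduction was computed for `A`, while the functor uses the operators read off from the
    -- module built out of `A`; the canonical intertwiner identifies the two reductions.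
    let e₁ := LinearEquiv.ofBijective _ (redMap_bijective hρ hb h (supp_of_catO M')
      A.toModuleCatEquiv_intertwines A.toModuleCatEquiv.bijective)
    have he₁ : Intertwines (redOps hρ hb h) (redOps hρ hb (supp_of_catO M')) e₁.toLinearMap :=
      redMap_intertwines hρ hb _ _ _
    have h₂ : Intertwines (moduleOps (quotRep ρ lam) (resParam ρ lam c) N.obj) (psiOps hρ hb M')
        (e.trans e₁).toLinearMap := ⟨(he₁.comp he).g, (he₁.comp he).y, (he₁.comp he).x⟩
    have h₃ := (psiOps hρ hb M').toModuleCatEquiv_intertwines.comp h₂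
    have hbij : Function.Bijective h₃.toLinearMap :=
      ((e.trans e₁).trans (psiOps hρ hb M').toModuleCatEquiv).bijective
    exact ⟨M', ⟨(ObjectProperty.isoMk _ (LinearEquiv.ofBijective _ hbij).toModuleIso).symm⟩⟩

instance psi_isEquivalence : (psi (lam := lam) hρ hb).IsEquivalence where

end Functor

end CategoryEquivalence

end Cherednik

end

theorem mainTheorem3 {V W : Type u} [AddCommGroup V] [Module ℂ V] [FiniteDimensional ℂ V]
    [Group W] [Finite W] (ρ : Representation ℂ W V) (hρ : Function.Injective ρ)
    (c : W → ℂ) (hc : ∀ s, Cherednik.IsReflection ρ s → ∀ w, c (w * s * w⁻¹) = c s)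
    (lam : Dual ℂ V) :
    (∀ M : ModuleCat.{u} (Cherednik.RCA ρ c), Cherednik.catO ρ c lam M ↔
      (Cherednik.IsFGOverPoly ρ c M ∧ Cherednik.HasGenEigenvalue ρ c M lam)) ∧
    ∃ (ψ : Cherednik.CatO ρ c lam ≌
        Cherednik.CatO (Cherednik.quotRep ρ lam) (Cherednik.resParam ρ lam c) 0)
      (j : ∀ M : Cherednik.CatO ρ c lam, (ψ.functor.obj M).obj →ₗ[ℂ] M.obj),
      (∀ (M N : Cherednik.CatO ρ c lam) (f : M ⟶ N) (n : (ψ.functor.obj M).obj),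
        j N ((ψ.functor.map f).hom n) = f.hom (j M n)) ∧
      ∀ M : Cherednik.CatO ρ c lam,
        Function.Injective (j M) ∧
        (∀ m : M.obj, m ∈ LinearMap.range (j M) ↔
          m ∈ Cherednik.genWeightSpace ρ c M.obj lam ∧
          ∀ y ∈ Cherednik.fixedSpace ρ lam, Cherednik.yGen ρ c y • m = lam y • m) ∧
        (∀ (w : Cherednik.stab ρ lam) (n : (ψ.functor.obj M).obj),
          j M (Cherednik.gGen (Cherednik.quotRep ρ lam) (Cherednik.resParam ρ lam c) w • n) =
            Cherednik.gGen ρ c (w : W) • j M n) ∧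
        (∀ (y : V) (n : (ψ.functor.obj M).obj),
          j M (Cherednik.yGen (Cherednik.quotRep ρ lam) (Cherednik.resParam ρ lam c)
              (Submodule.Quotient.mk y) • n) =
            Cherednik.yGen ρ c y • j M n - lam y • j M n) ∧
        (∀ (x : Dual ℂ (V ⧸ Cherednik.fixedSpace ρ lam)) (n : (ψ.functor.obj M).obj),
          Cherednik.xGen ρ c (x ∘ₗ (Cherednik.fixedSpace ρ lam).mkQ) • j M n -
            j M (Cherednik.xGen (Cherednik.quotRep ρ lam) (Cherednik.resParam ρ lam c) x • n) ∈
              ⨆ (μ : Dual ℂ V) (_ : μ ≠ lam), Cherednik.genWeightSpace ρ c M.obj μ) := by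
  classical
  have := Fintype.ofFinite W
  have hb := Cherednik.isParam_coef hc
  refine ⟨fun M => ⟨fun h => ⟨h.1, h.2.2⟩, fun h =>
    ⟨h.1, Cherednik.isLocallyFinite_of_hasGenEigenvalue h.2, h.2⟩⟩,
    (Cherednik.psi hρ hb).asEquivalence, Cherednik.psiIncl hρ hb,
    fun M N f n => Cherednik.psiIncl_psiMap hρ hb f n, fun M =>
    ⟨Cherednik.psiIncl_injective hρ hb M, fun m => Cherednik.mem_range_psiIncl hρ hb,
      Cherednik.psiIncl_g hρ hb M, Cherednik.psiIncl_y hρ hb M, Cherednik.psiIncl_x hρ hb M⟩⟩
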